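/- **The system.** A particle of unit mass moves in the half-plane $x_2\ge 1$ under the attraction of the origin, $\ddot x=-x/|x|^3$, and is reflected elastically at the wall $x_2=1$ ($p_2\mapsto -p_2$). Momenta $(p_1,\pm p_2)$ at a point of the wall are identified in the phase space, and a particle grazing the wall ($x_2=1$, $p_2=0$) moves along the wall by $\ddot x_1=-x_1/|x|^3$. With $L=x_1p_2-x_2p_1$ and $A=p\times L-x/|x|=(A_1,A_2)$, the energy $E=\frac12|p|^2-\frac1{|x|}$ and $D=L^2-2A_2$ are integrals of motion; $X(D,E)$ denotes the set of states of the phase space with given real values $D$, $E$. Only bounded motion, $E<0$, is considered. $X(D,E)$ is called singular if $D^2=4$, or $1+2DE+4E^2=0$, or $D+2E=0$. Put $R=\sqrt{1+2DE+4E^2}$, and let $\mathcal E_+$ be the conic $$\frac{x_1^2}{\left(\frac{R+1}{2E}\right)^2-1}+\frac{(x_2-1)^2}{\left(\frac{R+1}{2E}\right)^2}=1 .$$ A set of states is a single closed orbit if it is traversed by one non-constant periodic trajectory, and every trajectory meeting it is a time translate of that one. **Theorem 4.1.** 1. If $D+2E=0$ and $0<D<2$, then $X(D,E)$ is a single closed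 orbit: motion along the wall, which traces the minor axis of the ellipse $\mathcal E_+$. It is a limiting motion: there are bouncing (non-sliding) trajectories whose initial states tend to the initial state of the orbit, and every sequence of such trajectories converges to it, uniformly on bounded time intervals. 2. If $1+2DE+4E^2=0$, $D>2$ and $E>-\frac12$, then $X(D,E)$ is a single closed orbit. It is $2$-periodic (two reflections per minimal period) and traces the part in $x_2\ge1$ of an ellipse whose minor axis lies on the wall, centred at $(0,1)$. 3. If $D=2$ and $-1<E<-\frac12$, then $X(D,E)$ is a single closed orbit, which traces the segment of the $x_2$-axis from the wall point $(0,1)$ to $(0,-1/E)$. 4. If $D=2$ and $-\frac12<E<0$, then $X(D,E)$ is the disjoint union of a single closed orbit $K$, which traces the segment of the $x_2$-axis from $(0,1)$ to $(0,-1/E)$, and a separatrix $W$ of $K$: a non-empty connected invariant set, with a trajectory through each of its states, such that the distance to $K$ tends to $0$ along each of its trajectories both as $t\to+\infty$ and as $t\to-\infty$. All arcs of the trajectories in $W$ are arcs of non-degenerate Kepler ellipses (one focus at the origin, major axis of length $-1/E$) and contain the point $\mathcal F(0,2)$. 5. Every non-empty singular level set $X(D,E)$ with $E<0$ is one of those in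 1–4, except possibly for $(D,E)=(2,-1)$ and $(D,E)=(2,-\frac12)$. -/

import Mathlib

open Set Filter Topology

noncomputable section

namespace Boltzmann

/-- A state `s` of the particle: position `s.1 = (x₁, x₂)` and momentum `s.2 = (p₁, p₂)`
(unit mass, unit gravitational parameter). -/
abbrev State := (ℝ × ℝ) × (ℝ × ℝ)

/-- Euclidean length in the plane (the built-in norm of `ℝ × ℝ` is the sup norm). -/
def len (x : ℝ × ℝ) : ℝ := Real.sqrt (x.1 ^ 2 + x.2 ^ 2)

/-- Total energy `E = |p|² / 2 - 1 / |x|`. -/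
def energy (s : State) : ℝ := (s.2.1 ^ 2 + s.2.2 ^ 2) / 2 - 1 / len s.1

/-- Angular momentum `L = x₁ p₂ - x₂ p₁`. -/
def angMom (s : State) : ℝ := s.1.1 * s.2.2 - s.1.2 * s.2.1

/-- Second component of the Laplace-Runge-Lenz vector `A = p × L - x / |x|`. -/
def lrl₂ (s : State) : ℝ := -s.2.1 * angMom s - s.1.2 / len s.1

/-- The additional integral `D = L² - 2 A₂`. -/
def integralD (s : State) : ℝ := angMom s ^ 2 - 2 * lrl₂ s

/-- The phase space. The wall is `x₂ = 1`, the particle lives in `x₂ ≥ 1`. At the wall the momentum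
`(p₁, -p₂)` before a reflection is identified with the momentum `(p₁, p₂)` after it, and the class
is represented by the outgoing one, `p₂ ≥ 0`. -/
def phaseSpace : Set State := {s | 1 ≤ s.1.2 ∧ (s.1.2 = 1 → 0 ≤ s.2.2)}

/-- The identification of incoming and outgoing states at the wall. The quotient topology it
induces is the topology of the phase space. -/
def wallSetoid : Setoid State where
  r s s' := s = s' ∨
    (s.1 = s'.1 ∧ s.1.2 = 1 ∧ s.2.1 = s'.2.1 ∧ s.2.2 = -s'.2.2)
  iseqv := by
    refine ⟨fun _ => Or.inl rfl, ?_, ?_⟩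
    · rintro s s' (h | ⟨h1, h2, h3, h4⟩)
      · exact Or.inl h.symm
      · exact Or.inr ⟨h1.symm, h1 ▸ h2, h3.symm, by rw [h4, neg_neg]⟩
    · rintro s s' s'' (rfl | ⟨h1, h2, h3, h4⟩) (h | ⟨k1, k2, k3, k4⟩)
      · exact Or.inl h
      · exact Or.inr ⟨k1, k2, k3, k4⟩
      · exact h ▸ Or.inr ⟨h1, h2, h3, h4⟩
      · refine Or.inl (Prod.ext (h1.trans k1) (Prod.ext (h3.trans k3) ?_))
        rw [h4, k4, neg_neg]

/-- The class of a state modulo the identification at the wall. -/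
def glue (s : State) : Quotient wallSetoid := Quotient.mk wallSetoid s

/-- The level set of the two integrals in the phase space. -/
def levelSet (D E : ℝ) : Set State :=
  {s | s ∈ phaseSpace ∧ energy s = E ∧ integralD s = D}

/-- A trajectory of the Boltzmann system, defined for all times: Kepler motion
`x'' = -x / |x|³` above the wall and elastic reflection `p₂ ↦ -p₂` at the wall. The wall is
horizontal, so it never acts on `x₁` and `p₁`, which follow Kepler's equation at all times. At a
time of contact with the wall the recorded momentum is the outgoing one, and the momentum just
before the contact is its mirror image. If `p₂ = 0` at a contact (grazing), gravity presses the
particle to the wall and these equations leave only the motion along the wall. -/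
structure IsTrajectory (z : ℝ → State) : Prop where
  above_wall : ∀ t, 1 ≤ (z t).1.2
  deriv_x₁ : ∀ t, HasDerivAt (fun s => (z s).1.1) (z t).2.1 t
  deriv_p₁ : ∀ t, HasDerivAt (fun s => (z s).2.1) (-(z t).1.1 / len (z t).1 ^ 3) t
  continuous_x₂ : Continuous fun t => (z t).1.2
  deriv_x₂ : ∀ t, 1 < (z t).1.2 → HasDerivAt (fun s => (z s).1.2) (z t).2.2 t
  deriv_p₂ : ∀ t, 1 < (z t).1.2 →
    HasDerivAt (fun s => (z s).2.2) (-(z t).1.2 / len (z t).1 ^ 3) t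
  reflection : ∀ t, (z t).1.2 = 1 → 0 ≤ (z t).2.2 ∧
    Tendsto (fun s => (z s).2.2) (𝓝[<] t) (𝓝 (-(z t).2.2)) ∧
    Tendsto (fun s => (z s).2.2) (𝓝[>] t) (𝓝 (z t).2.2)

/-- The curve in the plane traced by the particle. -/
def trace (z : ℝ → State) : Set (ℝ × ℝ) := range fun t => (z t).1

/-- `K` is a single closed orbit: it is traversed by the trajectory `z`, periodic with minimal
period `T > 0` and not passing twice through a state within a period, and every trajectory that
meets `K` is a time translate of `z`. -/
structure IsClosedOrbit (z : ℝ → State) (T : ℝ) (K : Set State) : Prop where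
  trajectory : IsTrajectory z
  period_pos : 0 < T
  periodic : Function.Periodic z T
  injOn : InjOn z (Ico 0 T)
  range_eq : range z = K
  unique : ∀ w, IsTrajectory w → ∀ t₀, w t₀ ∈ K → ∃ c, ∀ t, w t = z (t + c)

/-- A sequence of bouncing (i.e. not sliding along the wall) trajectories whose initial states
converge to the state `s`. -/
def IsBouncingApprox (w : ℕ → ℝ → State) (s : State) : Prop :=
  (∀ n, IsTrajectory (w n) ∧ ¬((w n 0).1.2 = 1 ∧ (w n 0).2.2 = 0)) ∧
    Tendsto (fun n => w n 0) atTop (𝓝 s)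

/-- `z` is the limiting motion of bouncing trajectories: there are bouncing trajectories whose
initial states converge to `z 0`, and all such converge to `z`, uniformly on bounded times. -/
def IsBouncingLimit (z : ℝ → State) : Prop :=
  (∃ w, IsBouncingApprox w (z 0)) ∧
    ∀ w, IsBouncingApprox w (z 0) → TendstoLocallyUniformly w z atTop

/-- `R = √(1 + 2DE + 4E²)`. -/
def radiusR (D E : ℝ) : ℝ := Real.sqrt (1 + 2 * D * E + 4 * E ^ 2)

/-- The caustic `𝓔₊`, with foci `(0,0)` and `(0,2)`. -/
def causticPlus (D E : ℝ) : Set (ℝ × ℝ) :=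
  {x | x.1 ^ 2 / (((radiusR D E + 1) / (2 * E)) ^ 2 - 1)
      + (x.2 - 1) ^ 2 / ((radiusR D E + 1) / (2 * E)) ^ 2 = 1}

/-- The ellipse centred at the point `(0,1)` of the wall, with semi-axis `a` along the wall and
vertical semi-axis `b`. -/
def wallEllipse (a b : ℝ) : Set (ℝ × ℝ) :=
  {x | x.1 ^ 2 / a ^ 2 + (x.2 - 1) ^ 2 / b ^ 2 = 1}

/-- The ellipse with one focus at the origin, the other at `f`, and major axis of length `ℓ`
(non-degenerate if the distance `len f` between the foci is less than `ℓ`). -/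
def keplerEllipse (f : ℝ × ℝ) (ℓ : ℝ) : Set (ℝ × ℝ) := {x | len x + len (x - f) = ℓ}

/-- Between times `t₁ < t₂` the trajectory `z` runs through one arc: it is on the wall at `t₁` and
`t₂` and above it in between. -/
def IsArc (z : ℝ → State) (t₁ t₂ : ℝ) : Prop :=
  t₁ < t₂ ∧ (z t₁).1.2 = 1 ∧ (z t₂).1.2 = 1 ∧ ∀ t ∈ Ioo t₁ t₂, 1 < (z t).1.2

/-- `W` is a separatrix of `K`: a connected (in the phase space) invariant set, filled by
trajectories which approach `K` both for `t → +∞` and for `t → -∞`. -/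
structure IsSeparatrix (K W : Set State) : Prop where
  disjoint : Disjoint K W
  connected : IsConnected (glue '' W)
  exists_trajectory : ∀ s ∈ W, ∃ w, IsTrajectory w ∧ w 0 = s
  invariant : ∀ w, IsTrajectory w → w 0 ∈ W → ∀ t, w t ∈ W
  forward : ∀ w, IsTrajectory w → w 0 ∈ W →
    Tendsto (fun t => Metric.infDist (w t) K) atTop (𝓝 0)
  backward : ∀ w, IsTrajectory w → w 0 ∈ W →
    Tendsto (fun t => Metric.infDist (w t) K) atBot (𝓝 0)

/-- All arcs of the trajectory `w` of energy `E` are arcs of non-degenerate Kepler ellipses (one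
focus at the origin, major axis `-1 / E`) and pass through the point `(0,2)`. -/
def ArcsThroughF (w : ℝ → State) (E : ℝ) : Prop :=
  ∀ t, ∃ t₁ t₂, t₁ ≤ t ∧ t < t₂ ∧ IsArc w t₁ t₂ ∧
    (∃ f, len f < -1 / E ∧ ∀ s ∈ Icc t₁ t₂, (w s).1 ∈ keplerEllipse f (-1 / E)) ∧
    ∃ s ∈ Ioo t₁ t₂, (w s).1 = (0, 2)

/-- The pair `(D, E)` violates the conditions under which the level set is a smooth curve of
genus one. -/
def IsSingularPair (D E : ℝ) : Prop :=
  ¬(D ^ 2 ≠ 4 ∧ 1 + 2 * E * D + 4 * E ^ 2 ≠ 0 ∧ D + 2 * E ≠ 0)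

end Boltzmann

end

/-!
Above the wall the vector `A` and the angular momentum `L` are constant; at a contact they jump, but
`D` and `E` survive. The sum `D + 2E` is nonnegative and vanishes exactly for grazing states
(`grazing_eq_zero_iff`). Hence a trajectory either slides along the wall for all times
(`IsTrajectory.slides`), where it obeys a Lipschitz equation on the line, or its contacts are
transversal and isolated. In both cases it is determined by one of its states
(`IsTrajectory.unique`), and for `E < 0` a state which does not graze lies on a trajectory made of a
two-sided infinite sequence of Kepler arcs (`exists_trajectory`).

By uniqueness, a level set is a single closed orbit as soon as it is the range of one simple periodic
trajectory (`isClosedOrbit_of_clock`). Such a trajectory is written down as a curve in an angle `φ`,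
and the law of motion `φ = θ(t)` is the solution of the scalar equation `θ' = 1 / ω(θ)`
(`exists_periodic_clock`). This gives

* the sliding motion for `D + 2E = 0` (`wall_orbit`). A bouncing motion with small `D + 2E` stays
  close to the wall and its projection nearly solves the sliding equation, so Grönwall's inequality
  yields the convergence (`tendsto_slide`);
* the ellipse for `R = 0` (`ellipse_orbit`): `R` is the distance of `A` from `(0, 2E)`, so that here
  `A = (0, 2E)` and the Kepler ellipse has its centre at `(0,1)` and is symmetric to the wall;
* the vertical orbit for `D = 2` (`vertical_orbit`), which consists of the states with `L = 0`. From
  `4 A₁² = 4 (1 + 2E) L² - L⁴` there are no other states for `E < -1/2` (`levelSet_two_eq`).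

For `D = 2` and `-1/2 < E < 0` the separatrix consists of the states with `L ≠ 0`. Let
`k = √(1 + 2E)`. The ratio `ρ = (k L + A₁) / (k L - A₁)` is constant on an arc, and a reflection
multiplies it by the constant `((M - k) / (M + k))² < 1`, where `M = √(D + 2E) = √(1 + k²)`
(`reflectionRatio_mirror`). So `ρ` tends to `0` or `∞` along the trajectory, and
`L² = 16 k² ρ / (1 + ρ)²` tends to `0` (`tendsto_angMom`). By compactness this means convergence to the
vertical orbit (`tendsto_infDist`). The equation of the conic shows that each arc crosses the
`x₂`-axis at `(0,2)` (`arc_crosses_axis`). As `L` changes its sign at contacts, every trajectory passes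
through `(0,2)` from left to right; the states there which do so form a half circle, and the
separatrix is connected (`isConnected_separatrix`).
-/

open Set Filter Topology

noncomputable section

namespace Boltzmann

/-! ### Change of the time variable -/

/-- Solution of the scalar equation `θ' = 1 / ω(θ)`, `θ(0) = 0`, for a continuous `ω` bounded below
by a positive constant: it is the inverse function of `u ↦ ∫₀ᵘ ω`. -/
theorem exists_clock {ω : ℝ → ℝ} (hc : Continuous ω) {m : ℝ} (hm : 0 < m) (hω : ∀ u, m ≤ ω u) :
    ∃ θ : ℝ → ℝ, θ 0 = 0 ∧ StrictMono θ ∧ Function.Surjective θ ∧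
      (∀ t, HasDerivAt θ (1 / ω (θ t)) t) ∧ ∀ t, ∫ u in (0 : ℝ)..θ t, ω u = t := by
  set F : ℝ → ℝ := fun u => ∫ v in (0 : ℝ)..u, ω v with hF
  have hF0 : F 0 = 0 := by simp [hF]
  have hder : ∀ u, HasDerivAt F (ω u) u := fun u => (hc.integral_hasStrictDerivAt 0 u).hasDerivAt
  have hpos : ∀ u, 0 < ω u := fun u => hm.trans_le (hω u)
  have hmono : StrictMono F := strictMono_of_deriv_pos fun u => by
    rw [(hder u).deriv]; exact hpos u
  have hcont : Continuous F := continuous_iff_continuousAt.2 fun u => (hder u).continuousAt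
  have hG : Monotone fun u => F u - m * u := by
    have hd : ∀ u, HasDerivAt (fun u => F u - m * u) (ω u - m * 1) u := fun u =>
      (hder u).sub ((hasDerivAt_id u).const_mul m)
    refine monotone_of_deriv_nonneg (fun u => (hd u).differentiableAt) fun u => ?_
    rw [(hd u).deriv]; linarith [hω u]
  have htop : Tendsto F atTop atTop := by
    refine tendsto_atTop_mono' _ ?_ (tendsto_id.const_mul_atTop hm)
    filter_upwards [eventually_ge_atTop 0] with u hu
    have := hG hu
    simp only [hF0] at this
    simp only [id]; linarith
  have hbot : Tendsto F atBot atBot := by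
    refine tendsto_atBot_mono' _ ?_ (tendsto_id.const_mul_atBot hm)
    filter_upwards [eventually_le_atBot 0] with u hu
    have := hG hu
    simp only [hF0] at this
    simp only [id]; linarith
  have hsurj : Function.Surjective F := hcont.surjective htop hbot
  set e := hmono.orderIsoOfSurjective F hsurj with he
  have heF : ∀ u, e u = F u := fun u => rfl
  have hFe : ∀ t, F (e.symm t) = t := fun t => e.apply_symm_apply t
  refine ⟨e.symm, ?_, e.symm.strictMono, e.symm.surjective, fun t => ?_, hFe⟩
  · apply hmono.injective
    rw [hFe, hF0]
  · have := HasDerivAt.of_local_left_inverse (f := F) (g := e.symm) (a := t)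
      e.symm.continuous.continuousAt (hder (e.symm t)) (hpos _).ne'
      (Eventually.of_forall hFe)
    simpa [one_div] using this

/-- If the speed `1 / ω` is periodic, the solution of `exists_clock` is a periodic motion. -/
theorem exists_periodic_clock {ω : ℝ → ℝ} (hc : Continuous ω) {m : ℝ} (hm : 0 < m)
    (hω : ∀ u, m ≤ ω u) {P : ℝ} (hP : 0 < P) (hper : Function.Periodic ω P) :
    ∃ (θ : ℝ → ℝ) (T : ℝ), 0 < T ∧ θ 0 = 0 ∧ StrictMono θ ∧ Function.Surjective θ ∧
      (∀ t, HasDerivAt θ (1 / ω (θ t)) t) ∧ (∀ t, θ (t + T) = θ t + P) := by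
  obtain ⟨θ, h0, hmono, hsurj, hd, hint⟩ := exists_clock hc hm hω
  obtain ⟨T, hT⟩ := hsurj P
  refine ⟨θ, T, ?_, h0, hmono, hsurj, hd, fun t => ?_⟩
  · rw [← hmono.lt_iff_lt, h0, hT]; exact hP
  · obtain ⟨t', ht'⟩ := hsurj (θ t + P)
    rw [← ht']
    congr 1
    have h1 := hint t'
    rw [ht', ← intervalIntegral.integral_add_adjacent_intervals
      (b := θ t) (hc.intervalIntegrable _ _) (hc.intervalIntegrable _ _), hint t] at h1
    have h2 := hper.intervalIntegral_add_eq 0 (θ t)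
    have h3 := hint T
    rw [hT] at h3
    rw [zero_add, h3] at h2
    linarith

/-! ### Kepler's equation and its first integrals -/

/-- Mirror image in the wall of the momentum. -/
def mirror (s : State) : State := (s.1, (s.2.1, -s.2.2))

/-- The vector field of Kepler's equation, for states. -/
def kepler (s : State) : State := (s.2, (-s.1.1 / len s.1 ^ 3, -s.1.2 / len s.1 ^ 3))

/-- First component of the Laplace-Runge-Lenz vector. -/
def lrl₁ (s : State) : ℝ := s.2.2 * angMom s - s.1.1 / len s.1

/-- `D + 2E`, which vanishes exactly for a particle grazing the wall. -/
def grazing (s : State) : ℝ := integralD s + 2 * energy s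

theorem len_sq (x : ℝ × ℝ) : len x ^ 2 = x.1 ^ 2 + x.2 ^ 2 :=
  Real.sq_sqrt (by positivity)

theorem len_nonneg (x : ℝ × ℝ) : 0 ≤ len x := Real.sqrt_nonneg _

theorem le_len {x : ℝ × ℝ} : x.2 ≤ len x := Real.le_sqrt_of_sq_le (by nlinarith [sq_nonneg x.1])

theorem len_pos {x : ℝ × ℝ} (h : 1 ≤ x.2) : 0 < len x := by
  linarith [le_len (x := x)]

@[fun_prop]
theorem continuous_len : Continuous len := by unfold len; fun_prop

theorem energy_eq (s : State) : energy s = (s.2.1 ^ 2 + s.2.2 ^ 2) / 2 - 1 / len s.1 := rfl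

/-- `D + 2E` is a sum of terms which are nonnegative above the wall. -/
theorem grazing_eq {s : State} (h : 1 ≤ s.1.2) : grazing s =
    (s.1.1 * s.2.2 - (s.1.2 - 1) * s.2.1) ^ 2 + s.2.2 ^ 2 + 2 * (s.1.2 - 1) / len s.1 := by
  have := (len_pos h).ne'
  unfold grazing integralD lrl₂ energy angMom
  field_simp
  ring

theorem grazing_nonneg {s : State} (h : 1 ≤ s.1.2) : 0 ≤ grazing s := by
  rw [grazing_eq h]
  have := len_pos h
  have : 0 ≤ s.1.2 - 1 := by linarith
  positivity

theorem grazing_eq_zero_iff {s : State} (h : 1 ≤ s.1.2) :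
    grazing s = 0 ↔ s.1.2 = 1 ∧ s.2.2 = 0 := by
  constructor
  · intro h0
    rw [grazing_eq h] at h0
    have h1 := len_pos h
    have h2 : 0 ≤ s.1.2 - 1 := by linarith
    have h3 : 0 ≤ 2 * (s.1.2 - 1) / len s.1 := by positivity
    have h6 := sq_nonneg s.2.2
    have h7 := sq_nonneg (s.1.1 * s.2.2 - (s.1.2 - 1) * s.2.1)
    have h4 : 2 * (s.1.2 - 1) / len s.1 = 0 := by linarith
    have h5 : s.2.2 ^ 2 = 0 := by linarith
    refine ⟨?_, by simpa using h5⟩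
    rw [div_eq_zero_iff] at h4
    rcases h4 with h4 | h4
    · linarith
    · exact absurd h4 h1.ne'
  · rintro ⟨h1, h2⟩
    rw [grazing_eq h, h1, h2]; simp

theorem energy_mirror (s : State) : energy (mirror s) = energy s := by simp [energy, mirror]

theorem integralD_mirror {s : State} (h : s.1.2 = 1) : integralD (mirror s) = integralD s := by
  simp [integralD, lrl₂, angMom, mirror, h]; ring

theorem mirror_mirror (s : State) : mirror (mirror s) = s := by simp [mirror]

/-- The eccentricity `|A|` of the Kepler conic through a state. -/
theorem lrl_sq {s : State} (h : 1 ≤ s.1.2) :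
    lrl₁ s ^ 2 + lrl₂ s ^ 2 = 1 + 2 * energy s * angMom s ^ 2 := by
  have h1 := len_pos h
  have h2 := len_sq s.1
  unfold lrl₁ lrl₂ energy angMom
  field_simp
  linear_combination -h2

/-- The equation of the Kepler conic through a state. -/
theorem len_eq_conic {s : State} (h : 1 ≤ s.1.2) :
    len s.1 = angMom s ^ 2 - lrl₁ s * s.1.1 - lrl₂ s * s.1.2 := by
  have h1 := len_pos h
  have h2 := len_sq s.1
  unfold lrl₁ lrl₂ angMom
  field_simp
  linear_combination h2

/-- `R` is the distance of the vector `A` from the point `(0, 2E)`. -/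
theorem radius_sq {s : State} (h : 1 ≤ s.1.2) :
    1 + 2 * integralD s * energy s + 4 * energy s ^ 2 =
      lrl₁ s ^ 2 + (lrl₂ s - 2 * energy s) ^ 2 := by
  have := lrl_sq h
  unfold integralD
  linear_combination -this

theorem hasDerivAt_state {y : ℝ → State} {v : State} {t : ℝ} :
    HasDerivAt y v t ↔ (HasDerivAt (fun s => (y s).1.1) v.1.1 t ∧
      HasDerivAt (fun s => (y s).1.2) v.1.2 t) ∧
      HasDerivAt (fun s => (y s).2.1) v.2.1 t ∧ HasDerivAt (fun s => (y s).2.2) v.2.2 t := by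
  constructor
  · intro h
    have h1 : HasDerivAt (fun s => (y s).1) v.1 t := h.fst
    have h2 : HasDerivAt (fun s => (y s).2) v.2 t := h.snd
    exact ⟨⟨h1.fst, h1.snd⟩, h2.fst, h2.snd⟩
  · rintro ⟨⟨h1, h2⟩, h3, h4⟩
    exact (h1.prodMk h2).prodMk (h3.prodMk h4)

theorem hasDerivAt_len {x : ℝ → ℝ × ℝ} {a b : ℝ} {t : ℝ} (h1 : HasDerivAt (fun s => (x s).1) a t)
    (h2 : HasDerivAt (fun s => (x s).2) b t) (h : 0 < len (x t)) :
    HasDerivAt (fun s => len (x s)) (((x t).1 * a + (x t).2 * b) / len (x t)) t := by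
  have h3 : (x t).1 ^ 2 + (x t).2 ^ 2 ≠ 0 := by rw [← len_sq]; positivity
  have := ((h1.pow 2).add (h2.pow 2)).sqrt h3
  refine this.congr_deriv ?_
  change _ / (2 * len (x t)) = _
  field_simp
  norm_num
  ring

section integrals
variable {y : ℝ → State} {t : ℝ}

theorem hasDerivAt_angMom (h : HasDerivAt y (kepler (y t)) t) :
    HasDerivAt (fun s => angMom (y s)) 0 t := by
  obtain ⟨⟨h1, h2⟩, h3, h4⟩ := hasDerivAt_state.1 h
  refine ((h1.mul h4).sub (h2.mul h3)).congr_deriv ?_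
  simp only [kepler]; ring

theorem hasDerivAt_lrl₁ (h : HasDerivAt y (kepler (y t)) t) (hw : 1 ≤ (y t).1.2) :
    HasDerivAt (fun s => lrl₁ (y s)) 0 t := by
  have hL := hasDerivAt_angMom h
  obtain ⟨⟨h1, h2⟩, h3, h4⟩ := hasDerivAt_state.1 h
  have hp := len_pos hw
  have hl := hasDerivAt_len h1 h2 hp
  refine ((h4.mul hL).sub (h1.div hl hp.ne')).congr_deriv ?_
  simp only [kepler, angMom]
  have := len_sq (y t).1
  field_simp
  linear_combination (-(y t).2.1) * this

theorem hasDerivAt_lrl₂ (h : HasDerivAt y (kepler (y t)) t) (hw : 1 ≤ (y t).1.2) :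
    HasDerivAt (fun s => lrl₂ (y s)) 0 t := by
  have hL := hasDerivAt_angMom h
  obtain ⟨⟨h1, h2⟩, h3, h4⟩ := hasDerivAt_state.1 h
  have hp := len_pos hw
  have hl := hasDerivAt_len h1 h2 hp
  refine ((h3.neg.mul hL).sub (h2.div hl hp.ne')).congr_deriv ?_
  simp only [kepler, angMom]
  have := len_sq (y t).1
  field_simp
  linear_combination (-(y t).2.2) * this

theorem hasDerivAt_energy (h : HasDerivAt y (kepler (y t)) t) (hw : 1 ≤ (y t).1.2) :
    HasDerivAt (fun s => energy (y s)) 0 t := by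
  obtain ⟨⟨h1, h2⟩, h3, h4⟩ := hasDerivAt_state.1 h
  have hp := len_pos hw
  have hl := hasDerivAt_len h1 h2 hp
  refine ((((h3.pow 2).add (h4.pow 2)).div_const 2).sub
    ((hasDerivAt_const t (1 : ℝ)).div hl hp.ne')).congr_deriv ?_
  simp only [kepler]
  field_simp
  ring

theorem hasDerivAt_integralD (h : HasDerivAt y (kepler (y t)) t) (hw : 1 ≤ (y t).1.2) :
    HasDerivAt (fun s => integralD (y s)) 0 t := by
  refine (((hasDerivAt_angMom h).pow 2).sub ((hasDerivAt_lrl₂ h hw).const_mul 2)).congr_deriv ?_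
  simp

end integrals

/-! ### Local uniqueness for Kepler's equation -/

/-- Reversal of the velocity, which conjugates the motion to the reversed motion. -/
def reverse (s : State) : State := (s.1, (-s.2.1, -s.2.2))

theorem reverse_reverse (s : State) : reverse (reverse s) = s := by simp [reverse]

theorem continuous_reverse : Continuous reverse := by unfold reverse; fun_prop

theorem hasDerivAt_reverse {y : ℝ → State} {t : ℝ} (h : HasDerivAt y (kepler (y (-t))) (-t)) :
    HasDerivAt (fun s => reverse (y (-s))) (kepler (reverse (y (-t)))) t := by
  obtain ⟨⟨h1, h2⟩, h3, h4⟩ := hasDerivAt_state.1 h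
  have hn : HasDerivAt (fun s : ℝ => -s) (-1) t := hasDerivAt_neg t
  refine hasDerivAt_state.2 ⟨⟨?_, ?_⟩, ?_, ?_⟩
  · exact (HasDerivAt.comp t h1 hn).congr_deriv (by simp [kepler, reverse])
  · exact (HasDerivAt.comp t h2 hn).congr_deriv (by simp [kepler, reverse])
  · exact (HasDerivAt.comp t h3 hn).neg.congr_deriv (by simp [kepler, reverse])
  · exact (HasDerivAt.comp t h4 hn).neg.congr_deriv (by simp [kepler, reverse])

theorem contDiffAt_kepler {s : State} (h : 1 ≤ s.1.2) : ContDiffAt ℝ 1 kepler s := by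
  have hl : ContDiffAt ℝ 1 (fun s : State => len s.1) s := by
    unfold len
    refine ContDiffAt.sqrt (by fun_prop) ?_
    have := len_pos h
    rw [← len_sq]; positivity
  have h3 : len s.1 ^ 3 ≠ 0 := (pow_pos (len_pos h) 3).ne'
  unfold kepler
  refine contDiffAt_snd.prodMk (ContDiffAt.prodMk ?_ ?_)
  · exact ContDiffAt.div (by fun_prop) (hl.pow 3) h3
  · exact ContDiffAt.div (by fun_prop) (hl.pow 3) h3

/-- Two motions after the time `t` which have the same limit at `t` agree for a while. Nothing is
assumed of their values at `t`, nor of the motion before `t`. -/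
theorem kepler_unique_right {f g : ℝ → State} {t : ℝ} {s₀ : State} (hs : 1 ≤ s₀.1.2)
    (hf : Tendsto f (𝓝[>] t) (𝓝 s₀)) (hg : Tendsto g (𝓝[>] t) (𝓝 s₀))
    (hf' : ∀ᶠ s in 𝓝[>] t, HasDerivAt f (kepler (f s)) s)
    (hg' : ∀ᶠ s in 𝓝[>] t, HasDerivAt g (kepler (g s)) s) : ∀ᶠ s in 𝓝[>] t, f s = g s := by
  obtain ⟨K, U, hU, hK⟩ := (contDiffAt_kepler hs).exists_lipschitzOnWith
  -- a solution with limit `s₀` at `t`, given the value `s₀` at `t`, solves the equation from `t` on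
  have key : ∀ f : ℝ → State, Tendsto f (𝓝[>] t) (𝓝 s₀) →
      (∀ᶠ s in 𝓝[>] t, HasDerivAt f (kepler (f s)) s) →
      ∃ b > t, ContinuousOn (Function.update f t s₀) (Icc t b) ∧
        (∀ s ∈ Ico t b, HasDerivWithinAt (Function.update f t s₀)
          (kepler (Function.update f t s₀ s)) (Ici s) s) ∧
        ∀ s ∈ Ico t b, Function.update f t s₀ s ∈ U := by
    intro f hf hf'
    have hfU : ∀ᶠ s in 𝓝[>] t, f s ∈ U := hf hU
    obtain ⟨b, hb, hbs⟩ := mem_nhdsGT_iff_exists_Ioc_subset.1 (hf'.and hfU)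
    have hev : ∀ s, t < s → Function.update f t s₀ =ᶠ[𝓝 s] f := fun s hs => by
      filter_upwards [lt_mem_nhds hs] with u hu
      exact Function.update_of_ne hu.ne' _ _
    have hne : ∀ s, t < s → Function.update f t s₀ s = f s := fun s hs =>
      Function.update_of_ne hs.ne' _ _
    have hd : ∀ s, t < s → s ≤ b → HasDerivAt (Function.update f t s₀)
        (kepler (Function.update f t s₀ s)) s := fun s h1 h2 => by
      rw [hne s h1]
      exact (hbs ⟨h1, h2⟩).1.congr_of_eventuallyEq (hev s h1)
    have hcont : ContinuousWithinAt (Function.update f t s₀) (Ioi t) t := by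
      rw [ContinuousWithinAt, Function.update_self]
      refine hf.congr' ?_
      filter_upwards [self_mem_nhdsWithin] with u hu using (hne u hu).symm
    refine ⟨b, hb, ?_, ?_, ?_⟩
    · intro s hs
      rcases hs.1.eq_or_lt with rfl | h
      · exact (continuousWithinAt_Ioi_iff_Ici.1 hcont).mono Icc_subset_Ici_self
      · exact (hd s h hs.2).continuousAt.continuousWithinAt
    · intro s hs
      rcases hs.1.eq_or_lt with rfl | h
      · refine hasDerivWithinAt_Ici_of_tendsto_deriv (s := Ioc t b)
          (fun u hu => (hd u hu.1 hu.2).differentiableAt.differentiableWithinAt)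
          (hcont.mono fun u hu => hu.1) (Ioc_mem_nhdsGT hb) ?_
        rw [Function.update_self]
        have h2 : Tendsto (fun u => kepler (f u)) (𝓝[>] t) (𝓝 (kepler s₀)) :=
          (contDiffAt_kepler ‹_›).continuousAt.tendsto.comp hf
        refine h2.congr' ?_
        filter_upwards [Ioc_mem_nhdsGT hb] with u hu
        rw [(hd u hu.1 hu.2).deriv, hne u hu.1]
      · exact (hd s h hs.2.le).hasDerivWithinAt
    · intro s hs
      rcases hs.1.eq_or_lt with rfl | h
      · rw [Function.update_self]; exact mem_of_mem_nhds hU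
      · rw [hne s h]; exact (hbs ⟨h, hs.2.le⟩).2
  obtain ⟨b, hb, h1, h2, h3⟩ := key f hf hf'
  obtain ⟨c, hc, k1, k2, k3⟩ := key g hg hg'
  have hm := lt_min hb hc
  have hb' : Ico t (min b c) ⊆ Ico t b := Ico_subset_Ico_right (min_le_left _ _)
  have hc' : Ico t (min b c) ⊆ Ico t c := Ico_subset_Ico_right (min_le_right _ _)
  have := ODE_solution_unique_of_mem_Icc_right (v := fun _ => kepler) (s := fun _ => U)
    (a := t) (b := min b c) (fun _ _ => hK)
    (h1.mono (Icc_subset_Icc_right (min_le_left _ _))) (fun s hs => h2 s (hb' hs))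
    (fun s hs => h3 s (hb' hs))
    (k1.mono (Icc_subset_Icc_right (min_le_right _ _))) (fun s hs => k2 s (hc' hs))
    (fun s hs => k3 s (hc' hs)) (by simp)
  filter_upwards [Ioc_mem_nhdsGT hm] with s hs
  have h := this (Ioc_subset_Icc_self hs)
  rwa [Function.update_of_ne hs.1.ne', Function.update_of_ne hs.1.ne'] at h

theorem kepler_unique_left {f g : ℝ → State} {t : ℝ} {s₀ : State} (hs : 1 ≤ s₀.1.2)
    (hf : Tendsto f (𝓝[<] t) (𝓝 s₀)) (hg : Tendsto g (𝓝[<] t) (𝓝 s₀))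
    (hf' : ∀ᶠ s in 𝓝[<] t, HasDerivAt f (kepler (f s)) s)
    (hg' : ∀ᶠ s in 𝓝[<] t, HasDerivAt g (kepler (g s)) s) : ∀ᶠ s in 𝓝[<] t, f s = g s := by
  have hrev : Tendsto reverse (𝓝 s₀) (𝓝 (reverse s₀)) := continuous_reverse.continuousAt
  have hn : Tendsto (fun s : ℝ => -s) (𝓝[>] (-t)) (𝓝[<] t) := by
    simpa using tendsto_neg_nhdsGT (a := -t)
  have := kepler_unique_right (f := fun s => reverse (f (-s))) (g := fun s => reverse (g (-s)))
    (t := -t) (s₀ := reverse s₀) hs (hrev.comp (hf.comp hn)) (hrev.comp (hg.comp hn))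
    ((hn.eventually hf').mono fun s => hasDerivAt_reverse)
    ((hn.eventually hg').mono fun s => hasDerivAt_reverse)
  refine ((tendsto_neg_nhdsLT (a := t)).eventually this).mono fun s h => ?_
  have h2 := congrArg reverse h
  simpa only [reverse_reverse, neg_neg] using h2

/-! ### Conservation laws and uniqueness of trajectories -/

/-- The state just before a state of the phase space is reached. -/
def incoming (s : State) : State := if s.1.2 = 1 then mirror s else s

theorem incoming_fst (s : State) : (incoming s).1 = s.1 := by
  unfold incoming; split_ifs <;> rfl

/-- A function with zero derivative near, but not at, a point is constant near that point. -/
theorem eventually_eq_of_hasDerivAt_zero {f : ℝ → ℝ} (hf : Continuous f) {t : ℝ}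
    (hd : ∀ᶠ s in 𝓝[≠] t, HasDerivAt f 0 s) : ∀ᶠ s in 𝓝 t, f s = f t := by
  rw [← nhdsLT_sup_nhdsGT, eventually_sup] at hd
  obtain ⟨a, ha, hal⟩ := mem_nhdsLT_iff_exists_Ico_subset.1 hd.1
  obtain ⟨b, hb, hbr⟩ := mem_nhdsGT_iff_exists_Ioc_subset.1 hd.2
  filter_upwards [Ioo_mem_nhds ha hb] with s hs
  rcases lt_trichotomy s t with h | rfl | h
  · obtain ⟨c, hc, h2⟩ := exists_hasDerivAt_eq_slope f (fun _ => 0) h hf.continuousOn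
      fun x hx => hal ⟨hs.1.le.trans hx.1.le, hx.2⟩
    rw [eq_div_iff (sub_pos.2 h).ne'] at h2
    linarith
  · rfl
  · obtain ⟨c, hc, h2⟩ := exists_hasDerivAt_eq_slope f (fun _ => 0) h hf.continuousOn
      fun x hx => hbr ⟨hx.1, hx.2.le.trans hs.2.le⟩
    rw [eq_div_iff (sub_pos.2 h).ne'] at h2
    linarith

theorem continuousAt_energy {s : State} (h : 1 ≤ s.1.2) : ContinuousAt energy s := by
  have hl := (len_pos h).ne'
  unfold energy
  exact ContinuousAt.sub (by fun_prop) (continuousAt_const.div (by fun_prop) hl)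

theorem continuous_angMom : Continuous angMom := by unfold angMom; fun_prop

theorem continuousAt_lrl₂ {s : State} (h : 1 ≤ s.1.2) : ContinuousAt lrl₂ s := by
  have hl := (len_pos h).ne'
  have := continuous_angMom
  unfold lrl₂
  exact ContinuousAt.sub (by fun_prop) (ContinuousAt.div (by fun_prop) (by fun_prop) hl)

theorem continuousAt_lrl₁ {s : State} (h : 1 ≤ s.1.2) : ContinuousAt lrl₁ s := by
  have hl := (len_pos h).ne'
  have := continuous_angMom
  unfold lrl₁
  exact ContinuousAt.sub (by fun_prop) (ContinuousAt.div (by fun_prop) (by fun_prop) hl)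

theorem continuousAt_integralD {s : State} (h : 1 ≤ s.1.2) : ContinuousAt integralD s := by
  unfold integralD
  exact (continuous_angMom.continuousAt.pow 2).sub ((continuousAt_lrl₂ h).const_mul 2)

theorem continuousAt_grazing {s : State} (h : 1 ≤ s.1.2) : ContinuousAt grazing s := by
  unfold grazing
  exact (continuousAt_integralD h).add ((continuousAt_energy h).const_mul 2)

theorem grazing_mirror {s : State} (h : s.1.2 = 1) : grazing (mirror s) = grazing s := by
  unfold grazing
  rw [integralD_mirror h, energy_mirror]

/-- The equation of the motion along the wall, for the pair `(x₁, p₁)`. -/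
def slideField (y : ℝ × ℝ) : ℝ × ℝ := (y.2, -y.1 / len (y.1, 1) ^ 3)

theorem lipschitz_slideField : LipschitzWith 4 slideField := by
  have hg : LipschitzWith 4 fun x : ℝ => -x / len (x, 1) ^ 3 := by
    have hd : ∀ x : ℝ, HasDerivAt (fun x : ℝ => -x / len (x, 1) ^ 3)
        ((-1 * len (x, 1) ^ 3 - -x * (3 * len (x, 1) ^ 2 * ((x * 1 + 1 * 0) / len (x, 1))))
          / (len (x, 1) ^ 3) ^ 2) x := fun x => by
      have h0 : 0 < len (x, 1) := len_pos le_rfl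
      have h1 : HasDerivAt (fun x : ℝ => len (x, 1)) ((x * 1 + 1 * 0) / len (x, 1)) x :=
        hasDerivAt_len (x := fun x : ℝ => (x, 1)) (hasDerivAt_id x) (hasDerivAt_const x 1) h0
      exact (hasDerivAt_id x).fun_neg.fun_div (h1.fun_pow 3) (by positivity)
    refine lipschitzWith_of_nnnorm_deriv_le (fun x => (hd x).differentiableAt) fun x => ?_
    rw [(hd x).deriv, ← NNReal.coe_le_coe, coe_nnnorm, Real.norm_eq_abs]
    have h0 : 1 ≤ len (x, 1) := le_len (x := (x, 1))
    have h2 := len_sq (x, 1)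
    simp only [] at h2
    set r := len (x, 1)
    have hr : 0 < r := by linarith
    rw [show (-1 * r ^ 3 - -x * (3 * r ^ 2 * ((x * 1 + 1 * 0) / r))) / (r ^ 3) ^ 2
      = (3 * x ^ 2 - r ^ 2) / r ^ 5 by field_simp; ring, abs_le]
    have h5 : 1 ≤ r ^ 3 := one_le_pow₀ h0
    have h6 : r ^ 5 = r ^ 3 * r ^ 2 := by ring
    have hr5 : 0 < r ^ 5 := by positivity
    have h7 : r ^ 2 ≤ r ^ 5 := by nlinarith [sq_nonneg r]
    constructor
    · rw [le_div_iff₀ hr5]; push_cast; nlinarith [sq_nonneg x]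
    · rw [div_le_iff₀ hr5]; push_cast; nlinarith [sq_nonneg x]
  have h1 := (LipschitzWith.prod_snd (α := ℝ) (β := ℝ)).prodMk
    (hg.comp (LipschitzWith.prod_fst (α := ℝ) (β := ℝ)))
  have : max (1 : NNReal) (4 * 1) = 4 := by norm_num
  rw [this] at h1
  exact h1

namespace IsTrajectory
variable {z w : ℝ → State} {t : ℝ}

theorem hasDerivAt_kepler (h : IsTrajectory z) (ht : 1 < (z t).1.2) :
    HasDerivAt z (kepler (z t)) t :=
  hasDerivAt_state.2 ⟨⟨h.deriv_x₁ t, h.deriv_x₂ t ht⟩, h.deriv_p₁ t, h.deriv_p₂ t ht⟩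

theorem tendsto_right (h : IsTrajectory z) (t : ℝ) : Tendsto z (𝓝[>] t) (𝓝 (z t)) := by
  rcases (h.above_wall t).eq_or_lt with ht | ht
  · have h1 := (h.deriv_x₁ t).continuousAt.tendsto.mono_left
      (nhdsWithin_le_nhds (s := Ioi t))
    have h2 := (h.continuous_x₂.tendsto t).mono_left (nhdsWithin_le_nhds (s := Ioi t))
    have h3 := (h.deriv_p₁ t).continuousAt.tendsto.mono_left
      (nhdsWithin_le_nhds (s := Ioi t))
    exact (h1.prodMk_nhds h2).prodMk_nhds (h3.prodMk_nhds (h.reflection t ht.symm).2.2)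
  · exact (h.hasDerivAt_kepler ht).continuousAt.tendsto.mono_left nhdsWithin_le_nhds

theorem tendsto_left (h : IsTrajectory z) (t : ℝ) :
    Tendsto z (𝓝[<] t) (𝓝 (incoming (z t))) := by
  rcases (h.above_wall t).eq_or_lt with ht | ht
  · have h1 := (h.deriv_x₁ t).continuousAt.tendsto.mono_left
      (nhdsWithin_le_nhds (s := Iio t))
    have h2 := (h.continuous_x₂.tendsto t).mono_left (nhdsWithin_le_nhds (s := Iio t))
    have h3 := (h.deriv_p₁ t).continuousAt.tendsto.mono_left
      (nhdsWithin_le_nhds (s := Iio t))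
    rw [incoming, if_pos ht.symm]
    exact (h1.prodMk_nhds h2).prodMk_nhds (h3.prodMk_nhds (h.reflection t ht.symm).2.1)
  · rw [incoming, if_neg ht.ne']
    exact (h.hasDerivAt_kepler ht).continuousAt.tendsto.mono_left nhdsWithin_le_nhds

/-- A continuous function of the state which respects the identification at the wall is continuous
along trajectories. -/
theorem continuous_comp {Y : Type*} [TopologicalSpace Y] {f : State → Y}
    (hf : ∀ s : State, 1 ≤ s.1.2 → ContinuousAt f s)
    (hm : ∀ s : State, s.1.2 = 1 → f (mirror s) = f s) (h : IsTrajectory z) :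
    Continuous fun t => f (z t) := by
  refine continuous_iff_continuousAt.2 fun t => ?_
  have hi : f (incoming (z t)) = f (z t) := by
    unfold incoming
    split_ifs with hw
    · exact hm _ hw
    · rfl
  rw [continuousAt_iff_continuous_left'_right']
  constructor
  · have := (hf (incoming (z t)) (by rw [incoming_fst]; exact h.above_wall t)).tendsto.comp
      (h.tendsto_left t)
    rw [hi] at this
    exact this
  · exact (hf _ (h.above_wall t)).tendsto.comp (h.tendsto_right t)

theorem continuous_energy (h : IsTrajectory z) : Continuous fun t => energy (z t) :=
  h.continuous_comp (fun _ => continuousAt_energy) fun s _ => energy_mirror s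

theorem continuous_grazing (h : IsTrajectory z) : Continuous fun t => grazing (z t) :=
  h.continuous_comp (fun _ => continuousAt_grazing) fun _ => grazing_mirror

theorem momentum_pos (h : IsTrajectory z) (hg : 0 < grazing (z t)) (hw : (z t).1.2 = 1) :
    0 < (z t).2.2 := by
  refine (h.reflection t hw).1.lt_of_ne fun h0 => hg.ne' ?_
  exact (grazing_eq_zero_iff hw.ge).2 ⟨hw, h0.symm⟩

/-- Contacts at which the particle does not graze are isolated. -/
theorem eventually_above (h : IsTrajectory z) (hg : 0 < grazing (z t)) :
    ∀ᶠ s in 𝓝[≠] t, 1 < (z s).1.2 := by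
  rcases (h.above_wall t).eq_or_lt with ht | ht
  · have hp := h.momentum_pos hg ht.symm
    obtain ⟨-, hl, hr⟩ := h.reflection t ht.symm
    rw [← nhdsLT_sup_nhdsGT, eventually_sup]
    constructor
    · filter_upwards [hl.eventually (gt_mem_nhds (neg_lt_zero.2 hp))] with s hs
      refine (h.above_wall s).lt_of_ne fun hw => ?_
      exact absurd (h.reflection s hw.symm).1 (not_le.2 hs)
    · obtain ⟨b, hb, hbs⟩ :=
        mem_nhdsGT_iff_exists_Ioc_subset.1 (hr.eventually (lt_mem_nhds hp))
      filter_upwards [Ioc_mem_nhdsGT hb] with s hs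
      refine (h.above_wall s).lt_of_ne fun hw => ?_
      -- at a contact `p₂` has a nonpositive limit from the left
      obtain ⟨h0, h1, -⟩ := h.reflection s hw.symm
      have hs' : 0 < (z s).2.2 := hbs hs
      have h2 := h1.eventually (gt_mem_nhds (neg_lt_zero.2 hs'))
      obtain ⟨u, hu1, hu2⟩ := (h2.and (Ioo_mem_nhdsLT hs.1)).exists
      have : 0 < (z u).2.2 := hbs ⟨hu2.1, hu2.2.le.trans hs.2⟩
      linarith
  · exact ((h.continuous_x₂.tendsto t).eventually (lt_mem_nhds ht)).filter_mono nhdsWithin_le_nhds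

theorem eventually_hasDerivAt (h : IsTrajectory z) (hg : 0 < grazing (z t)) :
    ∀ᶠ s in 𝓝[≠] t, HasDerivAt z (kepler (z s)) s :=
  (h.eventually_above hg).mono fun _ => h.hasDerivAt_kepler

theorem eventually_eq_of_integral (h : IsTrajectory z) (hg : 0 < grazing (z t)) {f : State → ℝ}
    (hc : Continuous fun t => f (z t))
    (hf : ∀ s, 1 < (z s).1.2 → HasDerivAt (fun t => f (z t)) 0 s) :
    ∀ᶠ s in 𝓝 t, f (z s) = f (z t) :=
  eventually_eq_of_hasDerivAt_zero hc ((h.eventually_above hg).mono hf)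

theorem grazing_eq_of_pos (h : IsTrajectory z) {t₀ : ℝ} (hg : 0 < grazing (z t₀)) (t : ℝ) :
    grazing (z t) = grazing (z t₀) := by
  have hcl : IsClopen {t | grazing (z t) = grazing (z t₀)} := by
    refine ⟨isClosed_eq h.continuous_grazing continuous_const, ?_⟩
    refine isOpen_iff_mem_nhds.2 fun t (ht : _ = _) => ?_
    have := h.eventually_eq_of_integral (ht ▸ hg) (f := grazing) h.continuous_grazing fun s hs => by
      have hk := h.hasDerivAt_kepler hs
      refine ((hasDerivAt_integralD hk hs.le).add
        ((hasDerivAt_energy hk hs.le).const_mul 2)).congr_deriv (by simp)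
    exact this.mono fun s hs => hs.trans ht
  exact (hcl.eq_univ ⟨t₀, rfl⟩).ge (mem_univ t)

/-- If `D + 2E` is positive at one time it is constant, as contacts are isolated; otherwise it
vanishes at all times. -/
theorem grazing_eq (h : IsTrajectory z) (t t₀ : ℝ) : grazing (z t) = grazing (z t₀) := by
  rcases (grazing_nonneg (h.above_wall t₀)).eq_or_lt with h0 | h0
  · rcases (grazing_nonneg (h.above_wall t)).eq_or_lt with h1 | h1
    · rw [← h0, ← h1]
    · exact (h.grazing_eq_of_pos h1 t₀).symm
  · exact h.grazing_eq_of_pos h0 t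

/-- A grazing particle slides along the wall at all times. -/
theorem slides (h : IsTrajectory z) {t₀ : ℝ} (h0 : grazing (z t₀) = 0) (t : ℝ) :
    (z t).1.2 = 1 ∧ (z t).2.2 = 0 :=
  (grazing_eq_zero_iff (h.above_wall t)).1 ((h.grazing_eq t t₀).trans h0)

theorem slide_hasDerivAt (h : IsTrajectory z) {t₀ : ℝ} (h0 : grazing (z t₀) = 0) (t : ℝ) :
    HasDerivAt (fun t => ((z t).1.1, (z t).2.1)) (slideField ((z t).1.1, (z t).2.1)) t := by
  have h1 := (h.deriv_x₁ t).prodMk (h.deriv_p₁ t)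
  have h2 : (z t).1 = ((z t).1.1, 1) := Prod.ext rfl (h.slides h0 t).1
  unfold slideField
  rwa [h2] at h1

theorem energy_eq (h : IsTrajectory z) (t t₀ : ℝ) : energy (z t) = energy (z t₀) := by
  have hd : ∀ t, HasDerivAt (fun t => energy (z t)) 0 t := by
    intro t
    rcases (grazing_nonneg (h.above_wall t)).eq_or_lt with h0 | h0
    · have h2 := h.slides h0.symm
      have hk : HasDerivAt (fun t => (z t).1.2) 0 t :=
        (hasDerivAt_const t 1).congr_of_eventuallyEq (Eventually.of_forall fun s => (h2 s).1)
      have hk' : HasDerivAt (fun t => (z t).2.2) 0 t :=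
        (hasDerivAt_const t 0).congr_of_eventuallyEq (Eventually.of_forall fun s => (h2 s).2)
      have hp := len_pos (h.above_wall t)
      have hl := hasDerivAt_len (h.deriv_x₁ t) hk hp
      refine (((((h.deriv_p₁ t).pow 2).add (hk'.pow 2)).div_const 2).sub
        ((hasDerivAt_const t (1 : ℝ)).div hl hp.ne')).congr_deriv ?_
      field_simp
      ring
    · refine (hasDerivAt_const t (energy (z t))).congr_of_eventuallyEq ?_
      exact h.eventually_eq_of_integral h0 h.continuous_energy fun s hs =>
        hasDerivAt_energy (h.hasDerivAt_kepler hs) hs.le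
  exact is_const_of_deriv_eq_zero (fun t => (hd t).differentiableAt) (fun t => (hd t).deriv) t t₀

theorem integralD_eq (h : IsTrajectory z) (t t₀ : ℝ) : integralD (z t) = integralD (z t₀) := by
  have h1 := h.grazing_eq t t₀
  have h2 := h.energy_eq t t₀
  unfold grazing at h1
  linarith

theorem mem_phaseSpace (h : IsTrajectory z) (t : ℝ) : z t ∈ phaseSpace :=
  ⟨h.above_wall t, fun hw => (h.reflection t hw).1⟩

theorem mem_levelSet (h : IsTrajectory z) {D E t₀ : ℝ} (h0 : z t₀ ∈ levelSet D E) (t : ℝ) :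
    z t ∈ levelSet D E :=
  ⟨h.mem_phaseSpace t, (h.energy_eq t t₀).trans h0.2.1, (h.integralD_eq t t₀).trans h0.2.2⟩

theorem comp_add (h : IsTrajectory z) (c : ℝ) : IsTrajectory fun t => z (t + c) where
  above_wall t := h.above_wall _
  deriv_x₁ t := (h.deriv_x₁ (t + c)).comp_add_const t c
  deriv_p₁ t := (h.deriv_p₁ (t + c)).comp_add_const t c
  continuous_x₂ := h.continuous_x₂.comp (continuous_add_const c)
  deriv_x₂ t ht := (h.deriv_x₂ (t + c) ht).comp_add_const t c
  deriv_p₂ t ht := (h.deriv_p₂ (t + c) ht).comp_add_const t c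
  reflection t ht := by
    obtain ⟨h0, h1, h2⟩ := h.reflection (t + c) ht
    have hm : StrictMono fun s : ℝ => s + c := fun a b hab => by simpa using hab
    have hc : ContinuousAt (fun s : ℝ => s + c) t := by fun_prop
    refine ⟨h0, h1.comp ?_, h2.comp ?_⟩
    · exact tendsto_nhdsWithin_of_tendsto_nhds_of_eventually_within _
        (hc.tendsto.mono_left nhdsWithin_le_nhds)
        (eventually_mem_nhdsWithin.mono fun s hs => hm hs)
    · exact tendsto_nhdsWithin_of_tendsto_nhds_of_eventually_within _
        (hc.tendsto.mono_left nhdsWithin_le_nhds)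
        (eventually_mem_nhdsWithin.mono fun s hs => hm hs)

/-- A trajectory is determined by its state at one time. -/
theorem unique (hz : IsTrajectory z) (hw : IsTrajectory w) {t₀ : ℝ} (h0 : z t₀ = w t₀) : z = w := by
  rcases (grazing_nonneg (hz.above_wall t₀)).eq_or_lt with hg | hg
  -- a sliding motion obeys an equation with a Lipschitz right-hand side
  · have h1 := hz.slide_hasDerivAt hg.symm
    have h2 := hw.slide_hasDerivAt (t₀ := t₀) (h0 ▸ hg.symm)
    have h3 := ODE_solution_unique_univ (v := fun _ => slideField) (s := fun _ => univ) (t₀ := t₀)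
      (fun _ => lipschitz_slideField.lipschitzOnWith) (fun t => ⟨h1 t, mem_univ _⟩)
      (fun t => ⟨h2 t, mem_univ _⟩) (by rw [h0])
    funext t
    have h4 := congrFun h3 t
    have h5 := hz.slides hg.symm t
    have h6 := hw.slides (t₀ := t₀) (h0 ▸ hg.symm) t
    simp only [Prod.mk.injEq] at h4
    exact Prod.ext (Prod.ext h4.1 (h5.1.trans h6.1.symm)) (Prod.ext h4.2 (h5.2.trans h6.2.symm))
  -- for bouncing motions the times of agreement form a closed set, which is open because contacts
  -- are isolated and the motion between them is determined by its limits at a contact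
  · have hgz : ∀ t, 0 < grazing (z t) := fun t => by rw [hz.grazing_eq t t₀]; exact hg
    have hgw : ∀ t, 0 < grazing (w t) := fun t => by
      rw [hw.grazing_eq t t₀, ← h0]; exact hg
    -- `F` is continuous on the phase space, where momenta are identified at the wall, and injective
    let F : State → (ℝ × ℝ) × ℝ × ℝ × ℝ :=
      fun s => (s.1, s.2.1, s.2.2 * (s.1.2 - 1), s.2.2 ^ 2)
    have hFc : ∀ {z : ℝ → State}, IsTrajectory z → Continuous fun t => F (z t) := fun h =>
      h.continuous_comp (fun s _ => by
        have : Continuous F := by fun_prop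
        exact this.continuousAt) fun s hs => by simp [F, mirror, hs]
    have hF : ∀ s ∈ phaseSpace, ∀ s' ∈ phaseSpace, F s = F s' → s = s' := by
      rintro ⟨x, p⟩ ⟨h1, h2⟩ ⟨x', p'⟩ ⟨h1', h2'⟩ h
      simp only [F, Prod.mk.injEq] at h h1 h2 h1' h2'
      obtain ⟨rfl, h3, h4, h5⟩ := h
      refine Prod.ext rfl (Prod.ext h3 ?_)
      rcases h1.eq_or_lt with hx | hx
      · exact (pow_left_inj₀ (h2 hx.symm) (h2' hx.symm) two_ne_zero).1 h5
      · exact mul_right_cancel₀ (sub_pos.2 hx).ne' h4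
    have hcl : IsClopen {t | z t = w t} := by
      constructor
      · have : {t | z t = w t} = {t | F (z t) = F (w t)} := by
          ext t
          exact ⟨fun h => congrArg F h,
            hF _ (hz.mem_phaseSpace t) _ (hw.mem_phaseSpace t)⟩
        rw [this]
        exact isClosed_eq (hFc hz) (hFc hw)
      · refine isOpen_iff_mem_nhds.2 fun t (ht : _ = _) => ?_
        have e1 := hz.eventually_hasDerivAt (hgz t)
        have e2 := hw.eventually_hasDerivAt (hgw t)
        rw [← nhdsLT_sup_nhdsGT, eventually_sup] at e1 e2
        have hr := kepler_unique_right (hz.above_wall t) (hz.tendsto_right t)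
          (ht ▸ hw.tendsto_right t) e1.2 e2.2
        have hl := kepler_unique_left (by rw [incoming_fst]; exact hz.above_wall t)
          (hz.tendsto_left t) (ht ▸ hw.tendsto_left t) e1.1 e2.1
        have : ∀ᶠ s in 𝓝[≠] t, z s = w s := by
          rw [← nhdsLT_sup_nhdsGT, eventually_sup]; exact ⟨hl, hr⟩
        rw [eventually_nhdsWithin_iff] at this
        filter_upwards [this] with s hs
        by_cases hst : s = t
        · rw [hst]; exact ht
        · exact hs hst
    funext t
    exact (hcl.eq_univ ⟨t₀, h0⟩).ge (mem_univ t)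

/-- Two trajectories which pass through the same state are time translates of each other. -/
theorem eq_translate (hz : IsTrajectory z) (hw : IsTrajectory w) {t₀ t₁ : ℝ} (h0 : w t₀ = z t₁) :
    ∀ t, w t = z (t + (t₁ - t₀)) := by
  have := hw.unique (hz.comp_add (t₁ - t₀)) (t₀ := t₀) (by simpa using h0)
  exact fun t => congrFun this t

end IsTrajectory

/-! ### Arcs of Kepler ellipses above the wall -/

/-- The connected component of `{f > 1}` around a point. -/
theorem exists_excursion {f : ℝ → ℝ} (hf : Continuous f) {a m b : ℝ} (ham : a < m) (hmb : m < b)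
    (ha : f a ≤ 1) (hm : 1 < f m) (hb : f b ≤ 1) :
    ∃ c d, a ≤ c ∧ c < m ∧ m < d ∧ f c = 1 ∧ f d = 1 ∧ ∀ x ∈ Ioo c d, 1 < f x := by
  have hcl : IsClosed {x | f x ≤ 1} := isClosed_le hf continuous_const
  obtain ⟨c, ⟨⟨hac, hcm⟩, hc : f c ≤ 1⟩, hc'⟩ :=
    (isCompact_Icc.inter_right hcl).exists_isGreatest ⟨a, left_mem_Icc.2 ham.le, ha⟩
  obtain ⟨d, ⟨⟨hmd, hdb⟩, hd : f d ≤ 1⟩, hd'⟩ :=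
    (isCompact_Icc.inter_right hcl).exists_isLeast ⟨b, right_mem_Icc.2 hmb.le, hb⟩
  have hcm' : c < m := hcm.lt_of_ne (by rintro rfl; linarith)
  have hmd' : m < d := hmd.lt_of_ne (by rintro rfl; linarith)
  refine ⟨c, d, hac, hcm', hmd', hc.antisymm ?_, hd.antisymm ?_, fun x hx => ?_⟩
  · by_contra! h
    obtain ⟨x, hx, hx1⟩ := intermediate_value_Icc hcm hf.continuousOn ⟨h.le, hm.le⟩
    have := hc' ⟨⟨hac.trans hx.1, hx.2⟩, hx1.le⟩
    have hxc : x = c := this.antisymm hx.1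
    rw [hxc] at hx1; linarith
  · by_contra! h
    obtain ⟨x, hx, hx1⟩ := intermediate_value_Icc' hmd hf.continuousOn ⟨h.le, hm.le⟩
    have := hd' ⟨⟨hx.1, hx.2.trans hdb⟩, hx1.le⟩
    have hxc : x = d := hx.2.antisymm this
    rw [hxc] at hx1; linarith
  · by_contra! h
    rcases le_total x m with hxm | hxm
    · exact absurd (hc' ⟨⟨hac.trans hx.1.le, hxm⟩, h⟩) (not_le.2 hx.1)
    · exact absurd (hd' ⟨⟨hxm, hx.2.le.trans hdb⟩, h⟩) (not_le.2 hx.2)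

/-- A constant plus a sinusoid of frequency `w`. -/
def sinusoid (c a b w u : ℝ) : ℝ := c + a * Real.cos (w * u) + b * Real.sin (w * u)

theorem hasDerivAt_sinusoid (c a b w u : ℝ) :
    HasDerivAt (sinusoid c a b w) (sinusoid 0 (w * b) (-(w * a)) w u) u := by
  have h : HasDerivAt (fun u : ℝ => w * u) (w * 1) u := (hasDerivAt_id u).const_mul w
  unfold sinusoid
  refine (((h.cos.const_mul a).const_add c).add (h.sin.const_mul b)).congr_deriv ?_
  ring

theorem continuous_sinusoid (c a b w : ℝ) : Continuous (sinusoid c a b w) :=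
  continuous_iff_continuousAt.2 fun u => (hasDerivAt_sinusoid c a b w u).continuousAt

theorem sinusoid_zero (c a b w : ℝ) : sinusoid c a b w 0 = c + a := by simp [sinusoid]

theorem sinusoid_periodic (c a b : ℝ) {w : ℝ} (hw : w ≠ 0) :
    Function.Periodic (sinusoid c a b w) (2 * Real.pi / w) := fun u => by
  have : w * (u + 2 * Real.pi / w) = w * u + 2 * Real.pi := by field_simp
  simp [sinusoid, this]

/-- In the time `u` with `dt = |x| du`, coordinates and distance of a Kepler motion of negative
energy are sinusoids. If `|x| x'' - |x|' x' + x = 0` for a coordinate `x`, its momentum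
`x' / |x|` obeys Kepler's equation. -/
theorem hasDerivAt_sinusoid_momentum {X a b ρ f g w u : ℝ} (hρ : ρ * w ^ 2 = 1)
    (hX : X = w ^ 2 * (f * a + g * b)) (hr : sinusoid ρ f g w u ≠ 0) :
    HasDerivAt (fun u => sinusoid 0 (w * b) (-(w * a)) w u / sinusoid ρ f g w u)
      (-sinusoid X a b w u / sinusoid ρ f g w u ^ 2) u := by
  have h1 := hasDerivAt_sinusoid 0 (w * b) (-(w * a)) w u
  have h2 := hasDerivAt_sinusoid ρ f g w u
  refine (h1.div h2 hr).congr_deriv ?_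
  congr 1
  have hcs := Real.cos_sq_add_sin_sq (w * u)
  unfold sinusoid
  set C := Real.cos (w * u)
  set S := Real.sin (w * u)
  linear_combination (-(a * C) - b * S) * hρ + hX - w ^ 2 * (f * a + g * b) * hcs

/-- The sinusoids of a Kepler motion with initial position `(x, y)`, momentum `(p, q)`, distance `r`
from the origin and energy `-k / 2`. The ellipse has the centre `(X, Y)` and the major semi-axis
`j = 1 / k`. -/
theorem exists_kepler_sinusoids {x y p q r k w : ℝ} (hr0 : 0 < r) (hr2 : r ^ 2 = x ^ 2 + y ^ 2)
    (hk0 : 0 < k) (hw0 : 0 < w) (hw2 : w ^ 2 = k) (hv : r * (p ^ 2 + q ^ 2) = 2 - k * r) :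
    ∃ j X Y b₁ b₂ f g : ℝ, j * w ^ 2 = 1 ∧ X = w ^ 2 * (f * (x - X) + g * b₁) ∧
      Y = w ^ 2 * (f * (y - Y) + g * b₂) ∧ w * b₁ = r * p ∧ w * b₂ = r * q ∧ j + f = r ∧
      (∀ u, sinusoid X (x - X) b₁ w u ^ 2 + sinusoid Y (y - Y) b₂ w u ^ 2 =
        sinusoid j f g w u ^ 2) ∧ ∀ u, 0 ≤ sinusoid j f g w u := by
  obtain ⟨d, hd⟩ : ∃ d, d = x * p + y * q := ⟨_, rfl⟩
  -- the constants of the sinusoids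
  obtain ⟨i, hi'⟩ : ∃ i, i = 1 / (k * r) := ⟨_, rfl⟩
  obtain ⟨j, hj'⟩ : ∃ j, j = 1 / k := ⟨_, rfl⟩
  obtain ⟨l, hl'⟩ : ∃ l, l = 1 / w := ⟨_, rfl⟩
  have hj0 : 0 < j := by rw [hj']; positivity
  have hi : i * r = j := by rw [hi', hj']; field_simp
  have hj : l ^ 2 = j := by rw [hl', hj', ← hw2]; field_simp
  have hρ : j * w ^ 2 = 1 := by rw [hw2, hj']; field_simp
  have hlw : l * w = 1 := by rw [hl']; field_simp
  have hF : (p ^ 2 + q ^ 2) * j = 2 * i - 1 := by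
    rw [hi', hj']
    field_simp
    linear_combination hv
  clear hi' hj' hl'
  obtain ⟨X, hX⟩ : ∃ X, X = x * (1 - i) + d * p * j := ⟨_, rfl⟩
  obtain ⟨Y, hY⟩ : ∃ Y, Y = y * (1 - i) + d * q * j := ⟨_, rfl⟩
  obtain ⟨b₁, hb₁⟩ : ∃ b, b = r * p * l := ⟨_, rfl⟩
  obtain ⟨b₂, hb₂⟩ : ∃ b, b = r * q * l := ⟨_, rfl⟩
  obtain ⟨f, hf⟩ : ∃ f, f = r - j := ⟨_, rfl⟩
  obtain ⟨g, hg⟩ : ∃ g, g = d * l := ⟨_, rfl⟩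
  have eX : X = w ^ 2 * (f * (x - X) + g * b₁) := by
    rw [hX, hf, hg, hb₁]
    linear_combination -(d * r * p * w ^ 2) * hj - w ^ 2 * x * hi
      - (x - x * i + d * p * j) * hρ
  have eY : Y = w ^ 2 * (f * (y - Y) + g * b₂) := by
    rw [hY, hf, hg, hb₂]
    linear_combination -(d * r * q * w ^ 2) * hj - w ^ 2 * y * hi
      - (y - y * i + d * q * j) * hρ
  have hlen : ∀ u, sinusoid X (x - X) b₁ w u ^ 2 + sinusoid Y (y - Y) b₂ w u ^ 2 =
      sinusoid j f g w u ^ 2 := by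
    intro u
    -- comparison of the coefficients of two trigonometric polynomials
    have e1 : (x - X) * b₁ + (y - Y) * b₂ = f * g := by
      rw [hX, hY, hf, hg, hb₁, hb₂]
      linear_combination -(r * l * i) * hd - r * l * d * hF - d * l * hi
    have e2 : X * (x - X) + Y * (y - Y) = j * f := by
      rw [hX, hY, hf]
      linear_combination -(i * (1 - i)) * hr2 - (d * j * (2 * i - 1)) * hd - d ^ 2 * j * hF
        + (r - i * r - j) * hi
    have e3 : X * b₁ + Y * b₂ = j * g := by
      rw [hX, hY, hg, hb₁, hb₂]
      linear_combination -(r * l * (1 - i)) * hd + d * r * l * hF + d * l * hi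
    have e4 : (x - X) ^ 2 + (y - Y) ^ 2 - f ^ 2 = b₁ ^ 2 + b₂ ^ 2 - g ^ 2 := by
      rw [hX, hY, hf, hg, hb₁, hb₂]
      linear_combination -(i ^ 2) * hr2 + 2 * i * j * d * hd + (d ^ 2 * j - r ^ 2) * hF
        + (d ^ 2 - r ^ 2 * (p ^ 2 + q ^ 2)) * hj + (i * r + j - 2 * r) * hi
    have e5 : X ^ 2 + Y ^ 2 + (b₁ ^ 2 + b₂ ^ 2 - g ^ 2) = j ^ 2 := by
      rw [hX, hY, hg, hb₁, hb₂]
      linear_combination -((1 - i) ^ 2) * hr2 - 2 * (1 - i) * j * d * hd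
        + (d ^ 2 * j + r ^ 2) * hF + (r ^ 2 * (p ^ 2 + q ^ 2) - d ^ 2) * hj + (i * r + j) * hi
    have hcs := Real.cos_sq_add_sin_sq (w * u)
    unfold sinusoid
    set C := Real.cos (w * u)
    set S := Real.sin (w * u)
    linear_combination e5 + 2 * C * e2 + 2 * S * e3 + 2 * C * S * e1 + C ^ 2 * e4
      + (b₁ ^ 2 + b₂ ^ 2 - g ^ 2) * hcs
  have hrnn : ∀ u, 0 ≤ sinusoid j f g w u := by
    intro u
    have h1 : f ^ 2 + g ^ 2 ≤ j ^ 2 := by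
      have h2 : d ^ 2 ≤ r ^ 2 * (p ^ 2 + q ^ 2) := by
        rw [hr2, hd]; linarith [sq_nonneg (x * q - y * p)]
      have h3 : d ^ 2 * j ≤ r ^ 2 * (p ^ 2 + q ^ 2) * j := mul_le_mul_of_nonneg_right h2 hj0.le
      have h4 : r ^ 2 * (p ^ 2 + q ^ 2) * j = 2 * r * j - r ^ 2 := by
        linear_combination r ^ 2 * hF + 2 * r * hi
      have h5 : g ^ 2 = d ^ 2 * j := by rw [hg, ← hj]; ring
      rw [hf, h5]; linarith
    have hcs := Real.cos_sq_add_sin_sq (w * u)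
    unfold sinusoid
    set C := Real.cos (w * u)
    set S := Real.sin (w * u)
    have h2 : (f * C + g * S) ^ 2 ≤ j ^ 2 := by
      have : (f * C + g * S) ^ 2 + (f * S - g * C) ^ 2 = f ^ 2 + g ^ 2 := by
        linear_combination (f ^ 2 + g ^ 2) * hcs
      linarith [sq_nonneg (f * S - g * C)]
    have := (abs_le_of_sq_le_sq' h2 hj0.le).1
    linarith
  refine ⟨j, X, Y, b₁, b₂, f, g, hρ, eX, eY, ?_, ?_, by rw [hf]; ring, hlen, hrnn⟩
  · rw [hb₁]; linear_combination r * p * hlw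
  · rw [hb₂]; linear_combination r * q * hlw

/-- The motion between two contacts through a given state which does not graze the wall. -/
theorem exists_arc {s : State} (hs : s ∈ phaseSpace) (hE : energy s < 0) (hG : 0 < grazing s) :
    ∃ (y : ℝ → State) (t₁ t₂ : ℝ), t₁ ≤ 0 ∧ 0 < t₂ ∧ y 0 = s ∧
      (∀ t ∈ Icc t₁ t₂, HasDerivAt y (kepler (y t)) t) ∧
      (y t₁).1.2 = 1 ∧ (y t₂).1.2 = 1 ∧ ∀ t ∈ Ioo t₁ t₂, 1 < (y t).1.2 := by
  obtain ⟨⟨x, y⟩, p, q⟩ := s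
  have hy : 1 ≤ y := hs.1
  set r := len (x, y) with hr
  have hr0 : 0 < r := len_pos hy
  have hr2 : r ^ 2 = x ^ 2 + y ^ 2 := len_sq (x, y)
  obtain ⟨k, hk⟩ : ∃ k, k = -2 * energy ((x, y), p, q) := ⟨_, rfl⟩
  have hk0 : 0 < k := by rw [hk]; linarith
  have hv : r * (p ^ 2 + q ^ 2) = 2 - k * r := by
    rw [hk, energy_eq]
    simp only [← hr]
    field_simp
    ring
  set w := √k with hw
  have hw0 : 0 < w := Real.sqrt_pos.2 hk0
  have hw2 : w ^ 2 = k := Real.sq_sqrt hk0.le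
  clear_value w r
  clear hk
  obtain ⟨j, X, Y, b₁, b₂, f, g, hρ, eX, eY, hb₁, hb₂, hf, hlen, hrnn⟩ :=
    exists_kepler_sinusoids hr0 hr2 hk0 hw0 hw2 hv
  set ux := sinusoid X (x - X) b₁ w with hux
  set uy := sinusoid Y (y - Y) b₂ w with huy
  set ur := sinusoid j f g w with hur
  have hone : ∀ u, 1 ≤ uy u → 1 ≤ ur u := fun u hu => by
    have h1 := hlen u
    have h2 := hrnn u
    nlinarith [sq_nonneg (ux u)]
  have hmom : ∀ u, ur u ≠ 0 → HasDerivAt (fun u => sinusoid 0 (w * b₂) (-(w * (y - Y))) w u / ur u)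
      (-uy u / ur u ^ 2) u := fun u hu => hasDerivAt_sinusoid_momentum hρ eY hu
  have hmomx : ∀ u, ur u ≠ 0 →
      HasDerivAt (fun u => sinusoid 0 (w * b₁) (-(w * (x - X))) w u / ur u)
      (-ux u / ur u ^ 2) u := fun u hu => hasDerivAt_sinusoid_momentum hρ eX hu
  -- the motion returns to the wall: the vertical momentum is periodic, but would
  -- decrease strictly if the particle stayed above the wall
  have hret : ∃ u, uy u < 1 := by
    by_contra! h
    have hT : 0 < 2 * Real.pi / w := by positivity
    have hne : ∀ u, ur u ≠ 0 := fun u => (one_pos.trans_le (hone u (h u))).ne'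
    have hanti : StrictAnti fun u => sinusoid 0 (w * b₂) (-(w * (y - Y))) w u / ur u :=
      strictAnti_of_deriv_neg fun u => by
        rw [(hmom u (hne u)).deriv]
        have := h u
        have := hone u (h u)
        exact div_neg_of_neg_of_pos (by linarith) (by positivity)
    have h1 := hanti hT
    have h2 := sinusoid_periodic 0 (w * b₂) (-(w * (y - Y))) hw0.ne' 0
    have h3 := sinusoid_periodic j f g hw0.ne' 0
    simp only [zero_add] at h2 h3
    simp only [hur, h2, h3, lt_irrefl] at h1
  obtain ⟨u₀, hu₀⟩ := hret
  have hper := sinusoid_periodic Y (y - Y) b₂ hw0.ne'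
  have hT : 0 < 2 * Real.pi / w := by positivity
  have hback : ∃ a < 0, uy a ≤ 1 := by
    obtain ⟨n, hn⟩ := exists_nat_gt (u₀ / (2 * Real.pi / w))
    rw [div_lt_iff₀ hT] at hn
    exact ⟨u₀ - n * (2 * Real.pi / w), by linarith, by
      rw [huy, hper.sub_nat_mul_eq n]; exact hu₀.le⟩
  have hforw : ∀ m, ∃ b > m, uy b ≤ 1 := by
    intro m
    obtain ⟨n, hn⟩ := exists_nat_gt ((m - u₀) / (2 * Real.pi / w))
    rw [div_lt_iff₀ hT] at hn
    exact ⟨u₀ + n * (2 * Real.pi / w), by linarith, by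
      rw [huy, hper.nat_mul n u₀]; exact hu₀.le⟩
  have huy0 : uy 0 = y := by rw [huy, sinusoid_zero]; ring
  have hcuy : Continuous uy := continuous_sinusoid _ _ _ _
  -- the arc is the component of `{uy > 1}` at `0`, or to the right of `0` if it starts at the wall
  have hexc : ∃ c d, c ≤ 0 ∧ 0 < d ∧ uy c = 1 ∧ uy d = 1 ∧ ∀ u ∈ Ioo c d, 1 < uy u := by
    rcases hy.eq_or_lt with h1 | h1
    · have hq : 0 < q := by
        refine (hs.2 h1.symm).lt_of_ne fun h => hG.ne' ?_
        exact (grazing_eq_zero_iff hy).2 ⟨h1.symm, h.symm⟩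
      have hder : HasDerivAt uy (r * q) 0 := (hasDerivAt_sinusoid Y (y - Y) b₂ w 0).congr_deriv
        (by rw [sinusoid_zero, hb₂, zero_add])
      have hev : ∀ᶠ u in 𝓝[>] 0, 1 < uy u := by
        have hslope := (hasDerivAt_iff_tendsto_slope.1 hder).mono_left
          (nhdsWithin_mono 0 fun u (hu : 0 < u) => hu.ne')
        filter_upwards [hslope.eventually (lt_mem_nhds (mul_pos hr0 hq)), self_mem_nhdsWithin]
          with u hu (hu0 : 0 < u)
        rw [slope_def_field, huy0, ← h1] at hu
        have := (div_pos_iff_of_pos_right (by linarith)).1 hu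
        linarith
      obtain ⟨m, hm, hmu⟩ := mem_nhdsGT_iff_exists_Ioc_subset.1 hev
      obtain ⟨b, hb, hb1⟩ := hforw m
      obtain ⟨c, d, h0c, h2, h3, h4, h5, h6⟩ := exists_excursion hcuy hm hb (huy0.trans h1.symm).le
        (hmu (right_mem_Ioc.2 hm)) hb1
      refine ⟨c, d, ?_, (hm : 0 < m).trans h3, h4, h5, h6⟩
      by_contra! hc
      exact (hmu ⟨hc, h2.le⟩ : 1 < uy c).ne' h4
    · obtain ⟨a, ha, ha1⟩ := hback
      obtain ⟨b, hb, hb1⟩ := hforw 0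
      obtain ⟨c, d, -, h2, h3, h4, h5, h6⟩ := exists_excursion hcuy ha hb ha1 (huy0 ▸ h1) hb1
      exact ⟨c, d, h2.le, h3, h4, h5, h6⟩
  obtain ⟨c, d, hc, hd, hc1, hd1, hcd⟩ := hexc
  have hge : ∀ u ∈ Icc c d, 1 ≤ uy u := fun u hu => by
    rcases hu.1.eq_or_lt with rfl | h1
    · exact hc1.ge
    rcases hu.2.eq_or_lt with rfl | h2
    · exact hd1.ge
    exact (hcd u ⟨h1, h2⟩).le
  -- `ur` may vanish below the wall (collision with the origin); above it `ur ≥ 1`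
  obtain ⟨θ, hθ0, hθm, hθs, hθd, -⟩ := exists_clock (ω := fun u => max (ur u) (1 / 2))
    ((continuous_sinusoid _ _ _ _).max continuous_const) one_half_pos fun u => le_max_right _ _
  obtain ⟨t₁, ht₁⟩ := hθs c
  obtain ⟨t₂, ht₂⟩ := hθs d
  refine ⟨fun t => ((ux (θ t), uy (θ t)), (sinusoid 0 (w * b₁) (-(w * (x - X))) w (θ t) / ur (θ t),
    sinusoid 0 (w * b₂) (-(w * (y - Y))) w (θ t) / ur (θ t))), t₁, t₂, ?_, ?_, ?_, ?_, ?_, ?_, ?_⟩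
  · rw [← hθm.le_iff_le, ht₁, hθ0]; exact hc
  · rw [← hθm.lt_iff_lt, ht₂, hθ0]; exact hd
  · simp only [hθ0, huy0]
    simp only [hux, hur, sinusoid_zero, hf, hb₁, hb₂, zero_add, add_sub_cancel,
      mul_div_cancel_left₀ _ hr0.ne']
  · intro t ht
    have hy1 := hge (θ t) ⟨ht₁ ▸ hθm.monotone ht.1, ht₂ ▸ hθm.monotone ht.2⟩
    have hr1 := hone _ hy1
    have hθ' := hθd t
    rw [max_eq_left (by linarith)] at hθ'
    have hL : len (ux (θ t), uy (θ t)) = ur (θ t) := by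
      unfold len
      rw [hlen, Real.sqrt_sq (by linarith)]
    refine hasDerivAt_state.2 ⟨⟨?_, ?_⟩, ?_, ?_⟩
    · exact ((hasDerivAt_sinusoid X (x - X) b₁ w (θ t)).comp t hθ').congr_deriv
        (by simp [kepler, div_eq_mul_inv])
    · exact ((hasDerivAt_sinusoid Y (y - Y) b₂ w (θ t)).comp t hθ').congr_deriv
        (by simp [kepler, div_eq_mul_inv])
    · refine ((hmomx (θ t) (by linarith)).comp t hθ').congr_deriv ?_
      simp only [kepler, hL]
      field_simp
    · refine ((hmom (θ t) (by linarith)).comp t hθ').congr_deriv ?_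
      simp only [kepler, hL]
      field_simp
  · simp only [ht₁, hc1]
  · simp only [ht₂, hd1]
  · intro t ht
    exact hcd _ ⟨ht₁ ▸ hθm ht.1, ht₂ ▸ hθm ht.2⟩

/-! ### Existence of trajectories -/

theorem exists_int_chain {α : Type*} {R : α → α → Prop} (hf : ∀ a, ∃ b, R a b)
    (hb : ∀ b, ∃ a, R a b) (a₀ : α) : ∃ c : ℤ → α, c 0 = a₀ ∧ ∀ n, R (c n) (c (n + 1)) := by
  choose f hf using hf
  choose g hg using hb
  refine ⟨fun n => Int.rec (fun k => f^[k] a₀) (fun k => g^[k + 1] a₀) n, rfl, fun n => ?_⟩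
  rcases n with k | k
  · change R (f^[k] a₀) (f^[k + 1] a₀)
    rw [Function.iterate_succ_apply']
    exact hf _
  · rcases k with _ | k
    · exact hg a₀
    · have : Int.negSucc (k + 1) + 1 = Int.negSucc k := rfl
      rw [this]
      change R (g^[k + 1 + 1] a₀) (g^[k + 1] a₀)
      rw [Function.iterate_succ_apply']
      exact hg _

theorem exists_mem_Ico_int {u : ℤ → ℝ} (hm : StrictMono u) (htop : Tendsto u atTop atTop)
    (hbot : Tendsto u atBot atBot) (t : ℝ) : ∃ n, u n ≤ t ∧ t < u (n + 1) := by
  obtain ⟨b, hb⟩ := (htop.eventually (eventually_gt_atTop t)).exists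
  obtain ⟨a, ha⟩ := (hbot.eventually (eventually_le_atBot t)).exists
  obtain ⟨n, hn, hmax⟩ := Int.exists_greatest_of_bdd (P := fun n => u n ≤ t)
    ⟨b, fun n hn => by
      have := hm.lt_iff_lt.1 (hn.trans_lt hb); exact this.le⟩ ⟨a, ha⟩
  refine ⟨n, hn, ?_⟩
  by_contra! h
  have := hmax _ h
  omega

/-- A Kepler arc above the wall which is not tangent to it, of energy `E` and with `D + 2E = G`,
traversed from time `a` to time `b`. -/
structure IsKeplerArc (E G : ℝ) (y : ℝ → State) (a b : ℝ) : Prop where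
  lt : a < b
  hasDerivAt : ∀ t ∈ Icc a b, HasDerivAt y (kepler (y t)) t
  wall_left : (y a).1.2 = 1
  wall_right : (y b).1.2 = 1
  above : ∀ t ∈ Ioo a b, 1 < (y t).1.2
  energy_eq : ∀ t ∈ Icc a b, energy (y t) = E
  grazing_eq : ∀ t ∈ Icc a b, grazing (y t) = G
  left_pos : 0 < (y a).2.2
  right_neg : (y b).2.2 < 0

theorem eq_of_hasDerivAt_zero {f : ℝ → ℝ} {a b : ℝ} (h : ∀ t ∈ Icc a b, HasDerivAt f 0 t) {t u : ℝ}
    (ht : t ∈ Icc a b) (hu : u ∈ Icc a b) : f t = f u := by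
  have := constant_of_has_deriv_right_zero (HasDerivAt.continuousOn h) fun x hx =>
    (h x (Ico_subset_Icc_self hx)).hasDerivWithinAt
  rw [this t ht, this u hu]

theorem wall_grazing_eq {s : State} (h : s.1.2 = 1) :
    grazing s = (s.1.1 ^ 2 + 1) * s.2.2 ^ 2 := by
  rw [grazing_eq h.ge, h]; ring

theorem grazing_reverse {s : State} (h : 1 ≤ s.1.2) : grazing (reverse s) = grazing s := by
  rw [grazing_eq h, grazing_eq (by exact h)]
  simp only [reverse]
  ring

theorem energy_reverse (s : State) : energy (reverse s) = energy s := by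
  simp [energy, reverse]

/-- Every state which does not graze the wall lies on a Kepler arc. -/
theorem exists_keplerArc {s : State} (hs : s ∈ phaseSpace) (hE : energy s < 0)
    (hG : 0 < grazing s) : ∃ (y : ℝ → State) (t₁ t₂ : ℝ), t₁ ≤ 0 ∧ 0 < t₂ ∧ y 0 = s ∧
      IsKeplerArc (energy s) (grazing s) y t₁ t₂ := by
  obtain ⟨y, t₁, t₂, h1, h2, h0, hd, hw1, hw2, ha⟩ := exists_arc hs hE hG
  have hlt := h1.trans_lt h2
  have hge : ∀ t ∈ Icc t₁ t₂, 1 ≤ (y t).1.2 := fun t ht => by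
    rcases ht.1.eq_or_lt with rfl | h
    · exact hw1.ge
    rcases ht.2.eq_or_lt with rfl | h'
    · exact hw2.ge
    exact (ha t ⟨h, h'⟩).le
  have h0m : (0 : ℝ) ∈ Icc t₁ t₂ := ⟨h1, h2.le⟩
  have hEt : ∀ t ∈ Icc t₁ t₂, energy (y t) = energy s := fun t ht => by
    rw [← h0]
    exact eq_of_hasDerivAt_zero (fun u hu => hasDerivAt_energy (hd u hu) (hge u hu)) ht h0m
  have hGt : ∀ t ∈ Icc t₁ t₂, grazing (y t) = grazing s := fun t ht => by
    rw [← h0]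
    refine eq_of_hasDerivAt_zero (f := fun t => grazing (y t)) (fun u hu => ?_) ht h0m
    exact ((hasDerivAt_integralD (hd u hu) (hge u hu)).add
      ((hasDerivAt_energy (hd u hu) (hge u hu)).const_mul 2)).congr_deriv (by simp)
  have hne : ∀ t ∈ Icc t₁ t₂, (y t).1.2 = 1 → (y t).2.2 ≠ 0 := fun t ht hw hp => by
    have := (grazing_eq_zero_iff hw.ge).2 ⟨hw, hp⟩
    rw [hGt t ht] at this
    exact hG.ne' this
  have hl : t₁ ∈ Icc t₁ t₂ := left_mem_Icc.2 hlt.le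
  have hr : t₂ ∈ Icc t₁ t₂ := right_mem_Icc.2 hlt.le
  refine ⟨y, t₁, t₂, h1, h2, h0, hlt, hd, hw1, hw2, ha, hEt, hGt, ?_, ?_⟩
  · refine lt_of_le_of_ne ?_ (hne t₁ hl hw1).symm
    have hsl := (hasDerivAt_iff_tendsto_slope.1 (hasDerivAt_state.1 (hd t₁ hl)).1.2).mono_left
      (nhdsWithin_mono t₁ (s := Ioi t₁) fun u (hu : t₁ < u) => hu.ne')
    refine ge_of_tendsto hsl ?_
    filter_upwards [Ioo_mem_nhdsGT hlt] with u hu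
    rw [slope_def_field, hw1]
    have := ha u hu
    exact div_nonneg (by linarith) (by linarith [hu.1])
  · refine lt_of_le_of_ne ?_ (hne t₂ hr hw2)
    have hsl := (hasDerivAt_iff_tendsto_slope.1 (hasDerivAt_state.1 (hd t₂ hr)).1.2).mono_left
      (nhdsWithin_mono t₂ (s := Iio t₂) fun u (hu : u < t₂) => hu.ne)
    refine le_of_tendsto hsl ?_
    filter_upwards [Ioo_mem_nhdsLT hlt] with u hu
    rw [slope_def_field, hw2]
    have := ha u hu
    exact div_nonpos_of_nonneg_of_nonpos (by linarith) (by linarith [hu.2])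

namespace IsKeplerArc
variable {E G : ℝ} {y : ℝ → State} {a b : ℝ}

theorem comp_add (h : IsKeplerArc E G y a b) (c : ℝ) :
    IsKeplerArc E G (fun t => y (t + c)) (a - c) (b - c) where
  lt := by linarith [h.lt]
  hasDerivAt t ht :=
    (h.hasDerivAt (t + c) ⟨by linarith [ht.1], by linarith [ht.2]⟩).comp_add_const t c
  wall_left := by simpa using h.wall_left
  wall_right := by simpa using h.wall_right
  above t ht := h.above _ ⟨by linarith [ht.1], by linarith [ht.2]⟩
  energy_eq t ht := h.energy_eq _ ⟨by linarith [ht.1], by linarith [ht.2]⟩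
  grazing_eq t ht := h.grazing_eq _ ⟨by linarith [ht.1], by linarith [ht.2]⟩
  left_pos := by simpa using h.left_pos
  right_neg := by simpa using h.right_neg

theorem one_le (h : IsKeplerArc E G y a b) {t : ℝ} (ht : t ∈ Icc a b) : 1 ≤ (y t).1.2 := by
  rcases ht.1.eq_or_lt with rfl | h1
  · exact h.wall_left.ge
  rcases ht.2.eq_or_lt with rfl | h2
  · exact h.wall_right.ge
  exact (h.above t ⟨h1, h2⟩).le

theorem reverse (h : IsKeplerArc E G y a b) :
    IsKeplerArc E G (fun t => reverse (y (-t))) (-b) (-a) where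
  lt := by linarith [h.lt]
  hasDerivAt t ht := hasDerivAt_reverse (h.hasDerivAt _ ⟨by linarith [ht.2], by linarith [ht.1]⟩)
  wall_left := by simpa [Boltzmann.reverse] using h.wall_right
  wall_right := by simpa [Boltzmann.reverse] using h.wall_left
  above t ht := h.above _ ⟨by linarith [ht.2], by linarith [ht.1]⟩
  energy_eq t ht := by
    rw [energy_reverse]
    exact h.energy_eq _ ⟨by linarith [ht.2], by linarith [ht.1]⟩
  grazing_eq t ht := by
    have hm : -t ∈ Icc a b := ⟨by linarith [ht.2], by linarith [ht.1]⟩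
    rw [grazing_reverse (h.one_le hm)]
    exact h.grazing_eq _ hm
  left_pos := by simpa [Boltzmann.reverse] using h.right_neg
  right_neg := by simpa [Boltzmann.reverse] using h.left_pos

/-- The vertical momentum at a contact determines a lower bound for the duration of an arc, since
the vertical acceleration is at most `1`. The bound depends on the integrals only, so that contacts
cannot accumulate. -/
theorem duration (h : IsKeplerArc E G y a b) : a + √G * -E ≤ b := by
  have hr := len_pos h.wall_left.ge
  have ha := left_mem_Icc.2 h.lt.le
  have hp := h.left_pos
  have h1 : len (y a).1 * -E ≤ 1 := by
    have h2 := h.energy_eq a ha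
    rw [Boltzmann.energy_eq] at h2
    have h3 : -E ≤ 1 / len (y a).1 := by nlinarith [sq_nonneg (y a).2.1, sq_nonneg (y a).2.2]
    rw [le_div_iff₀ hr] at h3
    linarith
  have h2 : √G = len (y a).1 * (y a).2.2 := by
    rw [← h.grazing_eq a ha, wall_grazing_eq h.wall_left]
    have := len_sq (y a).1
    rw [h.wall_left, one_pow] at this
    rw [← this, ← mul_pow, Real.sqrt_sq (by positivity)]
  have h3 : √G * -E ≤ (y a).2.2 := by rw [h2]; nlinarith
  have hc : ContinuousOn (fun t => (y t).2.2) (Icc a b) :=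
    HasDerivAt.continuousOn fun t ht => (hasDerivAt_state.1 (h.hasDerivAt t ht)).2.2
  obtain ⟨c, hc1, hc2⟩ := exists_hasDerivAt_eq_slope (fun t => (y t).2.2) _ h.lt hc fun t ht =>
    (hasDerivAt_state.1 (h.hasDerivAt t (Ioo_subset_Icc_self ht))).2.2
  have h4 : (y c).1.2 / len (y c).1 ^ 3 ≤ 1 := by
    have h5 := h.one_le (Ioo_subset_Icc_self hc1)
    have h6 := len_pos h5
    have h7 : (y c).1.2 ≤ len (y c).1 := le_len
    have h8 : 1 ≤ len (y c).1 ^ 2 := one_le_pow₀ (h5.trans h7)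
    rw [div_le_one (by positivity)]
    nlinarith
  have h5 := h.right_neg
  have h6 := sub_pos.2 h.lt
  simp only [kepler] at hc2
  rw [eq_div_iff h6.ne', neg_div] at hc2
  nlinarith

theorem exists_next (h : IsKeplerArc E G y a b) (hE : E < 0) (hG : 0 < G) :
    ∃ (y' : ℝ → State) (c : ℝ), IsKeplerArc E G y' b c ∧ y b = mirror (y' b) := by
  have hb := right_mem_Icc.2 h.lt.le
  have hE' : energy (mirror (y b)) = E := by rw [energy_mirror]; exact h.energy_eq b hb
  have hG' : grazing (mirror (y b)) = G := by
    rw [grazing_mirror h.wall_right]; exact h.grazing_eq b hb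
  have hw : (mirror (y b)).1.2 = 1 := h.wall_right
  obtain ⟨y', t₁, t₂, h1, h2, h3, h4⟩ := exists_keplerArc (s := mirror (y b))
    ⟨hw.ge, fun _ => (neg_pos.2 h.right_neg).le⟩ (hE' ▸ hE) (hG' ▸ hG)
  rw [hE', hG'] at h4
  have ht : t₁ = 0 := by
    by_contra hne
    have := h4.above 0 ⟨h1.lt_of_ne hne, h2⟩
    rw [h3, hw] at this
    exact this.false
  subst ht
  have h5 := h4.comp_add (-b)
  rw [zero_sub, neg_neg] at h5
  exact ⟨_, _, h5, by simp [h3, mirror_mirror]⟩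

theorem exists_prev (h : IsKeplerArc E G y a b) (hE : E < 0) (hG : 0 < G) :
    ∃ (y' : ℝ → State) (c : ℝ), IsKeplerArc E G y' c a ∧ y' a = mirror (y a) := by
  obtain ⟨y', c, h1, h2⟩ := h.reverse.exists_next hE hG
  refine ⟨_, -c, by simpa using h1.reverse, ?_⟩
  have h3 := congrArg Boltzmann.reverse h2
  simp only [neg_neg, reverse_reverse] at h3
  rw [h3]
  simp [mirror, Boltzmann.reverse]

end IsKeplerArc

/-- Kepler arcs, each starting in the mirror image of the final state of the one before, form a
trajectory. -/
theorem isTrajectory_of_arcs {E G : ℝ} {y : ℤ → ℝ → State} {u : ℤ → ℝ} {z : ℝ → State}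
    (hex : ∀ t, ∃ n, u n ≤ t ∧ t < u (n + 1)) (harc : ∀ n, IsKeplerArc E G (y n) (u n) (u (n + 1)))
    (hjoin : ∀ n, y n (u (n + 1)) = mirror (y (n + 1) (u (n + 1))))
    (hz : ∀ n, ∀ t ∈ Ico (u n) (u (n + 1)), z t = y n t) : IsTrajectory z := by
  -- inside an arc
  have hin : ∀ n, ∀ t ∈ Ioo (u n) (u (n + 1)), HasDerivAt z (kepler (z t)) t ∧ 1 < (z t).1.2 := by
    intro n t ht
    rw [hz n t ⟨ht.1.le, ht.2⟩]
    refine ⟨((harc n).hasDerivAt t (Ioo_subset_Icc_self ht)).congr_of_eventuallyEq ?_,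
      (harc n).above t ht⟩
    filter_upwards [Ioo_mem_nhds ht.1 ht.2] with s hs using hz n s ⟨hs.1.le, hs.2⟩
  -- at the end of an arc
  have hval : ∀ n, z (u (n + 1)) = y (n + 1) (u (n + 1)) := fun n =>
    hz (n + 1) _ ⟨le_rfl, (harc (n + 1)).lt⟩
  have hright : ∀ n, z =ᶠ[𝓝[≥] (u (n + 1))] y (n + 1) := fun n => by
    filter_upwards [Ico_mem_nhdsGE (harc (n + 1)).lt] with s hs using hz (n + 1) s hs
  have hleft : ∀ n, z =ᶠ[𝓝[<] (u (n + 1))] y n := fun n => by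
    filter_upwards [Ioo_mem_nhdsLT (harc n).lt] with s hs using hz n s ⟨hs.1.le, hs.2⟩
  have hdr : ∀ n, HasDerivAt (y (n + 1)) (kepler (z (u (n + 1)))) (u (n + 1)) := fun n => by
    rw [hval]
    exact (harc (n + 1)).hasDerivAt _ (left_mem_Icc.2 (harc (n + 1)).lt.le)
  have hdl : ∀ n, HasDerivAt (y n) (kepler (mirror (z (u (n + 1))))) (u (n + 1)) := fun n => by
    rw [hval, ← hjoin n]
    exact (harc n).hasDerivAt _ (right_mem_Icc.2 (harc n).lt.le)
  -- quantities which a reflection does not affect are differentiable at contacts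
  have hjump : ∀ n (g : State → ℝ) (v : ℝ), g (mirror (z (u (n + 1)))) = g (z (u (n + 1))) →
      HasDerivAt (fun t => g (y n t)) v (u (n + 1)) →
      HasDerivAt (fun t => g (y (n + 1) t)) v (u (n + 1)) →
      HasDerivAt (fun t => g (z t)) v (u (n + 1)) := by
    intro n g v hg h1 h2
    have hl : HasDerivWithinAt (fun t => g (z t)) v (Iic (u (n + 1))) (u (n + 1)) := by
      refine h1.hasDerivWithinAt.congr_of_eventuallyEq ?_ ?_
      · rw [← Iio_insert, nhdsWithin_insert]
        refine eventually_sup.2 ⟨?_, (hleft n).mono fun s hs => congrArg g hs⟩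
        simp only [eventually_pure]
        rw [hjoin, ← hval, hg]
      · rw [hjoin, ← hval, hg]
    have hr : HasDerivWithinAt (fun t => g (z t)) v (Ici (u (n + 1))) (u (n + 1)) := by
      refine h2.hasDerivWithinAt.congr_of_eventuallyEq ?_ ?_
      · exact (hright n).mono fun s hs => congrArg g hs
      · rw [hval]
    have := hl.union hr
    rwa [Iic_union_Ici, hasDerivWithinAt_univ] at this
  have hcases : ∀ t, (∃ n, t ∈ Ioo (u n) (u (n + 1))) ∨ ∃ n, t = u (n + 1) := fun t => by
    obtain ⟨n, h1, h2⟩ := hex t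
    rcases h1.eq_or_lt with h | h
    · exact Or.inr ⟨n - 1, by simp [h]⟩
    · exact Or.inl ⟨n, h, h2⟩
  have hwall : ∀ n, (z (u (n + 1))).1.2 = 1 := fun n => by
    rw [hval]; exact (harc (n + 1)).wall_left
  constructor
  · intro t
    rcases hcases t with ⟨n, hn⟩ | ⟨n, rfl⟩
    · exact (hin n t hn).2.le
    · exact (hwall n).ge
  · intro t
    rcases hcases t with ⟨n, hn⟩ | ⟨n, rfl⟩
    · exact (hasDerivAt_state.1 (hin n t hn).1).1.1
    · exact hjump n (fun s => s.1.1) _ rfl (hasDerivAt_state.1 (hdl n)).1.1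
        (hasDerivAt_state.1 (hdr n)).1.1
  · intro t
    rcases hcases t with ⟨n, hn⟩ | ⟨n, rfl⟩
    · exact (hasDerivAt_state.1 (hin n t hn).1).2.1
    · exact hjump n (fun s => s.2.1) _ rfl (hasDerivAt_state.1 (hdl n)).2.1
        (hasDerivAt_state.1 (hdr n)).2.1
  · refine continuous_iff_continuousAt.2 fun t => ?_
    rcases hcases t with ⟨n, hn⟩ | ⟨n, rfl⟩
    · exact (hasDerivAt_state.1 (hin n t hn).1).1.2.continuousAt
    · rw [continuousAt_iff_continuous_left'_right']
      have h1 := (hasDerivAt_state.1 (hdl n)).1.2.continuousAt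
      have h2 := (hasDerivAt_state.1 (hdr n)).1.2.continuousAt
      constructor
      · rw [ContinuousWithinAt, hwall, ← (harc n).wall_right]
        refine (h1.tendsto.mono_left nhdsWithin_le_nhds).congr' ?_
        exact (hleft n).mono fun s hs => by simp only [hs]
      · rw [ContinuousWithinAt, hval]
        refine (h2.tendsto.mono_left nhdsWithin_le_nhds).congr' ?_
        exact ((hright n).filter_mono (nhdsWithin_mono _ Ioi_subset_Ici_self)).mono
          fun s hs => by simp only [hs]
  · intro t ht
    rcases hcases t with ⟨n, hn⟩ | ⟨n, rfl⟩
    · exact (hasDerivAt_state.1 (hin n t hn).1).1.2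
    · exact absurd (hwall n) ht.ne'
  · intro t ht
    rcases hcases t with ⟨n, hn⟩ | ⟨n, rfl⟩
    · exact (hasDerivAt_state.1 (hin n t hn).1).2.2
    · exact absurd (hwall n) ht.ne'
  · intro t ht
    rcases hcases t with ⟨n, hn⟩ | ⟨n, rfl⟩
    · exact absurd ht (hin n t hn).2.ne'
    · have h1 := (hasDerivAt_state.1 (hdl n)).2.2.continuousAt
      have h2 := (hasDerivAt_state.1 (hdr n)).2.2.continuousAt
      refine ⟨?_, ?_, ?_⟩
      · rw [hval]; exact (harc (n + 1)).left_pos.le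
      · have : -(z (u (n + 1))).2.2 = (y n (u (n + 1))).2.2 := by rw [hjoin, ← hval]; rfl
        rw [this]
        refine (h1.tendsto.mono_left nhdsWithin_le_nhds).congr' ?_
        exact (hleft n).mono fun s hs => by simp only [hs]
      · rw [hval]
        refine (h2.tendsto.mono_left nhdsWithin_le_nhds).congr' ?_
        exact ((hright n).filter_mono (nhdsWithin_mono _ Ioi_subset_Ici_self)).mono
          fun s hs => by simp only [hs]

/-- Through every state of negative energy which does not graze the wall there is a trajectory. It
is a sequence of arcs, infinite in both directions of time. -/
theorem exists_trajectory {s : State} (hs : s ∈ phaseSpace) (hE : energy s < 0)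
    (hG : 0 < grazing s) : ∃ (z : ℝ → State) (u : ℤ → ℝ), IsTrajectory z ∧ z 0 = s ∧
      StrictMono u ∧ Tendsto u atTop atTop ∧ Tendsto u atBot atBot ∧
      ∀ n, IsArc z (u n) (u (n + 1)) := by
  obtain ⟨y₀, t₁, t₂, h1, h2, h0, harc⟩ := exists_keplerArc hs hE hG
  set E := energy s
  set G := grazing s
  obtain ⟨c, hc0, hc⟩ := exists_int_chain
    (α := {c : (ℝ → State) × ℝ × ℝ // IsKeplerArc E G c.1 c.2.1 c.2.2})
    (R := fun c d => d.1.2.1 = c.1.2.2 ∧ c.1.1 c.1.2.2 = mirror (d.1.1 c.1.2.2))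
    (fun c => by
      obtain ⟨y', b, h3, h4⟩ := c.2.exists_next hE hG
      exact ⟨⟨(y', _, b), h3⟩, rfl, h4⟩)
    (fun c => by
      obtain ⟨y', b, h3, h4⟩ := c.2.exists_prev hE hG
      exact ⟨⟨(y', b, _), h3⟩, rfl, h4⟩)
    ⟨(y₀, t₁, t₂), harc⟩
  set u : ℤ → ℝ := fun n => (c n).1.2.1 with hu
  have hend : ∀ n, (c n).1.2.2 = u (n + 1) := fun n => (hc n).1.symm
  have harcs : ∀ n, IsKeplerArc E G (c n).1.1 (u n) (u (n + 1)) := fun n => hend n ▸ (c n).2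
  have hstep : ∀ n, u n + √G * -E ≤ u (n + 1) := fun n => (harcs n).duration
  have hδ : 0 < √G * -E := mul_pos (Real.sqrt_pos.2 hG) (by linarith)
  have hm : StrictMono u := strictMono_int_of_lt_succ fun n => (harcs n).lt
  have hlin : Monotone fun n : ℤ => u n - n * (√G * -E) := by
    refine monotone_int_of_le_succ fun n => ?_
    push_cast
    linarith [hstep n]
  have htop : Tendsto u atTop atTop := by
    have : Tendsto (fun n : ℤ => u 0 + n * (√G * -E)) atTop atTop :=
      tendsto_atTop_add_const_left _ _ (tendsto_intCast_atTop_atTop.atTop_mul_const hδ)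
    refine tendsto_atTop_mono' _ ?_ this
    filter_upwards [eventually_ge_atTop 0] with n hn
    have := hlin hn
    simp only [Int.cast_zero] at this
    linarith
  have hbot : Tendsto u atBot atBot := by
    have : Tendsto (fun n : ℤ => u 0 + n * (√G * -E)) atBot atBot :=
      tendsto_atBot_add_const_left _ _ ((tendsto_intCast_atBot_iff.2 tendsto_id).atBot_mul_const hδ)
    refine tendsto_atBot_mono' _ ?_ this
    filter_upwards [eventually_le_atBot 0] with n hn
    have := hlin hn
    simp only [Int.cast_zero] at this
    linarith
  have hex := exists_mem_Ico_int hm htop hbot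
  choose N hN1 hN2 using hex
  set z : ℝ → State := fun t => (c (N t)).1.1 t with hzdef
  have hz : ∀ n, ∀ t ∈ Ico (u n) (u (n + 1)), z t = (c n).1.1 t := by
    intro n t ht
    have h3 := hm.lt_iff_lt.1 ((hN1 t).trans_lt ht.2)
    have h4 := hm.lt_iff_lt.1 (ht.1.trans_lt (hN2 t))
    have : N t = n := by omega
    rw [hzdef]
    simp only [this]
  have hu0 : u 0 = t₁ := by simp only [hu, hc0]
  have hu1 : u (0 + 1) = t₂ := by rw [← hend 0, hc0]
  have htraj : IsTrajectory z := isTrajectory_of_arcs (fun t => ⟨N t, hN1 t, hN2 t⟩) harcs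
    (fun n => by have := (hc n).2; rwa [hend n] at this) hz
  refine ⟨z, u, htraj, ?_, hm, htop, hbot, fun n => ⟨(harcs n).lt, ?_, ?_, fun t ht => ?_⟩⟩
  · rw [hz 0 0 ⟨hu0 ▸ h1, hu1 ▸ h2⟩, hc0]
    exact h0
  · rw [hz n _ ⟨le_rfl, (harcs n).lt⟩]; exact (harcs n).wall_left
  · rw [hz (n + 1) _ ⟨le_rfl, (harcs (n + 1)).lt⟩]; exact (harcs (n + 1)).wall_left
  · rw [hz n _ ⟨ht.1.le, ht.2⟩]; exact (harcs n).above t ht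

/-! ### Closed orbits -/

theorem exists_cos_sin {c s : ℝ} (h : c ^ 2 + s ^ 2 = 1) : ∃ φ, Real.cos φ = c ∧ Real.sin φ = s := by
  have hn : ‖(⟨c, s⟩ : ℂ)‖ = 1 := by
    rw [Complex.norm_def, Complex.normSq_mk, Real.sqrt_eq_one]; linarith
  have h0 : (⟨c, s⟩ : ℂ) ≠ 0 := by rw [← norm_ne_zero_iff, hn]; exact one_ne_zero
  exact ⟨Complex.arg ⟨c, s⟩, by rw [Complex.cos_arg h0, hn, div_one],
    by rw [Complex.sin_arg, hn, div_one]⟩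

theorem eq_of_cos_sin_eq {φ ψ : ℝ} (hφ : φ ∈ Ico 0 (2 * Real.pi)) (hψ : ψ ∈ Ico 0 (2 * Real.pi))
    (hc : Real.cos φ = Real.cos ψ) (hs : Real.sin φ = Real.sin ψ) : φ = ψ := by
  obtain ⟨k, hk⟩ := Real.Angle.angle_eq_iff_two_pi_dvd_sub.1 (Real.Angle.cos_sin_inj hc hs)
  have hpi := Real.pi_pos
  have h1 : (k : ℝ) < 1 := by
    by_contra! h
    nlinarith [hφ.2, hψ.1]
  have h2 : (-1 : ℝ) < k := by
    by_contra! h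
    nlinarith [hφ.1, hψ.2]
  have h3 : k = 0 := by
    have h4 : k < 1 := by exact_mod_cast h1
    have h5 : -1 < k := by exact_mod_cast h2
    omega
  rw [h3] at hk
  simp at hk
  linarith

/-- A periodic motion along a simple closed curve `γ` of states, with law of motion `θ`, is a closed
orbit. -/
theorem isClosedOrbit_of_clock {γ : ℝ → State} {θ : ℝ → ℝ} {P T : ℝ} (hT : 0 < T) (h0 : θ 0 = 0)
    (hm : StrictMono θ) (hs : Function.Surjective θ) (hθ : ∀ t, θ (t + T) = θ t + P)
    (hper : Function.Periodic γ P) (hinj : InjOn γ (Ico 0 P))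
    (htraj : IsTrajectory fun t => γ (θ t)) :
    IsClosedOrbit (fun t => γ (θ t)) T (range γ) := by
  have hθT : θ T = P := by simpa [h0] using hθ 0
  have hr : range (fun t => γ (θ t)) = range γ := hs.range_comp γ
  refine ⟨htraj, hT, fun t => ?_, fun t ht u hu h => ?_, hr, fun w hw t₀ hw0 => ?_⟩
  · simp only [hθ, hper (θ t)]
  · refine hm.injective (hinj ?_ ?_ h)
    · exact ⟨h0 ▸ hm.monotone ht.1, hθT ▸ hm ht.2⟩
    · exact ⟨h0 ▸ hm.monotone hu.1, hθT ▸ hm hu.2⟩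
  · rw [← hr] at hw0
    obtain ⟨t₁, h1⟩ := hw0
    exact ⟨_, htraj.eq_translate hw h1.symm⟩

/-! ### Motion along the wall -/

/-- The time spent per unit of the angle `φ` in the motion `x₁ = a sin φ` along the wall. It is
`a cos φ / p₁`, with `p₁` taken from the conservation of energy and the factor `cos φ`, which vanishes
at the turning points, cancelled. -/
def slideClock (a φ : ℝ) : ℝ :=
  √(len (a * Real.sin φ, 1) * len (a, 1) * (len (a * Real.sin φ, 1) + len (a, 1)) / 2)

/-- The closed curve of states of a motion along the wall with amplitude `a`. -/
def slideCurve (a φ : ℝ) : State := ((a * Real.sin φ, 1), (a * Real.cos φ / slideClock a φ, 0))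

theorem one_le_len_wall (x : ℝ) : 1 ≤ len (x, 1) := le_len (x := (x, 1))

theorem slideClock_sq (a φ : ℝ) : slideClock a φ ^ 2 =
    len (a * Real.sin φ, 1) * len (a, 1) * (len (a * Real.sin φ, 1) + len (a, 1)) / 2 := by
  have h1 := one_le_len_wall (a * Real.sin φ)
  have h2 := one_le_len_wall a
  exact Real.sq_sqrt (by positivity)

theorem one_le_slideClock (a φ : ℝ) : 1 ≤ slideClock a φ := by
  have h1 := one_le_len_wall (a * Real.sin φ)
  have h2 := one_le_len_wall a
  refine Real.le_sqrt_of_sq_le ?_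
  have h3 := one_le_mul_of_one_le_of_one_le h1 h2
  nlinarith

theorem continuous_slideClock (a : ℝ) : Continuous (slideClock a) := by
  unfold slideClock
  fun_prop

theorem hasDerivAt_slideCurve_momentum (a φ : ℝ) :
    HasDerivAt (fun φ => a * Real.cos φ / slideClock a φ)
      (-(a * Real.sin φ) / len (a * Real.sin φ, 1) ^ 3 * slideClock a φ) φ := by
  set s₁ := len (a * Real.sin φ, 1) with hs₁
  set s₂ := len (a, 1) with hs₂
  have h1 : 1 ≤ s₁ := one_le_len_wall _
  have h2 : 1 ≤ s₂ := one_le_len_wall _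
  have hW := one_le_slideClock a φ
  have hW2 := slideClock_sq a φ
  rw [← hs₁, ← hs₂] at hW2
  have hd : HasDerivAt (fun φ => len (a * Real.sin φ, 1))
      ((a * Real.sin φ * (a * Real.cos φ) + 1 * 0) / s₁) φ :=
    hasDerivAt_len (x := fun φ => (a * Real.sin φ, (1 : ℝ)))
      ((Real.hasDerivAt_sin φ).const_mul a) (hasDerivAt_const φ 1) (by linarith)
  have hQ := (((hd.mul_const s₂).mul (hd.add_const s₂)).div_const 2).sqrt
    (by change s₁ * s₂ * (s₁ + s₂) / 2 ≠ 0; positivity)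
  have hden := ((Real.hasDerivAt_cos φ).const_mul a).div hQ (by
    change slideClock a φ ≠ 0
    linarith)
  refine hden.congr_deriv ?_
  change (a * -Real.sin φ * slideClock a φ - a * Real.cos φ * (_ / (2 * slideClock a φ))) /
    slideClock a φ ^ 2 = _
  have e1 : s₁ ^ 2 = a ^ 2 * Real.sin φ ^ 2 + 1 := by rw [hs₁, len_sq]; ring
  have e2 : s₂ ^ 2 = a ^ 2 + 1 := by rw [hs₂, len_sq]; ring
  have e3 : a ^ 2 * Real.cos φ ^ 2 = s₂ ^ 2 - s₁ ^ 2 := by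
    rw [e1, e2, Real.cos_sq']; ring
  set W := slideClock a φ
  have hW0 : W ≠ 0 := by linarith
  clear_value s₁ s₂ W
  have hs0 : s₁ ≠ 0 := by linarith
  have key : 4 * W ^ 2 * s₁ ^ 3 + a ^ 2 * Real.cos φ ^ 2 * (s₂ * (2 * s₁ + s₂)) * s₁ ^ 2 =
      4 * W ^ 4 := by
    linear_combination (4 * s₁ ^ 3 - 4 * (W ^ 2 + s₁ * s₂ * (s₁ + s₂) / 2)) * hW2
      + s₂ * (2 * s₁ + s₂) * s₁ ^ 2 * e3
  field_simp
  rw [← hs₁]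
  linear_combination (-a * Real.sin φ) * key

theorem isTrajectory_slide {a : ℝ} {θ : ℝ → ℝ}
    (hθ : ∀ t, HasDerivAt θ (1 / slideClock a (θ t)) t) :
    IsTrajectory fun t => slideCurve a (θ t) where
  above_wall t := le_rfl
  deriv_x₁ t := (((Real.hasDerivAt_sin _).const_mul a).comp t (hθ t)).congr_deriv (by
    simp only [slideCurve]; ring)
  deriv_p₁ t := ((hasDerivAt_slideCurve_momentum a (θ t)).comp t (hθ t)).congr_deriv (by
    have := one_le_slideClock a (θ t)
    simp only [slideCurve]; field_simp)
  continuous_x₂ := continuous_const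
  deriv_x₂ t ht := absurd ht (lt_irrefl _)
  deriv_p₂ t ht := absurd ht (lt_irrefl _)
  reflection t _ := by simp [slideCurve]

theorem slideCurve_periodic (a : ℝ) : Function.Periodic (slideCurve a) (2 * Real.pi) := fun φ => by
  simp [slideCurve, slideClock]

theorem slideClock_periodic (a : ℝ) : Function.Periodic (slideClock a) (2 * Real.pi) := fun φ => by
  simp [slideClock]

theorem slideCurve_injOn {a : ℝ} (ha : 0 < a) :
    InjOn (slideCurve a) (Ico 0 (2 * Real.pi)) := by
  intro φ hφ ψ hψ h
  simp only [slideCurve, Prod.mk.injEq] at h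
  have hs : Real.sin φ = Real.sin ψ := mul_left_cancel₀ ha.ne' h.1.1
  have hW : slideClock a φ = slideClock a ψ := by simp only [slideClock, hs]
  have hc := h.2.1
  have h1 := one_le_slideClock a ψ
  rw [hW, div_left_inj' (by linarith)] at hc
  exact eq_of_cos_sin_eq hφ hψ (mul_left_cancel₀ ha.ne' hc) hs

theorem range_slideCurve {D E a : ℝ} (hDE : D + 2 * E = 0) (ha : 0 < a) (hE : -E * len (a, 1) = 1) :
    range (slideCurve a) = levelSet D E := by
  have h2 := one_le_len_wall a
  have hE' : E = -1 / len (a, 1) := by field_simp; linarith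
  have e2 : len (a, 1) ^ 2 = a ^ 2 + 1 := by rw [len_sq]; ring
  have hkey : ∀ x p : ℝ, ((x, 1), (p, 0)) ∈ levelSet D E ↔ energy ((x, 1), (p, 0)) = E := by
    intro x p
    have hg : grazing ((x, 1), (p, 0)) = 0 :=
      (grazing_eq_zero_iff (s := ((x, 1), (p, 0))) le_rfl).2 ⟨rfl, rfl⟩
    unfold grazing at hg
    exact ⟨fun h => h.2.1, fun h => ⟨⟨le_rfl, fun _ => le_rfl⟩, h, by linarith⟩⟩
  ext s
  constructor
  · rintro ⟨φ, rfl⟩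
    refine (hkey _ _).2 ?_
    rw [energy_eq, hE']
    simp only
    have h1 := one_le_len_wall (a * Real.sin φ)
    have e1 : len (a * Real.sin φ, 1) ^ 2 = a ^ 2 * Real.sin φ ^ 2 + 1 := by rw [len_sq]; ring
    have e3 : a ^ 2 * Real.cos φ ^ 2 = len (a, 1) ^ 2 - len (a * Real.sin φ, 1) ^ 2 := by
      rw [e1, e2, Real.cos_sq']; ring
    rw [div_pow, mul_pow, slideClock_sq, e3]
    field_simp
    ring
  · intro hs
    obtain ⟨⟨x, y⟩, p, q⟩ := s
    have hg : grazing ((x, y), p, q) = 0 := by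
      unfold grazing; rw [hs.2.1, hs.2.2]; exact hDE
    obtain ⟨h3, h4⟩ := (grazing_eq_zero_iff hs.1.1).1 hg
    simp only at h3 h4
    subst h3 h4
    have he := (hkey x p).1 hs
    have h1 := one_le_len_wall x
    have e1 : len (x, 1) ^ 2 = x ^ 2 + 1 := by rw [len_sq]; ring
    rw [energy_eq, hE'] at he
    simp only at he
    have hp : p ^ 2 = 2 * (len (a, 1) - len (x, 1)) / (len (x, 1) * len (a, 1)) := by
      field_simp at he ⊢
      linarith
    set W := √(len (x, 1) * len (a, 1) * (len (x, 1) + len (a, 1)) / 2) with hW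
    have hW2 : W ^ 2 = len (x, 1) * len (a, 1) * (len (x, 1) + len (a, 1)) / 2 :=
      Real.sq_sqrt (by positivity)
    have hW0 : 0 < W := Real.sqrt_pos.2 (by positivity)
    have hpW : p ^ 2 * W ^ 2 = a ^ 2 - x ^ 2 := by
      rw [hp, hW2]
      field_simp
      linear_combination e2 - e1
    obtain ⟨φ, hc, hs⟩ := exists_cos_sin (c := p * W / a) (s := x / a) (by
      field_simp
      linarith)
    refine ⟨φ, ?_⟩
    have hx : a * Real.sin φ = x := by rw [hs]; field_simp
    have hp' : a * Real.cos φ = p * W := by rw [hc]; field_simp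
    simp only [slideCurve, slideClock, hx, hp', ← hW]
    rw [mul_div_cancel_right₀ _ hW0.ne']

/-- Perturbations of the motion along the wall grow at most exponentially. -/
theorem dist_le_of_approx_slide {f f' g : ℝ → ℝ × ℝ} {ε δ : ℝ} (hf : ∀ t, HasDerivAt f (f' t) t)
    (hε : ∀ t, dist (f' t) (slideField (f t)) ≤ ε) (hg : ∀ t, HasDerivAt g (slideField (g t)) t)
    (h0 : dist (f 0) (g 0) ≤ δ) (t : ℝ) :
    dist (f t) (g t) ≤ gronwallBound δ 4 ε |t| := by
  have forward : ∀ {f f' g : ℝ → ℝ × ℝ}, (∀ t, HasDerivAt f (f' t) t) →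
      (∀ t, dist (f' t) (slideField (f t)) ≤ ε) → (∀ t, HasDerivAt g (slideField (g t)) t) →
      dist (f 0) (g 0) ≤ δ → ∀ t, 0 ≤ t → dist (f t) (g t) ≤ gronwallBound δ 4 ε t := by
    intro f f' g hf hε hg h0 t ht
    have := dist_le_of_approx_trajectories_ODE (v := fun _ => slideField) (K := 4) (a := 0) (b := t)
      (εf := ε) (εg := 0) (f' := f') (g' := fun t => slideField (g t))
      (fun _ => lipschitz_slideField)
      (HasDerivAt.continuousOn fun t _ => hf t) (fun t _ => (hf t).hasDerivWithinAt)
      (fun t _ => hε t) (HasDerivAt.continuousOn fun t _ => hg t)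
      (fun t _ => (hg t).hasDerivWithinAt) (fun t _ => by simp) h0 t ⟨ht, le_rfl⟩
    simpa using this
  rcases le_total 0 t with ht | ht
  · rw [abs_of_nonneg ht]; exact forward hf hε hg h0 t ht
  · -- for negative times the reversed motions are compared
    rw [abs_of_nonpos ht]
    have hrev : ∀ {f : ℝ → ℝ × ℝ} {v : ℝ × ℝ} {t : ℝ}, HasDerivAt f v (-t) →
        HasDerivAt (fun t => ((f (-t)).1, -(f (-t)).2)) (-v.1, v.2) t := fun {f v t} h => by
      have hn : HasDerivAt (fun s : ℝ => -s) (-1) t := hasDerivAt_neg t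
      have h1 : HasDerivAt (fun s => (f s).1) v.1 (-t) := h.fst
      have h2 : HasDerivAt (fun s => (f s).2) v.2 (-t) := h.snd
      exact ((h1.comp t hn).congr_deriv (by simp)).prodMk
        ((h2.comp t hn).neg.congr_deriv (by simp))
    have := forward (f := fun t => ((f (-t)).1, -(f (-t)).2))
      (f' := fun t => (-(f' (-t)).1, (f' (-t)).2)) (g := fun t => ((g (-t)).1, -(g (-t)).2))
      (fun t => hrev (hf (-t))) (fun t => ?_) (fun t => hrev (hg (-t))) ?_ (-t) (by linarith)
    · simpa [Prod.dist_eq, dist_neg_neg] using this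
    · have := hε (-t)
      simpa [Prod.dist_eq, slideField, dist_neg_neg] using this
    · simpa [Prod.dist_eq, dist_neg_neg] using h0

/-- The horizontal force at height `y` differs from the one at the wall by at most `3 (y - 1)`. -/
theorem force_sub_le {x y : ℝ} (hy : 1 ≤ y) :
    |-x / len (x, y) ^ 3 - -x / len (x, 1) ^ 3| ≤ 3 * (y - 1) := by
  set r := len (x, y) with hr
  set s := len (x, 1) with hs
  have hs1 : 1 ≤ s := one_le_len_wall x
  have hry : y ≤ r := le_len (x := (x, y))
  have er : r ^ 2 = x ^ 2 + y ^ 2 := len_sq (x, y)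
  have es : s ^ 2 = x ^ 2 + 1 := by rw [hs, len_sq]; ring
  clear_value r s
  have hsr : s ≤ r := by nlinarith
  have h1 : r - s ≤ y - 1 := by nlinarith
  have hx : |x| ≤ s := abs_le_of_sq_le_sq (by linarith) (by linarith)
  have hr0 : 0 < r := by linarith
  have hs0 : 0 < s := by linarith
  have e : -x / r ^ 3 - -x / s ^ 3 = x * ((r - s) * (r ^ 2 + r * s + s ^ 2) / (r ^ 3 * s ^ 3)) := by
    field_simp; ring
  have h2 : (r - s) * (r ^ 2 + r * s + s ^ 2) / (r ^ 3 * s ^ 3) ≤ 3 * (y - 1) / s := by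
    rw [div_le_div_iff₀ (by positivity) hs0]
    have h3 : r ^ 2 + r * s + s ^ 2 ≤ 3 * r ^ 2 := by nlinarith
    have h4 : (r - s) * (r ^ 2 + r * s + s ^ 2) ≤ (y - 1) * (3 * r ^ 2) :=
      mul_le_mul h1 h3 (by positivity) (by linarith)
    have h5 : r ^ 2 * s ≤ r ^ 3 * s ^ 3 := by
      have : 1 ≤ r * s ^ 2 := one_le_mul_of_one_le_of_one_le (by linarith) (one_le_pow₀ hs1)
      nlinarith [mul_pos (pow_pos hr0 2) hs0]
    nlinarith
  have h0 : 0 ≤ (r - s) * (r ^ 2 + r * s + s ^ 2) / (r ^ 3 * s ^ 3) := by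
    have : 0 ≤ r - s := by linarith
    positivity
  rw [e, abs_mul, abs_of_nonneg h0]
  calc _ ≤ s * (3 * (y - 1) / s) := mul_le_mul hx h2 h0 hs0.le
    _ = _ := by field_simp

/-- The integral `D + 2E` bounds the distance from the wall and the vertical momentum. -/
theorem bounds_of_grazing {s : State} (h : 1 ≤ s.1.2) {κ : ℝ} (hκ : 0 < κ) (hE : energy s ≤ -κ) :
    s.1.2 - 1 ≤ grazing s / (2 * κ) ∧ s.2.2 ^ 2 ≤ grazing s := by
  have hr := len_pos h
  have h1 := grazing_eq h
  have h2 : 0 ≤ s.1.2 - 1 := by linarith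
  have h3 : 0 ≤ 2 * (s.1.2 - 1) / len s.1 := by positivity
  have h4 := sq_nonneg (s.1.1 * s.2.2 - (s.1.2 - 1) * s.2.1)
  have h5 := sq_nonneg s.2.2
  have h6 : κ ≤ 1 / len s.1 := by
    rw [energy_eq] at hE
    linarith [sq_nonneg s.2.1]
  refine ⟨?_, by linarith⟩
  rw [le_div_iff₀ (by positivity)]
  have h7 : (s.1.2 - 1) * (2 * κ) ≤ 2 * (s.1.2 - 1) / len s.1 := by
    have := mul_le_mul_of_nonneg_left h6 (by linarith : 0 ≤ 2 * (s.1.2 - 1))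
    rw [mul_one_div] at this
    linarith
  linarith

/-- A motion along the wall is the limit of all trajectories whose initial states tend to its
initial state. -/
theorem tendsto_slide {w : ℕ → ℝ → State} {z : ℝ → State} (hz : IsTrajectory z)
    (hE : energy (z 0) < 0) (hG : grazing (z 0) = 0) (hw : ∀ n, IsTrajectory (w n))
    (h0 : Tendsto (fun n => w n 0) atTop (𝓝 (z 0))) : TendstoLocallyUniformly w z atTop := by
  obtain ⟨κ, hκ, hEκ⟩ : ∃ κ, 0 < κ ∧ energy (z 0) < -κ :=
    ⟨-energy (z 0) / 2, by linarith, by linarith⟩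
  have hz1 := hz.above_wall 0
  have hev : ∀ᶠ n in atTop, energy (w n 0) ≤ -κ :=
    (((continuousAt_energy hz1).tendsto.comp h0).eventually (gt_mem_nhds hEκ)).mono
      fun n hn => hn.le
  have hgr : Tendsto (fun n => grazing (w n 0)) atTop (𝓝 0) := by
    have := (continuousAt_grazing hz1).tendsto.comp h0
    rwa [hG] at this
  have hd : Tendsto (fun n => dist (w n 0) (z 0)) atTop (𝓝 0) := tendsto_iff_dist_tendsto_zero.1 h0
  have hsq : Tendsto (fun n => √(grazing (w n 0))) atTop (𝓝 0) := by
    have := (Real.continuous_sqrt.tendsto 0).comp hgr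
    rwa [Real.sqrt_zero] at this
  have hy : Tendsto (fun n => grazing (w n 0) / (2 * κ)) atTop (𝓝 0) := by
    simpa using hgr.div_const (2 * κ)
  rw [Metric.tendstoLocallyUniformly_iff]
  intro ε hε t₀
  set M := |t₀| + 1
  have hb : Tendsto (fun n => gronwallBound (dist (w n 0) (z 0)) 4
      (3 * (grazing (w n 0) / (2 * κ))) M) atTop (𝓝 0) := by
    simp only [gronwallBound_of_K_ne_0 (show (4 : ℝ) ≠ 0 by norm_num)]
    have h1 := (hd.mul_const (Real.exp (4 * M))).add
      (((hy.const_mul 3).div_const 4).mul_const (Real.exp (4 * M) - 1))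
    simpa using h1
  refine ⟨Ioo (t₀ - 1) (t₀ + 1), Ioo_mem_nhds (by linarith) (by linarith), ?_⟩
  filter_upwards [hev, hb.eventually (gt_mem_nhds hε), hy.eventually (gt_mem_nhds hε),
    hsq.eventually (gt_mem_nhds hε)] with n hn hn1 hn2 hn3 t ht
  have htM : |t| ≤ M := by
    have h1 : |t - t₀| ≤ 1 := abs_le.2 ⟨by linarith [ht.1], by linarith [ht.2]⟩
    have h2 := abs_add_le (t - t₀) t₀
    rw [sub_add_cancel] at h2
    linarith
  have hbd : ∀ s, (w n s).1.2 - 1 ≤ grazing (w n 0) / (2 * κ) ∧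
      (w n s).2.2 ^ 2 ≤ grazing (w n 0) := fun s => by
    have := bounds_of_grazing ((hw n).above_wall s) hκ (((hw n).energy_eq s 0).trans_le hn)
    rwa [(hw n).grazing_eq s 0] at this
  have hgn : 0 ≤ grazing (w n 0) := grazing_nonneg ((hw n).above_wall 0)
  -- the projection to the wall nearly obeys the equation of the motion along the wall
  have hproj := dist_le_of_approx_slide
    (f := fun t => ((w n t).1.1, (w n t).2.1)) (g := fun t => ((z t).1.1, (z t).2.1))
    (ε := 3 * (grazing (w n 0) / (2 * κ))) (δ := dist (w n 0) (z 0))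
    (fun t => ((hw n).deriv_x₁ t).prodMk ((hw n).deriv_p₁ t)) (fun s => by
      have h1 := force_sub_le (x := (w n s).1.1) ((hw n).above_wall s)
      have h2 := (hbd s).1
      simp only [slideField, Prod.dist_eq, dist_self, Real.dist_eq]
      exact max_le (by positivity) (h1.trans (by linarith)))
    (hz.slide_hasDerivAt hG) (by
      simp only [Prod.dist_eq]
      exact max_le ((le_max_left _ _).trans (le_max_left _ _))
        ((le_max_left _ _).trans (le_max_right _ _))) t
  have hproj2 := hproj.trans (gronwallBound_mono dist_nonneg (by positivity) (by norm_num) htM)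
  have hlt := hproj2.trans_lt hn1
  simp only [Prod.dist_eq, max_lt_iff] at hlt
  obtain ⟨hzt1, hzt2⟩ := hz.slides hG t
  rw [dist_comm]
  simp only [Prod.dist_eq, max_lt_iff]
  refine ⟨⟨hlt.1, ?_⟩, hlt.2, ?_⟩
  · rw [hzt1, Real.dist_eq, abs_of_nonneg (by linarith [(hw n).above_wall t])]
    exact (hbd t).1.trans_lt hn2
  · rw [hzt2, Real.dist_eq, sub_zero]
    exact (Real.abs_le_sqrt (hbd t).2).trans_lt hn3

/-- Approximating bouncing motions start with a small vertical momentum. -/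
theorem isBouncingLimit_slide {z : ℝ → State} (hz : IsTrajectory z)
    (hE : energy (z 0) < 0) (hG : grazing (z 0) = 0) : IsBouncingLimit z := by
  refine ⟨?_, fun w hw => tendsto_slide hz hE hG (fun n => (hw.1 n).1) hw.2⟩
  obtain ⟨h1, h2⟩ := hz.slides hG 0
  set c := √(-energy (z 0)) with hc
  have hc0 : 0 < c := Real.sqrt_pos.2 (by linarith)
  have hc2 : c ^ 2 = -energy (z 0) := Real.sq_sqrt (by linarith)
  set s : ℕ → State := fun n => ((z 0).1, ((z 0).2.1, c / (n + 1))) with hs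
  have hpos : ∀ n : ℕ, 0 < c / ((n : ℝ) + 1) := fun n => by positivity
  have hle : ∀ n : ℕ, c / ((n : ℝ) + 1) ≤ c := fun n =>
    div_le_self hc0.le (by linarith [n.cast_nonneg (α := ℝ)])
  have hsE : ∀ n, energy (s n) < 0 := fun n => by
    have h3 : energy (s n) = energy (z 0) + (c / ((n : ℝ) + 1)) ^ 2 / 2 := by
      simp only [energy_eq, hs, h2]; ring
    have h4 : (c / ((n : ℝ) + 1)) ^ 2 ≤ c ^ 2 := pow_le_pow_left₀ (hpos n).le (hle n) 2
    rw [h3]; linarith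
  have hsG : ∀ n, 0 < grazing (s n) := fun n => by
    rw [wall_grazing_eq (by exact h1)]
    have := hpos n
    simp only [hs]
    positivity
  have hex := fun n => exists_trajectory (s := s n) ⟨h1.ge, fun _ => (hpos n).le⟩ (hsE n) (hsG n)
  choose w u hw hw0 _ using hex
  refine ⟨w, fun n => ⟨hw n, fun h => ?_⟩, ?_⟩
  · rw [hw0 n] at h
    exact (hpos n).ne' h.2
  · simp only [hw0]
    have h3 : Tendsto (fun n : ℕ => c / ((n : ℝ) + 1)) atTop (𝓝 0) := by
      simpa [div_eq_mul_inv] using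
        (tendsto_one_div_add_atTop_nhds_zero_nat (𝕜 := ℝ)).const_mul c
    have h4 : z 0 = ((z 0).1, ((z 0).2.1, 0)) := Prod.ext rfl (Prod.ext rfl h2)
    rw [h4]
    exact tendsto_const_nhds.prodMk_nhds (tendsto_const_nhds.prodMk_nhds h3)

/-- For `D + 2E = 0` the level set is the closed orbit of a motion along the wall. -/
theorem wall_orbit {D E : ℝ} (hDE : D + 2 * E = 0) (hD : 0 < D) (hD2 : D < 2) :
    ∃ z T, IsClosedOrbit z T (levelSet D E) ∧ IsBouncingLimit z ∧
        ∃ a b : ℝ, 0 < a ∧ a < b ∧ causticPlus D E = wallEllipse a b ∧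
          trace z = segment ℝ ((-a, 1) : ℝ × ℝ) (a, 1) := by
  have hE : E < 0 := by linarith
  have hE0 : E ≠ 0 := hE.ne
  have hE1 : -E < 1 := by linarith
  have hE2 : 1 < 1 / E ^ 2 := by rw [lt_div_iff₀ (by positivity)]; nlinarith
  set a := √(1 / E ^ 2 - 1) with ha
  have ha0 : 0 < a := Real.sqrt_pos.2 (by linarith)
  have ha2 : a ^ 2 = 1 / E ^ 2 - 1 := Real.sq_sqrt (by linarith)
  have hb : len (a, 1) = -1 / E := by
    have h1 := len_sq (a, 1)
    simp only [ha2] at h1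
    have h2 : 0 < -1 / E := div_pos_of_neg_of_neg (by norm_num) hE
    refine (pow_left_inj₀ (len_nonneg _) h2.le two_ne_zero).1 ?_
    rw [h1]; field_simp; ring
  have hbE : -E * len (a, 1) = 1 := by rw [hb]; field_simp
  obtain ⟨θ, T, hT, h0, hm, hs, hd, hθ⟩ := exists_periodic_clock (continuous_slideClock a) one_pos
    (one_le_slideClock a) Real.two_pi_pos (slideClock_periodic a)
  have htraj := isTrajectory_slide hd
  have hcl := isClosedOrbit_of_clock hT h0 hm hs hθ (slideCurve_periodic a) (slideCurve_injOn ha0)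
    htraj
  rw [range_slideCurve hDE ha0 hbE] at hcl
  have hmem : slideCurve a (θ 0) ∈ levelSet D E := by
    rw [← range_slideCurve hDE ha0 hbE]; exact mem_range_self _
  refine ⟨_, T, hcl, isBouncingLimit_slide htraj (by rw [hmem.2.1]; exact hE)
    (by unfold grazing; rw [hmem.2.1, hmem.2.2]; exact hDE), a, -1 / E, ha0, ?_, ?_, ?_⟩
  · have h2 : 0 < -1 / E := div_pos_of_neg_of_neg (by norm_num) hE
    refine lt_of_pow_lt_pow_left₀ 2 h2.le ?_
    rw [ha2, div_pow]; linarith [show (-1 : ℝ) ^ 2 / E ^ 2 = 1 / E ^ 2 by norm_num]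
  · have hR : radiusR D E = 1 := by
      unfold radiusR
      rw [show D = -2 * E by linarith, Real.sqrt_eq_one]; ring
    have h3 : ((1 + 1 : ℝ) / (2 * E)) ^ 2 = (-1 / E) ^ 2 := by field_simp; norm_num
    have h4 : (-1 / E) ^ 2 - 1 = a ^ 2 := by rw [ha2]; field_simp
    unfold causticPlus wallEllipse
    rw [hR, h3, h4]
  · have h5 : segment ℝ ((-a, 1) : ℝ × ℝ) (a, 1) = (fun x => (x, (1 : ℝ))) '' Icc (-a) a := by
      rw [← Prod.image_mk_segment_left, segment_eq_Icc (by linarith)]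
    rw [h5]
    unfold trace
    ext x
    constructor
    · rintro ⟨t, rfl⟩
      refine ⟨a * Real.sin (θ t), ⟨?_, ?_⟩, rfl⟩
      · nlinarith [Real.neg_one_le_sin (θ t)]
      · nlinarith [Real.sin_le_one (θ t)]
    · rintro ⟨y, hy, rfl⟩
      obtain ⟨t, ht⟩ := hs (Real.arcsin (y / a))
      refine ⟨t, ?_⟩
      simp only [slideCurve, ht]
      rw [Real.sin_arcsin (by rw [le_div_iff₀ ha0]; linarith [hy.1])
        (by rw [div_le_one ha0]; exact hy.2), mul_div_cancel₀ _ ha0.ne']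

/-! ### Bouncing motions parametrized by an angle -/

/-- The sign of `sin` near and to the right of `φ`. -/
def side (φ : ℝ) : ℝ :=
  open Classical in if 0 < Real.sin φ ∨ (Real.sin φ = 0 ∧ 0 < Real.cos φ) then 1 else -1

theorem side_eq {σ φ : ℝ} (hσ : σ = 1 ∨ σ = -1)
    (h : 0 < σ * Real.sin φ ∨ (Real.sin φ = 0 ∧ 0 < σ * Real.cos φ)) : side φ = σ := by
  unfold side
  rcases hσ with rfl | rfl
  · rw [if_pos (by simpa using h)]
  · rw [if_neg]
    rintro (h1 | ⟨h1, h2⟩) <;> rcases h with h | ⟨h, h'⟩ <;> linarith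

theorem side_sq (φ : ℝ) : side φ ^ 2 = 1 := by unfold side; split_ifs <;> norm_num

theorem side_mul_abs_sin (φ : ℝ) : side φ * |Real.sin φ| = Real.sin φ := by
  rcases lt_trichotomy (Real.sin φ) 0 with h | h | h
  · rw [side_eq (σ := -1) (Or.inr rfl) (Or.inl (by linarith)), abs_of_neg h]; ring
  · simp [h]
  · rw [side_eq (σ := 1) (Or.inl rfl) (Or.inl (by linarith)), abs_of_pos h]; ring

theorem side_mul_sin (φ : ℝ) : side φ * Real.sin φ = |Real.sin φ| := by
  rw [← side_mul_abs_sin φ]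
  rw [abs_mul, abs_abs, show |side φ| = 1 by unfold side; split_ifs <;> norm_num]
  linear_combination |Real.sin φ| * side_sq φ

theorem side_eq_of_mul_pos {φ ψ : ℝ} (h : 0 < side φ * Real.sin ψ) : side ψ = side φ :=
  side_eq (by unfold side; split_ifs <;> simp) (Or.inl h)

theorem side_eventually_eq {φ : ℝ} (h : Real.sin φ ≠ 0) : ∀ᶠ ψ in 𝓝 φ, side ψ = side φ := by
  have h1 : 0 < side φ * Real.sin φ := by rw [side_mul_sin]; exact abs_pos.2 h
  have h2 : Continuous fun ψ => side φ * Real.sin ψ := by fun_prop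
  exact ((h2.tendsto φ).eventually (lt_mem_nhds h1)).mono fun ψ => side_eq_of_mul_pos

theorem hasDerivAt_abs_sin {φ : ℝ} (h : Real.sin φ ≠ 0) :
    HasDerivAt (fun φ => |Real.sin φ|) (side φ * Real.cos φ) φ := by
  refine ((Real.hasDerivAt_sin φ).const_mul (side φ)).congr_of_eventuallyEq ?_
  filter_upwards [side_eventually_eq h] with ψ hψ
  rw [← side_mul_sin, hψ]

theorem side_cos_of_sin_eq_zero {φ : ℝ} (h : Real.sin φ = 0) : side φ * Real.cos φ = 1 := by
  have h1 := Real.sin_sq_add_cos_sq φ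
  rw [h] at h1
  have h2 : Real.cos φ = 1 ∨ Real.cos φ = -1 := mul_self_eq_one_iff.1 (by rw [← pow_two]; linarith)
  rcases h2 with h2 | h2
  · rw [side_eq (σ := 1) (Or.inl rfl) (Or.inr ⟨h, by linarith⟩), h2]; ring
  · rw [side_eq (σ := -1) (Or.inr rfl) (Or.inr ⟨h, by linarith⟩), h2]; ring

theorem side_add_pi (φ : ℝ) : side (φ + Real.pi) = -side φ := by
  refine side_eq (by unfold side; split_ifs <;> simp) ?_
  rw [Real.sin_add_pi, Real.cos_add_pi, neg_mul_neg, neg_mul_neg, side_mul_sin, neg_eq_zero]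
  by_cases h : Real.sin φ = 0
  · exact Or.inr ⟨h, by rw [side_cos_of_sin_eq_zero h]; exact one_pos⟩
  · exact Or.inl (abs_pos.2 h)

theorem side_add_two_pi (φ : ℝ) : side (φ + 2 * Real.pi) = side φ := by
  unfold side; simp

theorem tendsto_side_cos {φ : ℝ} (h : Real.sin φ = 0) :
    Tendsto (fun ψ => side ψ * Real.cos ψ) (𝓝[>] φ) (𝓝 1) ∧
      Tendsto (fun ψ => side ψ * Real.cos ψ) (𝓝[<] φ) (𝓝 (-1)) := by
  have hd : HasDerivAt (fun ψ => side φ * Real.sin ψ) 1 φ :=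
    ((Real.hasDerivAt_sin φ).const_mul _).congr_deriv (side_cos_of_sin_eq_zero h)
  have hsl := (hasDerivAt_iff_tendsto_slope.1 hd).eventually (lt_mem_nhds one_pos)
  have hc : Tendsto (fun ψ => side φ * Real.cos ψ) (𝓝 φ) (𝓝 1) := by
    have : Continuous fun ψ => side φ * Real.cos ψ := by fun_prop
    have := this.tendsto φ
    rwa [side_cos_of_sin_eq_zero h] at this
  rw [← nhdsLT_sup_nhdsGT, eventually_sup] at hsl
  constructor
  · refine (hc.mono_left nhdsWithin_le_nhds).congr' ?_
    filter_upwards [hsl.2, self_mem_nhdsWithin] with ψ h1 (h2 : φ < ψ)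
    rw [slope_def_field, h, mul_zero, sub_zero] at h1
    rw [side_eq_of_mul_pos ((div_pos_iff_of_pos_right (sub_pos.2 h2)).1 h1)]
  · refine (hc.neg.mono_left nhdsWithin_le_nhds).congr' ?_
    filter_upwards [hsl.1, self_mem_nhdsWithin] with ψ h1 (h2 : ψ < φ)
    rw [slope_def_field, h, mul_zero, sub_zero] at h1
    have h3 : side φ * Real.sin ψ < 0 := by
      by_contra! h4
      exact absurd h1 (not_lt.2 (div_nonpos_of_nonneg_of_nonpos h4 (by linarith)))
    have h4 : side ψ = -side φ := side_eq (by unfold side; split_ifs <;> simp)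
      (Or.inl (by linarith))
    rw [h4]; ring

/-- The curve of states with `x₁ = X(φ)`, `p₁ = P(φ)`, `x₂ = 1 + b |sin φ|` in a motion whose time
element is `dt = ω(φ) dφ`. It is at the wall when `sin φ = 0`; there `side` makes the momentum the
outgoing one. -/
def foldCurve (X P ω : ℝ → ℝ) (b φ : ℝ) : State :=
  ((X φ, 1 + b * |Real.sin φ|), (P φ, b * (side φ * Real.cos φ) / ω φ))

/-- The hypotheses are Kepler's equation with respect to `φ`; the sign change of `side` at the zeros
of `sin` is the reflection. -/
theorem isTrajectory_foldCurve {X P ω θ : ℝ → ℝ} {b : ℝ} (hb : 0 < b) (hω : ∀ φ, 0 < ω φ)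
    (hc : Continuous ω) (hX : ∀ φ, HasDerivAt X (P φ * ω φ) φ)
    (hP : ∀ φ, HasDerivAt P (-X φ / len (X φ, 1 + b * |Real.sin φ|) ^ 3 * ω φ) φ)
    (hQ : ∀ φ, Real.sin φ ≠ 0 → HasDerivAt (fun φ => b * Real.cos φ / ω φ)
      (side φ * (-(1 + b * |Real.sin φ|) / len (X φ, 1 + b * |Real.sin φ|) ^ 3 * ω φ)) φ)
    (hm : StrictMono θ) (hθ : ∀ t, HasDerivAt θ (1 / ω (θ t)) t) :
    IsTrajectory fun t => foldCurve X P ω b (θ t) := by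
  have hne : ∀ φ, 1 < 1 + b * |Real.sin φ| → Real.sin φ ≠ 0 := fun φ h h0 => by
    simp [h0] at h
  constructor
  · intro t
    have : 0 ≤ b * |Real.sin (θ t)| := by positivity
    simp only [foldCurve]
    linarith
  · intro t
    have := hω (θ t)
    exact ((hX _).comp t (hθ t)).congr_deriv (by simp only [foldCurve]; field_simp)
  · intro t
    have := hω (θ t)
    exact ((hP _).comp t (hθ t)).congr_deriv (by simp only [foldCurve]; field_simp)
  · have hθc : Continuous θ := continuous_iff_continuousAt.2 fun t => (hθ t).continuousAt
    simp only [foldCurve]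
    fun_prop
  · intro t ht
    have := hω (θ t)
    exact ((((hasDerivAt_abs_sin (hne _ ht)).const_mul b).const_add 1).comp t (hθ t)).congr_deriv
      (by simp only [foldCurve]; field_simp)
  · intro t ht
    have h0 := hω (θ t)
    have h1 : HasDerivAt (fun φ => b * (side φ * Real.cos φ) / ω φ)
        (-(1 + b * |Real.sin (θ t)|) / len (X (θ t), 1 + b * |Real.sin (θ t)|) ^ 3 * ω (θ t))
        (θ t) := by
      have h2 := ((hQ _ (hne _ ht)).const_mul (side (θ t))).congr_of_eventuallyEq
        (f₁ := fun φ => b * (side φ * Real.cos φ) / ω φ) (by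
          filter_upwards [side_eventually_eq (hne _ ht)] with ψ hψ
          rw [hψ]; ring)
      refine h2.congr_deriv ?_
      rw [← mul_assoc, ← pow_two, side_sq, one_mul]
    exact (h1.comp t (hθ t)).congr_deriv (by simp only [foldCurve]; field_simp)
  · intro t ht
    have h0 := hω (θ t)
    have hs : Real.sin (θ t) = 0 := by
      simp only [foldCurve, add_eq_left, mul_eq_zero, abs_eq_zero] at ht
      exact ht.resolve_left hb.ne'
    obtain ⟨h1, h2⟩ := tendsto_side_cos hs
    have hωt : Tendsto ω (𝓝 (θ t)) (𝓝 (ω (θ t))) := hc.tendsto _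
    have hr : Tendsto θ (𝓝[>] t) (𝓝[>] (θ t)) :=
      tendsto_nhdsWithin_of_tendsto_nhds_of_eventually_within _
        ((hθ t).continuousAt.tendsto.mono_left nhdsWithin_le_nhds)
        (eventually_mem_nhdsWithin.mono fun s hs => hm hs)
    have hl : Tendsto θ (𝓝[<] t) (𝓝[<] (θ t)) :=
      tendsto_nhdsWithin_of_tendsto_nhds_of_eventually_within _
        ((hθ t).continuousAt.tendsto.mono_left nhdsWithin_le_nhds)
        (eventually_mem_nhdsWithin.mono fun s hs => hm hs)
    simp only [foldCurve, side_cos_of_sin_eq_zero hs]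
    refine ⟨by positivity, ?_, ?_⟩
    · rw [show -(b * 1 / ω (θ t)) = b * -1 / ω (θ t) by ring]
      exact ((h2.const_mul b).div (hωt.mono_left nhdsWithin_le_nhds) h0.ne').comp hl
    · exact ((h1.const_mul b).div (hωt.mono_left nhdsWithin_le_nhds) h0.ne').comp hr

/-! ### The vertical orbit -/

/-- The time spent per unit of the angle `φ` in the vertical motion `x₂ = 1 + c |sin φ|`, from the
conservation of energy. As in `slideClock`, the factor `cos φ` is cancelled. -/
def verticalClock (c φ : ℝ) : ℝ :=
  √(c * (1 + c) * ((1 + |Real.sin φ|) * (1 + c * |Real.sin φ|)) / 2)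

theorem verticalClock_sq {c : ℝ} (hc : 0 < c) (φ : ℝ) : verticalClock c φ ^ 2 =
    c * (1 + c) * ((1 + |Real.sin φ|) * (1 + c * |Real.sin φ|)) / 2 :=
  Real.sq_sqrt (by positivity)

theorem verticalClock_pos {c : ℝ} (hc : 0 < c) (φ : ℝ) : 0 < verticalClock c φ :=
  Real.sqrt_pos.2 (by positivity)

/-- The states of the vertical motion up to the height `1 + c`. -/
def verticalCurve (c : ℝ) : ℝ → State := foldCurve (fun _ => 0) (fun _ => 0) (verticalClock c) c

theorem len_vertical {y : ℝ} (hy : 0 ≤ y) : len (0, y) = y := by simp [len, Real.sqrt_sq hy]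

theorem isTrajectory_vertical {c : ℝ} (hc : 0 < c) {θ : ℝ → ℝ} (hm : StrictMono θ)
    (hθ : ∀ t, HasDerivAt θ (1 / verticalClock c (θ t)) t) :
    IsTrajectory fun t => verticalCurve c (θ t) := by
  refine isTrajectory_foldCurve hc (verticalClock_pos hc) (by unfold verticalClock; fun_prop)
    (fun φ => ?_) (fun φ => ?_) (fun φ hφ => ?_) hm hθ
  · simpa using hasDerivAt_const φ (0 : ℝ)
  · simpa using hasDerivAt_const φ (0 : ℝ)
  · rw [len_vertical (by positivity)]
    have hW := verticalClock_pos hc φ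
    have hW2 := verticalClock_sq hc φ
    have ha := hasDerivAt_abs_sin hφ
    have hQ := ((((ha.const_add 1).mul ((ha.const_mul c).const_add 1)).const_mul
      (c * (1 + c))).div_const 2).sqrt (by
        change c * (1 + c) * ((1 + |Real.sin φ|) * (1 + c * |Real.sin φ|)) / 2 ≠ 0
        positivity)
    refine (((Real.hasDerivAt_cos φ).const_mul c).div hQ hW.ne').congr_deriv ?_
    change (c * -Real.sin φ * verticalClock c φ - c * Real.cos φ * (_ / (2 * verticalClock c φ))) /
      verticalClock c φ ^ 2 = _
    have e1 : Real.cos φ ^ 2 = 1 - |Real.sin φ| ^ 2 := by rw [sq_abs, Real.cos_sq']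
    have e2 := side_mul_abs_sin φ
    have e3 := side_sq φ
    set W := verticalClock c φ
    set s := |Real.sin φ| with hs
    have hs0 : 0 ≤ s := abs_nonneg _
    set σ := side φ
    rw [← e2]
    have key : c * (4 * s * W ^ 2 + Real.cos φ ^ 2 * (c * (1 + c)) * (1 + 2 * c * s + c)) *
        (1 + c * s) ^ 2 = 4 * W ^ 4 := by
      rw [show W ^ 4 = (W ^ 2) ^ 2 by ring, hW2, e1]
      ring
    clear_value W s σ
    field_simp
    linear_combination (-σ) * key

theorem verticalCurve_periodic (c : ℝ) : Function.Periodic (verticalCurve c) Real.pi := fun φ => by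
  simp [verticalCurve, foldCurve, verticalClock, side_add_pi]

theorem verticalCurve_injOn {c : ℝ} (hc : 0 < c) :
    InjOn (verticalCurve c) (Ico 0 Real.pi) := by
  have hside : ∀ φ ∈ Ico 0 Real.pi, side φ = 1 := fun φ hφ => by
    rcases hφ.1.eq_or_lt with rfl | h
    · exact side_eq (Or.inl rfl) (Or.inr (by simp))
    · exact side_eq (Or.inl rfl) (Or.inl (by simpa using Real.sin_pos_of_pos_of_lt_pi h hφ.2))
  have hsub : ∀ φ ∈ Ico 0 Real.pi, φ ∈ Ico 0 (2 * Real.pi) := fun φ hφ =>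
    ⟨hφ.1, by linarith [hφ.2, Real.pi_pos]⟩
  intro φ hφ ψ hψ h
  simp only [verticalCurve, foldCurve, Prod.mk.injEq, true_and, hside φ hφ, hside ψ hψ,
    one_mul] at h
  have hs : |Real.sin φ| = |Real.sin ψ| := mul_left_cancel₀ hc.ne' (add_left_cancel h.1)
  have hW : verticalClock c φ = verticalClock c ψ := by simp only [verticalClock, hs]
  have h1 := verticalClock_pos hc ψ
  have h2 := h.2
  rw [hW, div_left_inj' h1.ne'] at h2
  refine eq_of_cos_sin_eq (hsub φ hφ) (hsub ψ hψ) (mul_left_cancel₀ hc.ne' h2) ?_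
  rw [abs_of_nonneg (Real.sin_nonneg_of_nonneg_of_le_pi hφ.1 hφ.2.le),
    abs_of_nonneg (Real.sin_nonneg_of_nonneg_of_le_pi hψ.1 hψ.2.le)] at hs
  exact hs

/-- The states of energy `E` of vertical motions. -/
def verticalStates (E : ℝ) : Set State := {s ∈ levelSet 2 E | s.1.1 = 0 ∧ s.2.1 = 0}

theorem integralD_vertical {s : State} (h : 1 ≤ s.1.2) (hx : s.1.1 = 0) (hp : s.2.1 = 0) :
    integralD s = 2 := by
  have h1 : s.1 = (0, s.1.2) := Prod.ext hx rfl
  have h2 : len s.1 = s.1.2 := by rw [h1]; exact len_vertical (by linarith)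
  simp only [integralD, lrl₂, angMom, hx, hp, h2]
  rw [div_self (by linarith)]
  ring

theorem range_verticalCurve {c E : ℝ} (hc : 0 < c) (hE : E * (1 + c) = -1) :
    range (verticalCurve c) = verticalStates E := by
  have hE' : E = -1 / (1 + c) := by field_simp; linarith
  ext s
  constructor
  · rintro ⟨φ, rfl⟩
    have hs0 : 0 ≤ |Real.sin φ| := abs_nonneg _
    have h1 : 1 ≤ 1 + c * |Real.sin φ| := by
      have : 0 ≤ c * |Real.sin φ| := by positivity
      linarith
    refine ⟨⟨⟨h1, fun hw => ?_⟩, ?_, integralD_vertical h1 rfl rfl⟩, rfl, rfl⟩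
    · have hs : Real.sin φ = 0 := by
        simp only [verticalCurve, foldCurve, add_eq_left, mul_eq_zero, abs_eq_zero] at hw
        exact hw.resolve_left hc.ne'
      have := verticalClock_pos hc φ
      simp only [verticalCurve, foldCurve, side_cos_of_sin_eq_zero hs]
      positivity
    · have e1 : Real.cos φ ^ 2 = 1 - |Real.sin φ| ^ 2 := by rw [sq_abs, Real.cos_sq']
      simp only [energy_eq, verticalCurve, foldCurve]
      rw [len_vertical (by linarith), div_pow, mul_pow, mul_pow, side_sq, verticalClock_sq hc, e1,
        hE']
      field_simp
      ring
  · rintro ⟨⟨⟨h1, h2⟩, h3, -⟩, h4, h5⟩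
    obtain ⟨⟨x, y⟩, p, q⟩ := s
    simp only at h1 h2 h4 h5
    subst h4 h5
    rw [energy_eq] at h3
    simp only [len_vertical (by linarith : 0 ≤ y)] at h3
    rw [hE'] at h3
    have hq : q ^ 2 = 2 * (1 + c - y) / (y * (1 + c)) := by
      field_simp at h3 ⊢
      linarith
    have hyc : y ≤ 1 + c := by
      have h6 : 0 ≤ 2 * (1 + c - y) / (y * (1 + c)) := hq ▸ sq_nonneg q
      by_contra! h7
      exact absurd h6 (not_le.2 (div_neg_of_neg_of_pos (by linarith) (by positivity)))
    set s := (y - 1) / c with hs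
    have hs0 : 0 ≤ s := div_nonneg (by linarith) hc.le
    have hy : y = 1 + c * s := by rw [hs]; field_simp; ring
    set W := √(c * (1 + c) * ((1 + s) * (1 + c * s)) / 2) with hW
    have hW0 : 0 < W := Real.sqrt_pos.2 (by positivity)
    have hW2 : W ^ 2 = c * (1 + c) * ((1 + s) * (1 + c * s)) / 2 := Real.sq_sqrt (by positivity)
    clear_value s
    obtain ⟨φ, hcos, hsin⟩ := exists_cos_sin (c := q * W / c) (s := s) (by
      rw [div_pow, mul_pow, hq, hW2, hy]
      field_simp
      ring)
    have hside : side φ = 1 := by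
      refine side_eq (Or.inl rfl) ?_
      rw [one_mul, one_mul, hsin]
      rcases hs0.eq_or_lt with h6 | h6
      · refine Or.inr ⟨h6.symm, ?_⟩
        have h7 : 0 ≤ q := h2 (by rw [hy, ← h6]; ring)
        refine lt_of_le_of_ne (by rw [hcos]; positivity) fun h8 => ?_
        have := Real.sin_sq_add_cos_sq φ
        rw [hsin, ← h6, ← h8] at this
        norm_num at this
      · exact Or.inl h6
    have habs : |Real.sin φ| = s := by rw [hsin, abs_of_nonneg hs0]
    refine ⟨φ, ?_⟩
    simp only [verticalCurve, foldCurve, verticalClock, habs, hside, one_mul, hcos, ← hW]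
    rw [← hy, mul_div_cancel₀ _ hc.ne', mul_div_cancel_right₀ _ hW0.ne']

/-- For `-1 < E < 0` the vertical states form a closed orbit. -/
theorem vertical_orbit {E : ℝ} (hE1 : -1 < E) (hE : E < 0) :
    ∃ z T, IsClosedOrbit z T (verticalStates E) ∧
      trace z = segment ℝ ((0, 1) : ℝ × ℝ) (0, -1 / E) := by
  obtain ⟨c, hc⟩ : ∃ c, c = -1 / E - 1 := ⟨_, rfl⟩
  have hE0 : E ≠ 0 := hE.ne
  have hc0 : 0 < c := by
    have : 1 < -1 / E := by rw [lt_div_iff_of_neg hE]; linarith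
    linarith
  have hcE : E * (1 + c) = -1 := by rw [hc]; field_simp; ring
  have hctop : -1 / E = 1 + c := by rw [hc]; ring
  obtain ⟨θ, T, hT, h0, hm, hs, hd, hθ⟩ := exists_periodic_clock (ω := verticalClock c)
    (m := √(c * (1 + c) / 2))
    (by unfold verticalClock; fun_prop) (Real.sqrt_pos.2 (by positivity))
    (fun φ => Real.sqrt_le_sqrt (by
      have h1 : 1 ≤ 1 + |Real.sin φ| := by linarith [abs_nonneg (Real.sin φ)]
      have h2 : 1 ≤ 1 + c * |Real.sin φ| := by
        have : 0 ≤ c * |Real.sin φ| := by positivity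
        linarith
      have h3 := one_le_mul_of_one_le_of_one_le h1 h2
      have h4 : 0 < c * (1 + c) := by positivity
      nlinarith))
    Real.pi_pos (fun φ => by simp [verticalClock])
  have hcl := isClosedOrbit_of_clock hT h0 hm hs hθ (verticalCurve_periodic c)
    (verticalCurve_injOn hc0) (isTrajectory_vertical hc0 hm hd)
  rw [range_verticalCurve hc0 hcE] at hcl
  refine ⟨_, T, hcl, ?_⟩
  rw [hctop, ← Prod.image_mk_segment_right, segment_eq_Icc (by linarith)]
  unfold trace
  ext x
  constructor
  · rintro ⟨t, rfl⟩
    refine ⟨1 + c * |Real.sin (θ t)|, ⟨?_, ?_⟩, rfl⟩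
    · have : 0 ≤ c * |Real.sin (θ t)| := by positivity
      linarith
    · nlinarith [Real.abs_sin_le_one (θ t)]
  · rintro ⟨y, hy, rfl⟩
    obtain ⟨t, ht⟩ := hs (Real.arcsin ((y - 1) / c))
    refine ⟨t, ?_⟩
    have h3 : 0 ≤ (y - 1) / c := div_nonneg (by linarith [hy.1]) hc0.le
    simp only [verticalCurve, foldCurve, ht]
    rw [Real.sin_arcsin (by linarith) (by rw [div_le_one hc0]; linarith [hy.2]), abs_of_nonneg h3,
      mul_div_cancel₀ _ hc0.ne']
    simp

/-! ### The two-periodic orbit -/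

/-- Although `|s|` is not, this function is differentiable at `0`. It is the horizontal momentum on
the ellipse, up to a factor, as a function of `s = sin φ`. -/
theorem hasDerivAt_div_add_abs {b : ℝ} (hb : 0 < b) (s : ℝ) :
    HasDerivAt (fun s => s / (b + |s|)) (b / (b + |s|) ^ 2) s := by
  rcases lt_trichotomy s 0 with h | rfl | h
  · have h1 : b - s ≠ 0 := by linarith
    have h2 := (hasDerivAt_id s).fun_div ((hasDerivAt_id s).const_sub b) h1
    refine (h2.congr_of_eventuallyEq ?_).congr_deriv ?_
    · filter_upwards [gt_mem_nhds h] with u hu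
      rw [abs_of_neg hu]; simp [sub_eq_add_neg]
    · rw [abs_of_neg h, ← sub_eq_add_neg]; simp
  · rw [hasDerivAt_iff_tendsto_slope]
    have hc : Continuous fun s : ℝ => 1 / (b + |s|) :=
      continuous_const.div (by fun_prop) fun s => by positivity
    have h1 := (hc.tendsto 0).mono_left (nhdsWithin_le_nhds (s := {0}ᶜ))
    have h2 : b / (b + |(0 : ℝ)|) ^ 2 = 1 / (b + |(0 : ℝ)|) := by
      rw [abs_zero, add_zero]; field_simp
    rw [h2]
    refine h1.congr' ?_
    filter_upwards [self_mem_nhdsWithin] with u (hu : u ≠ 0)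
    rw [slope_def_field]
    simp only [zero_div, sub_zero]
    field_simp
  · have h1 : b + s ≠ 0 := by linarith
    have h2 := (hasDerivAt_id s).fun_div ((hasDerivAt_id s).const_add b) h1
    refine (h2.congr_of_eventuallyEq ?_).congr_deriv ?_
    · filter_upwards [lt_mem_nhds h] with u hu
      rw [abs_of_pos hu]; simp
    · rw [abs_of_pos h]; simp

/-- The time element `dt = √b r dφ` of a Kepler ellipse with centre `(0,1)`, major semi-axis `b` and
eccentric anomaly `φ`, in which `r = b + |sin φ|` is the distance from the origin. -/
def ellipseClock (b φ : ℝ) : ℝ := √b * (b + |Real.sin φ|)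

/-- The states of a motion to and fro on the upper half of an ellipse with centre `(0,1)`. -/
def ellipseCurve (a b : ℝ) : ℝ → State :=
  foldCurve (fun φ => a * Real.cos φ) (fun φ => -(a * Real.sin φ) / ellipseClock b φ)
    (ellipseClock b) b

section
variable {a b : ℝ}

theorem ellipseClock_pos (hb : 0 < b) (φ : ℝ) : 0 < ellipseClock b φ := by
  unfold ellipseClock; positivity

theorem len_ellipse (hb : 0 < b) (hab : a ^ 2 = b ^ 2 - 1) (φ : ℝ) :
    len (a * Real.cos φ, 1 + b * |Real.sin φ|) = b + |Real.sin φ| := by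
  refine (pow_left_inj₀ (len_nonneg _) (by positivity) two_ne_zero).1 ?_
  rw [len_sq]
  simp only [mul_pow]
  rw [hab, Real.cos_sq', ← sq_abs (Real.sin φ)]
  ring

theorem isTrajectory_ellipse (hb : 0 < b) (hab : a ^ 2 = b ^ 2 - 1) {θ : ℝ → ℝ} (hm : StrictMono θ)
    (hθ : ∀ t, HasDerivAt θ (1 / ellipseClock b (θ t)) t) :
    IsTrajectory fun t => ellipseCurve a b (θ t) := by
  have hsb : √b ^ 2 = b := Real.sq_sqrt hb.le
  have hsb0 : 0 < √b := Real.sqrt_pos.2 hb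
  refine isTrajectory_foldCurve hb (ellipseClock_pos hb) (by unfold ellipseClock; fun_prop)
    (fun φ => ?_) (fun φ => ?_) (fun φ hφ => ?_) hm hθ
  · have := ellipseClock_pos hb φ
    refine ((Real.hasDerivAt_cos φ).const_mul a).congr_deriv ?_
    field_simp
  · have h1 := (((hasDerivAt_div_add_abs hb _).comp φ (Real.hasDerivAt_sin φ)).const_mul (-a / √b))
    rw [len_ellipse hb hab]
    refine (h1.congr_of_eventuallyEq (Eventually.of_forall fun ψ => ?_)).congr_deriv ?_
    · simp only [ellipseClock, Function.comp]; field_simp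
    · unfold ellipseClock
      have hr : 0 < b + |Real.sin φ| := by positivity
      field_simp
      rw [hsb]
  · rw [len_ellipse hb hab]
    have hr : 0 < b + |Real.sin φ| := by positivity
    have hW : HasDerivAt (ellipseClock b) (√b * (side φ * Real.cos φ)) φ :=
      ((hasDerivAt_abs_sin hφ).const_add b).const_mul _
    refine (((Real.hasDerivAt_cos φ).const_mul b).div hW
      (ellipseClock_pos hb φ).ne').congr_deriv ?_
    have e1 : Real.cos φ ^ 2 = 1 - |Real.sin φ| ^ 2 := by rw [sq_abs, Real.cos_sq']
    have e2 := side_mul_abs_sin φ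
    unfold ellipseClock
    generalize |Real.sin φ| = s at *
    rw [← e2]
    field_simp
    linear_combination (-b * side φ) * e1 + (1 + b * s) * side φ * hsb

theorem ellipseCurve_periodic (a b : ℝ) : Function.Periodic (ellipseCurve a b) (2 * Real.pi) :=
  fun φ => by simp [ellipseCurve, foldCurve, ellipseClock, side_add_two_pi]

theorem ellipseCurve_injOn (ha : 0 < a) (hb : 0 < b) :
    InjOn (ellipseCurve a b) (Ico 0 (2 * Real.pi)) := by
  intro φ hφ ψ hψ h
  simp only [ellipseCurve, foldCurve, Prod.mk.injEq] at h
  obtain ⟨⟨h1, h2⟩, h3, -⟩ := h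
  have hs : |Real.sin φ| = |Real.sin ψ| := mul_left_cancel₀ hb.ne' (add_left_cancel h2)
  have hW : ellipseClock b φ = ellipseClock b ψ := by simp only [ellipseClock, hs]
  rw [hW, div_left_inj' (ellipseClock_pos hb ψ).ne', neg_inj] at h3
  exact eq_of_cos_sin_eq hφ hψ (mul_left_cancel₀ ha.ne' h1) (mul_left_cancel₀ ha.ne' h3)

theorem range_ellipseCurve (ha : 0 < a) (hb : 0 < b) (hab : a ^ 2 = b ^ 2 - 1) :
    range (ellipseCurve a b) = levelSet (b + 1 / b) (-1 / (2 * b)) := by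
  have hsb : √b ^ 2 = b := Real.sq_sqrt hb.le
  have hsb0 : 0 < √b := Real.sqrt_pos.2 hb
  ext s
  constructor
  · rintro ⟨φ, rfl⟩
    have hs0 : 0 ≤ |Real.sin φ| := abs_nonneg _
    have h1 : 1 ≤ 1 + b * |Real.sin φ| := by
      have : 0 ≤ b * |Real.sin φ| := by positivity
      linarith
    have hω := ellipseClock_pos hb φ
    have e1 : Real.cos φ ^ 2 = 1 - |Real.sin φ| ^ 2 := by rw [sq_abs, Real.cos_sq']
    have hE : energy (ellipseCurve a b φ) = -1 / (2 * b) := by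
      simp only [energy_eq, ellipseCurve, foldCurve]
      rw [len_ellipse hb hab, div_pow, div_pow, neg_sq, mul_pow, mul_pow, mul_pow, side_sq, e1,
        ← sq_abs (Real.sin φ), hab, ellipseClock, mul_pow, hsb]
      field_simp
      ring
    refine ⟨⟨h1, fun hw => ?_⟩, hE, ?_⟩
    · have hs : Real.sin φ = 0 := by
        simp only [ellipseCurve, foldCurve, add_eq_left, mul_eq_zero, abs_eq_zero] at hw
        exact hw.resolve_left hb.ne'
      simp only [ellipseCurve, foldCurve, side_cos_of_sin_eq_zero hs]
      positivity
    · have hG : grazing (ellipseCurve a b φ) = b := by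
        rw [grazing_eq h1]
        have e2 : (ellipseCurve a b φ).1.1 * (ellipseCurve a b φ).2.2 -
            ((ellipseCurve a b φ).1.2 - 1) * (ellipseCurve a b φ).2.1 =
            a * b * side φ / ellipseClock b φ := by
          simp only [ellipseCurve, foldCurve]
          field_simp
          rw [← side_mul_abs_sin φ]
          simp only [abs_mul, abs_abs, show |side φ| = 1 by unfold side; split_ifs <;> norm_num]
          linear_combination b * side φ * e1
        rw [e2]
        simp only [ellipseCurve, foldCurve]
        rw [len_ellipse hb hab, div_pow, div_pow, mul_pow, mul_pow, mul_pow, mul_pow, side_sq, e1,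
          hab, ellipseClock, mul_pow, hsb]
        field_simp
        ring
      unfold grazing at hG
      rw [hE] at hG
      have e3 : 2 * (-1 / (2 * b)) = -(1 / b) := by field_simp
      linarith
  · rintro ⟨⟨h1, h2⟩, h3, h4⟩
    have e1 := radius_sq h1
    rw [h3, h4] at e1
    have e2 : lrl₁ s ^ 2 + (lrl₂ s - 2 * (-1 / (2 * b))) ^ 2 = 0 := by
      rw [← e1]; field_simp; ring
    -- `R = 0`, hence `A = (0, 2E)`
    have hA1 : lrl₁ s = 0 := by
      have : lrl₁ s ^ 2 = 0 := by
        linarith [sq_nonneg (lrl₁ s), sq_nonneg (lrl₂ s - 2 * (-1 / (2 * b)))]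
      simpa using this
    have hA2 : lrl₂ s = -1 / b := by
      have : (lrl₂ s - 2 * (-1 / (2 * b))) ^ 2 = 0 := by
        linarith [sq_nonneg (lrl₁ s), sq_nonneg (lrl₂ s - 2 * (-1 / (2 * b)))]
      have : lrl₂ s - 2 * (-1 / (2 * b)) = 0 := by simpa using this
      rw [sub_eq_zero] at this
      rw [this]; field_simp
    have hL2 : angMom s ^ 2 = a ^ 2 / b := by
      unfold integralD at h4
      rw [hA2] at h4
      have : angMom s ^ 2 = b + 1 / b + 2 * (-1 / b) := by linarith
      rw [this, hab]; field_simp; ring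
    -- the orientation of the motion
    obtain ⟨σ, hσ, hL⟩ : ∃ σ : ℝ, (σ = 1 ∨ σ = -1) ∧ angMom s = σ * a / √b := by
      have : angMom s ^ 2 = (a / √b) ^ 2 := by rw [hL2, div_pow, hsb]
      rcases sq_eq_sq_iff_eq_or_eq_neg.1 this with h | h
      · exact ⟨1, Or.inl rfl, by rw [h]; ring⟩
      · exact ⟨-1, Or.inr rfl, by rw [h]; ring⟩
    have hσ2 : σ ^ 2 = 1 := by rcases hσ with rfl | rfl <;> norm_num
    have hσ0 : σ ≠ 0 := by rintro rfl; norm_num at hσ2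
    have hcon := len_eq_conic h1
    rw [hL2, hA1, hA2] at hcon
    have hr := len_pos h1
    have hr2 := len_sq s.1
    unfold lrl₁ at hA1
    unfold lrl₂ at hA2
    rw [hL] at hA1 hA2
    obtain ⟨⟨x, y⟩, p, q⟩ := s
    simp only at h1 h2 hr2 hA1 hA2 hcon
    set r := len (x, y)
    clear_value r
    set S := (y - 1) / b with hS
    have hS0 : 0 ≤ S := div_nonneg (by linarith) hb.le
    have hy : y = 1 + b * S := by rw [hS]; field_simp; ring
    have hrS : r = b + S := by rw [hcon, hab, hS]; field_simp; ring
    clear_value S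
    subst hy
    obtain ⟨φ, hcos, hsin⟩ := exists_cos_sin (c := x / a) (s := σ * S) (by
      rw [div_pow, mul_pow, hσ2]
      field_simp
      rw [hrS] at hr2
      linear_combination -hr2 + (S ^ 2 - 1) * hab)
    have habs : |Real.sin φ| = S := by
      rw [hsin, abs_mul, abs_of_nonneg hS0]
      rcases hσ with rfl | rfl <;> norm_num
    have hq : q = √b * σ * x / (a * r) := by
      field_simp at hA1 ⊢
      linear_combination σ * hA1 - q * a * r * hσ2
    have hside : side φ = σ := by
      refine side_eq hσ ?_
      rw [hsin, hcos]
      rcases hS0.eq_or_lt with h6 | h6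
      · refine Or.inr ⟨by rw [← h6, mul_zero], ?_⟩
        have h7 : 0 ≤ q := h2 (by rw [← h6]; ring)
        have h8 : σ * (x / a) = q * r / √b := by rw [hq]; field_simp
        rw [h8]
        refine lt_of_le_of_ne (by positivity) fun h9 => ?_
        have hx : x / a = 0 := by
          rw [← h9] at h8
          exact (mul_eq_zero.1 h8).resolve_left hσ0
        have := Real.sin_sq_add_cos_sq φ
        rw [hsin, hcos, hx, ← h6] at this
        norm_num at this
      · refine Or.inl ?_
        rw [← mul_assoc, ← pow_two, hσ2, one_mul]; exact h6
    refine ⟨φ, ?_⟩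
    simp only [ellipseCurve, foldCurve, ellipseClock, habs, hside, hcos, ← hrS]
    rw [hsin]
    refine Prod.ext (Prod.ext ?_ rfl) (Prod.ext ?_ ?_)
    · simp only; field_simp
    · have h10 : p * (σ * a / √b) = -a ^ 2 * S / (b * r) := by
        have h11 : p * (σ * a / √b) = 1 / b - (1 + b * S) / r := by linear_combination -hA2
        rw [h11, hab]
        field_simp
        linear_combination hrS
      have h12 : p = σ * (√b / a) * (p * (σ * a / √b)) := by
        field_simp
        linear_combination -p * hσ2
      simp only
      rw [h12, h10]
      field_simp
      linear_combination S * hsb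
    · simp only
      rw [hq]
      field_simp
      rw [hsb, mul_comm]

end

/-- If `1 + 2DE + 4E² = 0` the level set is a two-periodic orbit: `R = 0` determines the vector
`A = (0, 2E)`, and the ellipse is symmetric to the wall, so that a reflection reverses the motion on
it. -/
theorem ellipse_orbit {D E : ℝ} (hR : 1 + 2 * D * E + 4 * E ^ 2 = 0) (hD : 2 < D)
    (hE : -1 / 2 < E) : ∃ z T, IsClosedOrbit z T (levelSet D E) ∧
      {t ∈ Ico 0 T | (z t).1.2 = 1}.ncard = 2 ∧
      ∃ a b : ℝ, 0 < a ∧ a < b ∧ trace z = {x ∈ wallEllipse a b | 1 ≤ x.2} := by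
  have hE0 : E < 0 := by nlinarith [sq_nonneg E]
  have hEne : E ≠ 0 := hE0.ne
  obtain ⟨b, hb⟩ : ∃ b, b = -1 / (2 * E) := ⟨_, rfl⟩
  have hb1 : 1 < b := by rw [hb, lt_div_iff_of_neg (by linarith)]; linarith
  have hb0 : 0 < b := by linarith
  have hEb : -1 / (2 * b) = E := by rw [hb]; field_simp
  have hDb : b + 1 / b = D := by
    rw [hb]
    field_simp
    linear_combination -hR
  set a := √(b ^ 2 - 1) with ha
  have ha0 : 0 < a := Real.sqrt_pos.2 (by nlinarith)
  have hab : a ^ 2 = b ^ 2 - 1 := Real.sq_sqrt (by nlinarith)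
  obtain ⟨θ, T, hT, h0, hm, hs, hd, hθ⟩ := exists_periodic_clock (ω := ellipseClock b)
    (m := √b * b) (by unfold ellipseClock; fun_prop) (by positivity)
    (fun φ => mul_le_mul_of_nonneg_left (by linarith [abs_nonneg (Real.sin φ)]) (by positivity))
    Real.two_pi_pos (fun φ => by simp [ellipseClock])
  have hcl := isClosedOrbit_of_clock hT h0 hm hs hθ (ellipseCurve_periodic a b)
    (ellipseCurve_injOn ha0 hb0) (isTrajectory_ellipse hb0 hab hm hd)
  rw [range_ellipseCurve ha0 hb0 hab, hEb, hDb] at hcl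
  refine ⟨_, T, hcl, ?_, a, b, ha0, ?_, ?_⟩
  · -- the contacts are at the angles `0` and `π`
    obtain ⟨t₁, ht₁⟩ := hs Real.pi
    have hθT : θ T = 2 * Real.pi := by simpa [h0] using hθ 0
    have hpi := Real.pi_pos
    have h1 : 0 < t₁ := by rw [← hm.lt_iff_lt, h0, ht₁]; exact hpi
    have h2 : t₁ < T := by rw [← hm.lt_iff_lt, hθT, ht₁]; linarith
    have hset : {t ∈ Ico 0 T | (ellipseCurve a b (θ t)).1.2 = 1} = {0, t₁} := by
      ext t
      simp only [mem_ofPred_eq, mem_insert_iff, mem_singleton_iff, ellipseCurve, foldCurve,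
        add_eq_left, mul_eq_zero, abs_eq_zero, hb0.ne', false_or]
      constructor
      · rintro ⟨⟨h3, h4⟩, h5⟩
        obtain ⟨n, hn⟩ := Real.sin_eq_zero_iff.1 h5
        have h6 : 0 ≤ θ t := h0 ▸ hm.monotone h3
        have h7 : θ t < 2 * Real.pi := hθT ▸ hm h4
        have h8 : (-1 : ℝ) < n := by nlinarith
        have h9 : (n : ℝ) < 2 := by nlinarith
        have h10 : n = 0 ∨ n = 1 := by
          have : -1 < n := by exact_mod_cast h8
          have : n < 2 := by exact_mod_cast h9
          omega
        rcases h10 with rfl | rfl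
        · left
          apply hm.injective
          rw [h0, ← hn]; simp
        · right
          apply hm.injective
          rw [ht₁, ← hn]; simp
      · rintro (rfl | rfl)
        · exact ⟨⟨le_rfl, hT⟩, by rw [h0, Real.sin_zero]⟩
        · exact ⟨⟨h1.le, h2⟩, by rw [ht₁, Real.sin_pi]⟩
    rw [hset, ncard_pair h1.ne]
  · exact lt_of_pow_lt_pow_left₀ 2 hb0.le (by rw [hab]; linarith)
  · ext x
    constructor
    · rintro ⟨t, rfl⟩
      refine ⟨?_, ?_⟩
      · simp only [wallEllipse, mem_ofPred_eq, ellipseCurve, foldCurve, add_sub_cancel_left,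
          mul_pow, sq_abs]
        rw [mul_div_cancel_left₀ _ (by positivity), mul_div_cancel_left₀ _ (by positivity),
          Real.cos_sq_add_sin_sq]
      · have : 0 ≤ b * |Real.sin (θ t)| := by positivity
        simp only [ellipseCurve, foldCurve]
        linarith
    · rintro ⟨h1, h2⟩
      obtain ⟨φ, hc, hsn⟩ := exists_cos_sin (c := x.1 / a) (s := (x.2 - 1) / b) (by
        rw [div_pow, div_pow]; exact h1)
      obtain ⟨t, ht⟩ := hs φ
      refine ⟨t, ?_⟩
      have h3 : 0 ≤ (x.2 - 1) / b := div_nonneg (by linarith) hb0.le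
      simp only [ellipseCurve, foldCurve, ht, hc, hsn, abs_of_nonneg h3]
      rw [mul_div_cancel₀ _ ha0.ne', mul_div_cancel₀ _ hb0.ne']
      simp

/-! ### Level sets with `D = 2` -/

section levelTwo
variable {s : State} {k E : ℝ}

theorem angMom_sq_of_integralD (hD : integralD s = 2) : angMom s ^ 2 = 2 * (1 + lrl₂ s) := by
  unfold integralD at hD
  linarith

/-- On the level set `D = 2` the conserved quantities of an arc satisfy
`4 A₁² = 4 (1 + 2E) L² - L⁴`. -/
theorem factor_lrl₁_of_integralD (hs : 1 ≤ s.1.2) (hD : integralD s = 2)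
    (hk : k ^ 2 = 1 + 2 * energy s) :
    (k * angMom s + lrl₁ s) * (k * angMom s - lrl₁ s) = angMom s ^ 4 / 4 := by
  have h1 := lrl_sq hs
  have h2 := angMom_sq_of_integralD hD
  have h3 : lrl₂ s = angMom s ^ 2 / 2 - 1 := by linarith
  rw [h3] at h1
  linear_combination angMom s ^ 2 * hk - h1

/-- For `D = 2` the motion is vertical exactly if its angular momentum vanishes. -/
theorem angMom_eq_zero_iff (hs : 1 ≤ s.1.2) (hD : integralD s = 2) :
    angMom s = 0 ↔ s.1.1 = 0 ∧ s.2.1 = 0 := by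
  have hr := len_pos hs
  constructor
  · intro h
    have h1 := angMom_sq_of_integralD hD
    have h2 : lrl₂ s = -1 := by rw [h] at h1; linarith
    have h3 : len s.1 = s.1.2 := by
      unfold lrl₂ at h2
      rw [h] at h2
      field_simp at h2
      linarith
    have h4 := len_sq s.1
    rw [h3] at h4
    have h5 : s.1.1 = 0 := by
      have : s.1.1 ^ 2 = 0 := by linarith
      simpa using this
    refine ⟨h5, ?_⟩
    unfold angMom at h
    rw [h5, zero_mul, zero_sub, neg_eq_zero] at h
    exact (mul_eq_zero.1 h).resolve_left (by linarith)
  · rintro ⟨h1, h2⟩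
    simp [angMom, h1, h2]

theorem mem_verticalStates_iff : s ∈ verticalStates E ↔ s ∈ levelSet 2 E ∧ angMom s = 0 :=
  and_congr_right fun h => (angMom_eq_zero_iff h.1.1 h.2.2).symm

/-- For `E < -1/2` all states with `D = 2` are vertical. -/
theorem levelSet_two_eq {E : ℝ} (hE : E < -1 / 2) : levelSet 2 E = verticalStates E := by
  refine Subset.antisymm (fun s hs => mem_verticalStates_iff.2 ⟨hs, ?_⟩) fun s hs => hs.1
  by_contra hL
  have h1 := lrl_sq hs.1.1
  have h2 := angMom_sq_of_integralD hs.2.2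
  rw [hs.2.1] at h1
  have h3 : lrl₂ s = angMom s ^ 2 / 2 - 1 := by linarith
  have h4 : lrl₁ s ^ 2 = angMom s ^ 2 * (1 + 2 * E - angMom s ^ 2 / 4) := by
    rw [h3] at h1
    linear_combination h1
  have h5 : 0 < angMom s ^ 2 := by positivity
  have h6 := mul_neg_of_pos_of_neg h5 (by linarith : 1 + 2 * E - angMom s ^ 2 / 4 < 0)
  linarith [sq_nonneg (lrl₁ s)]

/-- The states with `D = 2` and energy `E` which do not belong to the vertical motion. -/
def separatrixStates (E : ℝ) : Set State := {s ∈ levelSet 2 E | angMom s ≠ 0}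

theorem levelSet_two_eq_union (E : ℝ) :
    levelSet 2 E = verticalStates E ∪ separatrixStates E := by
  ext s
  simp only [mem_union, mem_verticalStates_iff, separatrixStates, mem_ofPred_eq, ← and_or_left,
    em, and_true]

theorem disjoint_separatrixStates (E : ℝ) :
    Disjoint (verticalStates E) (separatrixStates E) :=
  Set.disjoint_left.2 fun _ h1 h2 => h2.2 (mem_verticalStates_iff.1 h1).2

/-! ### The reflection law for `D = 2` -/

/-- A quantity conserved along Kepler arcs, which determines `L²` on the level set `D = 2` and is
multiplied by a constant at each reflection (`k² = 1 + 2E`). -/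
def reflectionRatio (k : ℝ) (s : State) : ℝ :=
  (k * angMom s + lrl₁ s) / (k * angMom s - lrl₁ s)

theorem reflectionRatio_pos (hs : 1 ≤ s.1.2) (hD : integralD s = 2)
    (hk : k ^ 2 = 1 + 2 * energy s) (hL : angMom s ≠ 0) : 0 < reflectionRatio k s := by
  have h1 := factor_lrl₁_of_integralD hs hD hk
  have h2 : 0 < (k * angMom s + lrl₁ s) * (k * angMom s - lrl₁ s) := by rw [h1]; positivity
  rcases pos_and_pos_or_neg_and_neg_of_mul_pos h2 with h | h
  · exact div_pos h.1 h.2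
  · exact div_pos_of_neg_of_neg h.1 h.2

/-- The angular momentum is small when the ratio is small and when it is large. -/
theorem angMom_sq_eq (hs : 1 ≤ s.1.2) (hD : integralD s = 2)
    (hk : k ^ 2 = 1 + 2 * energy s) (hL : angMom s ≠ 0) :
    angMom s ^ 2 = 16 * k ^ 2 * reflectionRatio k s / (1 + reflectionRatio k s) ^ 2 := by
  have h1 := factor_lrl₁_of_integralD hs hD hk
  have h0 := reflectionRatio_pos hs hD hk hL
  have h2 : k * angMom s - lrl₁ s ≠ 0 := by
    intro h
    rw [h, mul_zero] at h1
    have : 0 < angMom s ^ 4 / 4 := by positivity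
    linarith
  have h3 : k * angMom s + lrl₁ s = reflectionRatio k s * (k * angMom s - lrl₁ s) := by
    unfold reflectionRatio; field_simp
  have h4 : 1 + reflectionRatio k s ≠ 0 := by linarith
  generalize reflectionRatio k s = ρ at *
  rw [eq_div_iff (by positivity)]
  refine mul_left_cancel₀ (pow_ne_zero 2 hL) ?_
  have h5 : (1 + ρ) * (k * angMom s - lrl₁ s) = 2 * k * angMom s := by linarith
  rw [h3] at h1
  linear_combination (-4) * (1 + ρ) ^ 2 * h1 + 4 * ρ * ((1 + ρ) * (k * angMom s - lrl₁ s) +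
    2 * k * angMom s) * h5

theorem angMom_mul_mirror (hw : s.1.2 = 1) (hD : integralD s = 2) :
    angMom s * angMom (mirror s) = -(2 * (len s.1 - 1) / len s.1) := by
  have hr := len_pos hw.ge
  have h1 := len_sq s.1
  have h2 := wall_grazing_eq hw
  unfold grazing at h2
  have h3 := energy_eq s
  rw [hD] at h2
  rw [hw] at h1
  simp only [angMom, mirror, hw]
  generalize len s.1 = r at *
  have h4 : 2 * (r - 1) / r = 2 - 2 * (1 / r) := by field_simp
  rw [h4]
  linear_combination -2 * h3 + h2

/-- The angular momentum changes its sign at each contact. -/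
theorem angMom_mul_mirror_neg (hw : s.1.2 = 1) (hD : integralD s = 2) (hL : angMom s ≠ 0) :
    angMom s * angMom (mirror s) < 0 := by
  have hr : len s.1 ≠ 1 := by
    intro h
    have h1 := len_sq s.1
    have h3 := energy_eq s
    have h2 := wall_grazing_eq hw
    unfold grazing at h2
    rw [h] at h1 h3
    rw [hD] at h2
    rw [hw] at h1
    refine hL ((angMom_eq_zero_iff hw.ge hD).2 ⟨?_, ?_⟩)
    · have : s.1.1 ^ 2 = 0 := by linarith
      simpa using this
    · have h4 : s.1.1 ^ 2 = 0 := by linarith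
      rw [h4] at h2
      have : s.2.1 ^ 2 = 0 := by linarith
      simpa using this
  have h1 : 1 < len s.1 := lt_of_le_of_ne (hw ▸ le_len) (Ne.symm hr)
  rw [angMom_mul_mirror hw hD, neg_lt_zero]
  exact div_pos (by linarith) (by linarith)

/-- A relation between the conserved quantities of the arcs before and after a contact. It holds for
both square roots `k` of `1 + 2E`, and the quotient of the two relations is the reflection law. -/
theorem contact_identity (hw : s.1.2 = 1) (hD : integralD s = 2)
    (hk : k ^ 2 = 1 + 2 * energy s) :
    (s.2.2 * len s.1 - k) * angMom s ^ 2 * (k * angMom (mirror s) + lrl₁ (mirror s)) +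
      (s.2.2 * len s.1 + k) * angMom (mirror s) ^ 2 * (k * angMom s + lrl₁ s) = 0 := by
  have hr := len_pos hw.ge
  have h1 := len_sq s.1
  have h2 := wall_grazing_eq hw
  unfold grazing at h2
  have h3 := energy_eq s
  rw [hD] at h2
  rw [hw] at h1
  have hLL := angMom_mul_mirror hw hD
  have hk2 : k ^ 2 = s.2.2 ^ 2 * len s.1 ^ 2 - 1 := by
    linear_combination hk + h2 - s.2.2 ^ 2 * h1
  have hp : len s.1 * s.2.1 ^ 2 = len s.1 * k ^ 2 - len s.1 + 2 - len s.1 * s.2.2 ^ 2 := by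
    rw [hk, h3]; field_simp; ring
  have hA : lrl₁ s = s.2.2 * angMom s - s.1.1 / len s.1 := rfl
  have hA' : lrl₁ (mirror s) = -s.2.2 * angMom (mirror s) - s.1.1 / len s.1 := rfl
  have hL : angMom s = s.1.1 * s.2.2 - s.2.1 := by unfold angMom; rw [hw, one_mul]
  have hL' : angMom (mirror s) = -(s.1.1 * s.2.2) - s.2.1 := by
    simp only [angMom, mirror]; rw [hw]; ring
  rw [hA, hA']
  generalize angMom (mirror s) = L' at *
  generalize angMom s = L at *
  generalize len s.1 = r at *
  generalize s.1.1 = q at *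
  generalize s.2.1 = p at *
  generalize s.2.2 = P at *
  have e : (P * r - k) * L ^ 2 * (k * L' + (-P * L' - q / r)) +
      (P * r + k) * L' ^ 2 * (k * L + (P * L - q / r)) =
      L * L' * (-(2 * k * p * (P * r + P)) - 2 * q * P * (k ^ 2 + P * r * P)) -
        2 * q / r * (P * r * (p ^ 2 + q ^ 2 * P ^ 2) + 2 * k * p * q * P) := by
    rw [hL, hL']; ring
  rw [e, hLL]
  field_simp
  linear_combination 4 * k * p * P * h1 + 2 * q * P * ((r - 2) * hk2 - hp + r * P ^ 2 * h1)

/-- A reflection multiplies the ratio by a constant less than one. -/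
theorem reflectionRatio_mirror (hw : s.1.2 = 1) (hD : integralD s = 2)
    (hk : k ^ 2 = 1 + 2 * energy s) (hk0 : 0 < k) (hP : 0 ≤ s.2.2) (hL : angMom s ≠ 0) :
    reflectionRatio k s = ((√(1 + k ^ 2) - k) / (√(1 + k ^ 2) + k)) ^ 2 *
      reflectionRatio k (mirror s) := by
  have hD' : integralD (mirror s) = 2 := (integralD_mirror hw).trans hD
  have hk' : (-k) ^ 2 = 1 + 2 * energy s := by rw [neg_sq, hk]
  have hM : √(1 + k ^ 2) = s.2.2 * len s.1 := by
    rw [Real.sqrt_eq_iff_mul_self_eq (by positivity) (mul_nonneg hP (len_nonneg _))]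
    have h1 := len_sq s.1
    have h2 := wall_grazing_eq hw
    unfold grazing at h2
    rw [hD] at h2
    rw [hw] at h1
    linear_combination h2 + hk - s.2.2 ^ 2 * h1
  have hkM : k < √(1 + k ^ 2) := Real.lt_sqrt_of_sq_lt (by linarith)
  -- `p₂ |x|` has the same value `√(D + 2E)` at all contacts
  have e1 := contact_identity hw hD hk
  have e2 := contact_identity hw hD hk'
  have hL' : angMom (mirror s) ≠ 0 := right_ne_zero_of_mul (angMom_mul_mirror_neg hw hD hL).ne
  have b1 := factor_lrl₁_of_integralD hw.ge hD hk
  have b2 := factor_lrl₁_of_integralD (s := mirror s) hw.ge hD' (hk.trans (by rw [energy_mirror]))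
  have c1 : k * angMom s - lrl₁ s ≠ 0 := by
    intro h
    rw [h, mul_zero] at b1
    have : 0 < angMom s ^ 4 / 4 := by positivity
    linarith
  have c2 : k * angMom (mirror s) - lrl₁ (mirror s) ≠ 0 := by
    intro h
    rw [h, mul_zero] at b2
    have : 0 < angMom (mirror s) ^ 4 / 4 := by positivity
    linarith
  rw [← hM] at e1 e2
  unfold reflectionRatio
  generalize √(1 + k ^ 2) = M at *
  have hMk : 0 < M - k := by linarith
  have hMk' : 0 < M + k := by linarith
  generalize angMom (mirror s) = L' at *
  generalize angMom s = L at *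
  generalize lrl₁ (mirror s) = A' at *
  generalize lrl₁ s = A at *
  have f1 : k * L + A = -((M - k) * L ^ 2 * (k * L' + A') / ((M + k) * L' ^ 2)) := by
    field_simp; linear_combination e1
  have f2 : k * L - A = -((M + k) * L ^ 2 * (k * L' - A') / ((M - k) * L' ^ 2)) := by
    field_simp; linear_combination -e2
  rw [f1, f2]
  field_simp

end levelTwo

/-! ### Arcs on the level set `D = 2` -/

section arcs
variable {z : ℝ → State} {t₁ t₂ : ℝ}

/-- An integral of Kepler's equation is constant on an arc. At the end of the arc the mirror image
of the recorded state counts. -/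
theorem IsTrajectory.arc_const (h : IsTrajectory z) (ha : IsArc z t₁ t₂) {f : State → ℝ}
    (hf : ∀ s : State, 1 ≤ s.1.2 → ContinuousAt f s)
    (hd : ∀ t, HasDerivAt z (kepler (z t)) t → 1 ≤ (z t).1.2 →
      HasDerivAt (fun s => f (z s)) 0 t) :
    (∀ t ∈ Ico t₁ t₂, f (z t) = f (z t₁)) ∧ f (mirror (z t₂)) = f (z t₁) := by
  obtain ⟨hlt, hw1, hw2, hab⟩ := ha
  obtain ⟨m, hm⟩ := nonempty_Ioo.2 hlt
  have hc : ∀ t ∈ Ioo t₁ t₂, f (z t) = f (z m) := fun t ht => by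
    rcases le_total t m with h1 | h1
    · exact eq_of_hasDerivAt_zero (f := fun s => f (z s)) (a := t) (b := m)
        (fun u hu => by
          have := hab u ⟨ht.1.trans_le hu.1, hu.2.trans_lt hm.2⟩
          exact hd u (h.hasDerivAt_kepler this) this.le) (left_mem_Icc.2 h1) (right_mem_Icc.2 h1)
    · exact eq_of_hasDerivAt_zero (f := fun s => f (z s)) (a := m) (b := t)
        (fun u hu => by
          have := hab u ⟨hm.1.trans_le hu.1, hu.2.trans_lt ht.2⟩
          exact hd u (h.hasDerivAt_kepler this) this.le) (right_mem_Icc.2 h1) (left_mem_Icc.2 h1)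
  have h1 : f (z t₁) = f (z m) := by
    refine tendsto_nhds_unique ((hf _ hw1.ge).tendsto.comp (h.tendsto_right t₁)) ?_
    refine tendsto_const_nhds.congr' ?_
    filter_upwards [Ioo_mem_nhdsGT hlt] with t ht
    exact (hc t ht).symm
  have h2 : f (mirror (z t₂)) = f (z m) := by
    have h3 : incoming (z t₂) = mirror (z t₂) := if_pos hw2
    have h4 := h.tendsto_left t₂
    rw [h3] at h4
    refine tendsto_nhds_unique ((hf _ (show 1 ≤ (mirror (z t₂)).1.2 from hw2.ge)).tendsto.comp h4) ?_
    refine tendsto_const_nhds.congr' ?_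
    filter_upwards [Ioo_mem_nhdsLT hlt] with t ht
    exact (hc t ht).symm
  refine ⟨fun t ht => ?_, h2.trans h1.symm⟩
  rcases ht.1.eq_or_lt with rfl | h3
  · rfl
  · exact (hc t ⟨h3, ht.2⟩).trans h1.symm

theorem IsTrajectory.arc_angMom (h : IsTrajectory z) (ha : IsArc z t₁ t₂) :
    (∀ t ∈ Ico t₁ t₂, angMom (z t) = angMom (z t₁)) ∧ angMom (mirror (z t₂)) = angMom (z t₁) :=
  h.arc_const ha (fun _ _ => continuous_angMom.continuousAt) fun _ h _ => hasDerivAt_angMom h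

theorem IsTrajectory.arc_lrl₁ (h : IsTrajectory z) (ha : IsArc z t₁ t₂) :
    (∀ t ∈ Ico t₁ t₂, lrl₁ (z t) = lrl₁ (z t₁)) ∧ lrl₁ (mirror (z t₂)) = lrl₁ (z t₁) :=
  h.arc_const ha (fun _ => continuousAt_lrl₁) fun _ => hasDerivAt_lrl₁

theorem IsTrajectory.arc_lrl₂ (h : IsTrajectory z) (ha : IsArc z t₁ t₂) :
    (∀ t ∈ Ico t₁ t₂, lrl₂ (z t) = lrl₂ (z t₁)) ∧ lrl₂ (mirror (z t₂)) = lrl₂ (z t₁) :=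
  h.arc_const ha (fun _ => continuousAt_lrl₂) fun _ => hasDerivAt_lrl₂

end arcs

/-- The second focus of the Kepler ellipse of a state is `A / E`, its major axis `-1 / E`. -/
theorem len_sub_focus {s : State} (hs : 1 ≤ s.1.2) (hE : energy s < 0) :
    len s.1 + len (s.1 - (lrl₁ s / energy s, lrl₂ s / energy s)) = -1 / energy s := by
  have h1 := len_sq s.1
  have h2 := len_eq_conic hs
  have h3 := lrl_sq hs
  have h4 := energy_eq s
  have hr := len_pos hs
  have h5 : 0 ≤ -1 / energy s - len s.1 := by
    have h6 : -(1 / len s.1) ≤ energy s := by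
      rw [h4]; linarith [sq_nonneg s.2.1, sq_nonneg s.2.2]
    rw [sub_nonneg, le_div_iff_of_neg hE]
    have h7 := mul_le_mul_of_nonneg_left h6 hr.le
    rw [mul_neg, mul_one_div_cancel hr.ne'] at h7
    linarith
  have h6 : len (s.1 - (lrl₁ s / energy s, lrl₂ s / energy s)) = -1 / energy s - len s.1 := by
    refine (pow_left_inj₀ (len_nonneg _) h5 two_ne_zero).1 ?_
    rw [len_sq]
    simp only [Prod.fst_sub, Prod.snd_sub]
    have := hE.ne
    generalize energy s = e at *
    generalize len s.1 = r at *
    field_simp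
    linear_combination -e ^ 2 * h1 - 2 * e * h2 + h3
  rw [h6]; ring

theorem len_focus_lt {s : State} (hs : 1 ≤ s.1.2) (hE : energy s < 0) (hL : angMom s ≠ 0) :
    len (lrl₁ s / energy s, lrl₂ s / energy s) < -1 / energy s := by
  have h3 := lrl_sq hs
  refine lt_of_pow_lt_pow_left₀ 2 (div_nonneg_of_nonpos (by norm_num) hE.le) ?_
  rw [len_sq]
  simp only [div_pow]
  rw [← add_div, h3]
  have h4 : 0 < energy s ^ 2 := sq_pos_of_neg hE
  have h5 : 0 < angMom s ^ 2 := by positivity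
  gcongr
  nlinarith

section separatrix
variable {w : ℝ → State} {E : ℝ}

/-- A trajectory with `D = 2` is a sequence of arcs, infinite in both directions of time. -/
theorem exists_arcs (hE1 : -1 < E) (hE : E < 0) (hw : IsTrajectory w) (h0 : w 0 ∈ levelSet 2 E) :
    ∃ u : ℤ → ℝ, StrictMono u ∧ (∀ t, ∃ n, u n ≤ t ∧ t < u (n + 1)) ∧
      ∀ n, IsArc w (u n) (u (n + 1)) := by
  have hG : 0 < grazing (w 0) := by
    unfold grazing; rw [h0.2.1, h0.2.2]; linarith
  obtain ⟨z, u, hz, hz0, hm, htop, hbot, harc⟩ :=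
    exists_trajectory h0.1 (by rw [h0.2.1]; exact hE) hG
  obtain rfl := hz.unique hw hz0
  exact ⟨u, hm, exists_mem_Ico_int hm htop hbot, harc⟩

/-- The two contacts of an arc lie on different sides of the `x₂`-axis, and the only point of the axis
on the ellipse above the wall is `(0,2)`. -/
theorem arc_crosses_axis (hw : IsTrajectory w) (h0 : w 0 ∈ levelSet 2 E) {t₁ t₂ : ℝ}
    (ha : IsArc w t₁ t₂) (hL : angMom (w t₁) ≠ 0) (hE1 : -1 < E) (hE : E < 0) :
    ∃ t ∈ Ioo t₁ t₂, (w t).1 = (0, 2) := by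
  obtain ⟨hlt, hw1, hw2, -⟩ := id ha
  have hl := fun t => hw.mem_levelSet h0 t
  obtain ⟨hLc, hLm⟩ := hw.arc_angMom ha
  obtain ⟨hAc, hAm⟩ := hw.arc_lrl₁ ha
  obtain ⟨hBc, hBm⟩ := hw.arc_lrl₂ ha
  have hL2 := angMom_sq_of_integralD (hl t₁).2.2
  have hq := len_eq_conic hw1.ge
  have hq' := len_eq_conic (s := mirror (w t₂)) hw2.ge
  have e1 := len_sq (w t₁).1
  have e2 := len_sq (w t₂).1
  have hA2 : lrl₁ (w t₁) ^ 2 < 1 := by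
    have h1 := lrl_sq hw1.ge
    rw [(hl t₁).2.1] at h1
    have h2 : lrl₂ (w t₁) = angMom (w t₁) ^ 2 / 2 - 1 := by linarith
    rw [h2] at h1
    nlinarith [sq_nonneg (angMom (w t₁) ^ 2 / 2 - (1 + 2 * E))]
  -- equal contact points would have opposite momenta `p₂` and equal `A₁`, which forces `L = 0`
  have hne : (w t₁).1.1 ≠ (w t₂).1.1 := by
    intro h
    have g1 := wall_grazing_eq hw1
    have g2 := wall_grazing_eq hw2
    rw [hw.grazing_eq t₂ t₁, g1, h] at g2
    have g3 : (w t₁).2.2 = (w t₂).2.2 :=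
      (pow_left_inj₀ (hw.reflection t₁ hw1).1 (hw.reflection t₂ hw2).1 two_ne_zero).1
        (mul_left_cancel₀ (by positivity) g2)
    have hp : 0 < (w t₁).2.2 := hw.momentum_pos (by
      unfold grazing; rw [(hl t₁).2.1, (hl t₁).2.2]; linarith) hw1
    have h5 : lrl₁ (mirror (w t₂)) =
        -(w t₂).2.2 * angMom (mirror (w t₂)) - (w t₂).1.1 / len (w t₂).1 := rfl
    have h6 : lrl₁ (w t₁) = (w t₁).2.2 * angMom (w t₁) - (w t₁).1.1 / len (w t₁).1 := rfl
    have h7 : (w t₁).1 = (w t₂).1 := Prod.ext h (hw1.trans hw2.symm)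
    rw [hAm, h6, hLm, h7, g3] at h5
    rw [g3] at hp
    have h8 : (w t₂).2.2 * angMom (w t₁) = 0 := by linarith
    rcases mul_eq_zero.1 h8 with h8 | h8
    · exact hp.ne' h8
    · exact hL h8
  -- the contact points are the zeros of a quadratic polynomial with negative constant term
  have hneg : (w t₁).1.1 * (w t₂).1.1 < 0 := by
    rw [hLm, hAm, hBm] at hq'
    change len (w t₂).1 = _ - _ * (w t₂).1.1 - _ * (w t₂).1.2 at hq'
    rw [hL2, hw1] at hq
    rw [hL2, hw2] at hq'
    rw [hq, hw1] at e1
    rw [hq', hw2] at e2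
    have hB : 0 < 1 + lrl₂ (w t₁) := by
      have : 0 < angMom (w t₁) ^ 2 := by positivity
      linarith
    generalize (w t₁).1.1 = q at *
    generalize (w t₂).1.1 = q' at *
    generalize lrl₁ (w t₁) = A at *
    generalize lrl₂ (w t₁) = B at *
    have h1 : (q + q') * (1 - A ^ 2) + 2 * (2 + B) * A = 0 := by
      refine mul_left_cancel₀ (sub_ne_zero.2 hne) ?_
      linear_combination e2 - e1
    have h2 : q * q' * (1 - A ^ 2) = 1 - (2 + B) ^ 2 := by
      linear_combination q * h1 + e1
    by_contra h3
    rw [not_lt] at h3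
    have h4 : 0 ≤ q * q' * (1 - A ^ 2) := mul_nonneg h3 (by linarith)
    nlinarith
  have hcx : Continuous fun t => (w t).1.1 :=
    continuous_iff_continuousAt.2 fun t => (hw.deriv_x₁ t).continuousAt
  obtain ⟨t, ht, hx⟩ : ∃ t ∈ Ioo t₁ t₂, (w t).1.1 = 0 := by
    rcases mul_neg_iff.1 hneg with ⟨h1, h2⟩ | ⟨h1, h2⟩
    · exact intermediate_value_Ioo' hlt.le hcx.continuousOn ⟨h2, h1⟩
    · exact intermediate_value_Ioo hlt.le hcx.continuousOn ⟨h1, h2⟩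
  refine ⟨t, ht, Prod.ext hx ?_⟩
  have h1 := len_eq_conic (hw.above_wall t)
  have h2 := angMom_sq_of_integralD (hl t).2.2
  have h3 : (w t).1 = (0, (w t).1.2) := Prod.ext hx rfl
  have h4 : len (w t).1 = (w t).1.2 := by
    rw [h3]; exact len_vertical (by linarith [hw.above_wall t])
  rw [h4, h2, hx] at h1
  have h5 : 1 + lrl₂ (w t) ≠ 0 := by
    intro h
    rw [h, mul_zero] at h2
    rw [hLc t (Ioo_subset_Ico_self ht)] at h2
    exact hL (by simpa using h2)
  exact mul_right_cancel₀ h5 (by linarith)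

end separatrix

/-! ### The separatrix -/

section separatrix
variable {w : ℝ → State} {E : ℝ}

theorem angMom_ne_zero (hE1 : -1 / 2 < E) (hE : E < 0) (hw : IsTrajectory w)
    (h0 : w 0 ∈ separatrixStates E) (t : ℝ) : angMom (w t) ≠ 0 := by
  obtain ⟨z, T, hz, -⟩ := vertical_orbit (by linarith : -1 < E) hE
  intro h
  obtain ⟨c, hc⟩ := hz.unique w hw t (mem_verticalStates_iff.2 ⟨hw.mem_levelSet h0.1 t, h⟩)
  have h1 : w 0 ∈ verticalStates E := by
    rw [hc 0, ← hz.range_eq]; exact mem_range_self _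
  exact h0.2 (mem_verticalStates_iff.1 h1).2

theorem mem_separatrixStates (hE1 : -1 / 2 < E) (hE : E < 0) (hw : IsTrajectory w)
    (h0 : w 0 ∈ separatrixStates E) (t : ℝ) : w t ∈ separatrixStates E :=
  ⟨hw.mem_levelSet h0.1 t, angMom_ne_zero hE1 hE hw h0 t⟩

theorem arcsThroughF (hE1 : -1 / 2 < E) (hE : E < 0) (hw : IsTrajectory w)
    (h0 : w 0 ∈ separatrixStates E) : ArcsThroughF w E := by
  obtain ⟨u, -, hu, harc⟩ := exists_arcs (by linarith) hE hw h0.1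
  intro t
  obtain ⟨n, h1, h2⟩ := hu t
  have ha := harc n
  have hL := angMom_ne_zero hE1 hE hw h0
  have hl := fun t => hw.mem_levelSet h0.1 t
  refine ⟨u n, u (n + 1), h1, h2, ha, ⟨(lrl₁ (w (u n)) / E, lrl₂ (w (u n)) / E), ?_, ?_⟩,
    arc_crosses_axis hw h0.1 ha (hL _) (by linarith) hE⟩
  · have := len_focus_lt (hw.above_wall (u n)) (by rw [(hl _).2.1]; exact hE) (hL _)
    rwa [(hl _).2.1] at this
  · intro s hs
    rcases hs.2.eq_or_lt with rfl | h3
    · have h4 : energy (mirror (w (u (n + 1)))) = E := by rw [energy_mirror]; exact (hl _).2.1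
      have := len_sub_focus (s := mirror (w (u (n + 1)))) (hw.above_wall _) (by rw [h4]; exact hE)
      rwa [h4, (hw.arc_lrl₁ ha).2, (hw.arc_lrl₂ ha).2] at this
    · have := len_sub_focus (hw.above_wall s) (by rw [(hl _).2.1]; exact hE)
      rwa [(hl _).2.1, (hw.arc_lrl₁ ha).1 s ⟨hs.1, h3⟩, (hw.arc_lrl₂ ha).1 s ⟨hs.1, h3⟩] at this

/-- The ratio at successive arcs is a geometric sequence, so that it tends to `0` in one direction of
time and to `∞` in the other; in both cases the angular momentum tends to `0`. -/
theorem tendsto_angMom (hE1 : -1 / 2 < E) (hE : E < 0) (hw : IsTrajectory w)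
    (h0 : w 0 ∈ separatrixStates E) :
    Tendsto (fun t => angMom (w t)) atTop (𝓝 0) ∧
      Tendsto (fun t => angMom (w t)) atBot (𝓝 0) := by
  obtain ⟨u, hm, hu, harc⟩ := exists_arcs (by linarith) hE hw h0.1
  have hL := angMom_ne_zero hE1 hE hw h0
  have hl := fun t => hw.mem_levelSet h0.1 t
  obtain ⟨k, hk0, hk⟩ : ∃ k : ℝ, 0 < k ∧ k ^ 2 = 1 + 2 * E :=
    ⟨√(1 + 2 * E), Real.sqrt_pos.2 (by linarith), Real.sq_sqrt (by linarith)⟩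
  have hk' : ∀ t, k ^ 2 = 1 + 2 * energy (w t) := fun t => by rw [(hl t).2.1, hk]
  set c := ((√(1 + k ^ 2) - k) / (√(1 + k ^ 2) + k)) ^ 2 with hc
  have hkM : k < √(1 + k ^ 2) := Real.lt_sqrt_of_sq_lt (by linarith)
  have hc0 : 0 < c := by
    have : 0 < √(1 + k ^ 2) - k := by linarith
    positivity
  have hc1 : c < 1 := by
    rw [hc, sq_lt_one_iff₀ (div_nonneg (by linarith) (by linarith)), div_lt_one (by linarith)]
    linarith
  set ρ : ℝ → ℝ := fun t => reflectionRatio k (w t) with hρ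
  have hρ0 : ∀ t, 0 < ρ t := fun t =>
    reflectionRatio_pos (hw.above_wall t) (hl t).2.2 (hk' t) (hL t)
  have hLρ : ∀ t, angMom (w t) ^ 2 = 16 * k ^ 2 * ρ t / (1 + ρ t) ^ 2 := fun t =>
    angMom_sq_eq (hw.above_wall t) (hl t).2.2 (hk' t) (hL t)
  have hstep : ∀ n, ρ (u (n + 1)) = c * ρ (u n) := fun n => by
    have h1 := reflectionRatio_mirror (harc n).2.2.1 (hl _).2.2 (hk' (u (n + 1))) hk0
      (hw.reflection _ (harc n).2.2.1).1 (hL _)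
    have h2 : reflectionRatio k (mirror (w (u (n + 1)))) = ρ (u n) := by
      simp only [hρ, reflectionRatio, (hw.arc_angMom (harc n)).2, (hw.arc_lrl₁ (harc n)).2]
    rw [h2] at h1
    exact h1
  have hpow : ∀ n : ℤ, ρ (u n) = c ^ n * ρ (u 0) := fun n => by
    induction n using Int.induction_on with
    | zero => simp
    | succ n ih => rw [hstep, ih, zpow_add_one₀ hc0.ne']; ring
    | pred n ih =>
      have h1 := hstep (-n - 1)
      rw [sub_add_cancel, ih] at h1
      rw [zpow_sub_one₀ hc0.ne']
      field_simp
      linarith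
  have hloc : ∀ t, ∃ n : ℤ, u n ≤ t ∧ t < u (n + 1) ∧ ρ t = c ^ n * ρ (u 0) := fun t => by
    obtain ⟨n, h1, h2⟩ := hu t
    refine ⟨n, h1, h2, ?_⟩
    rw [← hpow]
    simp only [hρ, reflectionRatio, (hw.arc_angMom (harc n)).1 t ⟨h1, h2⟩,
      (hw.arc_lrl₁ (harc n)).1 t ⟨h1, h2⟩]
  have hcn : Tendsto (fun n : ℕ => c ^ n) atTop (𝓝 0) :=
    tendsto_pow_atTop_nhds_zero_of_lt_one hc0.le hc1
  have key : ∀ {l : Filter ℝ}, Tendsto (fun t => angMom (w t) ^ 2) l (𝓝 0) →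
      Tendsto (fun t => angMom (w t)) l (𝓝 0) := fun {l} h => by
    have h1 := (Real.continuous_sqrt.tendsto 0).comp h
    simp only [Real.sqrt_zero, Function.comp_def, Real.sqrt_sq_eq_abs] at h1
    exact (tendsto_zero_iff_abs_tendsto_zero _).2 h1
  constructor
  · refine key ?_
    have h1 : Tendsto ρ atTop (𝓝 0) := by
      refine tendsto_order.2 ⟨fun a ha => Eventually.of_forall fun t => ha.trans (hρ0 t),
        fun a ha => ?_⟩
      have h2 := hcn.mul_const (ρ (u 0))
      rw [zero_mul] at h2
      obtain ⟨N, hN⟩ := (h2.eventually (gt_mem_nhds ha)).exists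
      filter_upwards [eventually_ge_atTop (u N)] with t ht
      obtain ⟨n, h3, h4, h5⟩ := hloc t
      have h6 : (N : ℤ) ≤ n := by
        have := hm.lt_iff_lt.1 (ht.trans_lt h4)
        omega
      rw [h5]
      refine lt_of_le_of_lt (mul_le_mul_of_nonneg_right ?_ (hρ0 _).le) hN
      rw [← zpow_natCast]
      exact zpow_le_zpow_right_of_le_one₀ hc0 hc1.le h6
    have h2 := (h1.const_mul (16 * k ^ 2)).div ((h1.const_add 1).pow 2) (by norm_num)
    simp only [mul_zero, zero_div] at h2
    exact h2.congr fun t => (hLρ t).symm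
  · refine key ?_
    have h1 : Tendsto (fun t => (ρ t)⁻¹) atBot (𝓝 0) := by
      refine tendsto_order.2 ⟨fun a ha => Eventually.of_forall fun t =>
        ha.trans (inv_pos.2 (hρ0 t)), fun a ha => ?_⟩
      have h2 := hcn.mul_const (ρ (u 0))⁻¹
      rw [zero_mul] at h2
      obtain ⟨N, hN⟩ := (h2.eventually (gt_mem_nhds ha)).exists
      filter_upwards [eventually_lt_atBot (u (-N))] with t ht
      obtain ⟨n, h3, h4, h5⟩ := hloc t
      have h6 : (N : ℤ) ≤ -n := by
        have := hm.lt_iff_lt.1 (h3.trans_lt ht)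
        omega
      rw [h5, mul_inv, ← zpow_neg]
      refine lt_of_le_of_lt (mul_le_mul_of_nonneg_right ?_ (inv_pos.2 (hρ0 _)).le) hN
      rw [← zpow_natCast]
      exact zpow_le_zpow_right_of_le_one₀ hc0 hc1.le h6
    have h2 := (h1.const_mul (16 * k ^ 2)).div ((h1.const_add 1).pow 2) (by norm_num)
    simp only [mul_zero, zero_div] at h2
    refine h2.congr fun t => ?_
    rw [hLρ, Pi.div_apply]
    have := hρ0 t
    field_simp
    ring

/-! ### Convergence to the vertical orbit -/

/-- All states with `D = 2` and energy `E`, incoming ones at the wall included. In contrast to the level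
set, which contains the outgoing ones only, this set is closed. -/
def closedLevel (E : ℝ) : Set State := {s | 1 ≤ s.1.2 ∧ energy s = E ∧ integralD s = 2}

theorem isCompact_closedLevel (hE : E < 0) : IsCompact (closedLevel E) := by
  have hcl : IsClosed {s : State | 1 ≤ s.1.2} := isClosed_le continuous_const (by fun_prop)
  have h1 : IsClosed (closedLevel E) := by
    have ha : ContinuousOn energy {s : State | 1 ≤ s.1.2} := fun s hs =>
      (continuousAt_energy hs).continuousWithinAt
    have hb : ContinuousOn integralD {s : State | 1 ≤ s.1.2} := fun s hs =>
      (continuousAt_integralD hs).continuousWithinAt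
    have hab := (ha.preimage_isClosed_of_isClosed hcl (isClosed_singleton (x := E))).inter
      (hb.preimage_isClosed_of_isClosed hcl (isClosed_singleton (x := (2 : ℝ))))
    rwa [← inter_inter_distrib_left] at hab
  set b := max (-1 / E) (2 + 2 * E + 1) with hb
  refine (isCompact_Icc (a := (((-b, -b), (-b, -b)) : State))
    (b := ((b, b), (b, b)))).of_isClosed_subset h1 fun s hs => ?_
  obtain ⟨h2, h3, -⟩ := hs
  have hr := len_pos h2
  rw [energy_eq] at h3
  have hr1 : 1 ≤ len s.1 := h2.trans le_len
  have h4 : len s.1 ≤ -1 / E := by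
    rw [le_div_iff_of_neg hE]
    have h5 : -(1 / len s.1) ≤ E := by linarith [sq_nonneg s.2.1, sq_nonneg s.2.2]
    have h6 := mul_le_mul_of_nonneg_left h5 hr.le
    rw [mul_neg, mul_one_div_cancel hr.ne'] at h6
    linarith
  have h5 : s.2.1 ^ 2 + s.2.2 ^ 2 ≤ 2 + 2 * E := by
    have : 1 / len s.1 ≤ 1 := by rw [div_le_one hr]; exact hr1
    linarith
  have h6 := len_sq s.1
  have hb1 : -1 / E ≤ b := le_max_left _ _
  have hb2 : 2 + 2 * E + 1 ≤ b := le_max_right _ _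
  have hE' : 0 ≤ 2 + 2 * E := le_trans (by positivity) h5
  have x1 : |s.1.1| ≤ b := (abs_le_of_sq_le_sq (by nlinarith [sq_nonneg s.1.2]) hr.le).trans
    (h4.trans hb1)
  have x2 : |s.1.2| ≤ b := (abs_le_of_sq_le_sq (by nlinarith [sq_nonneg s.1.1]) hr.le).trans
    (h4.trans hb1)
  have p1 : |s.2.1| ≤ b := (abs_le_of_sq_le_sq (by nlinarith [sq_nonneg s.2.2])
    (by linarith : 0 ≤ 2 + 2 * E + 1)).trans hb2
  have p2 : |s.2.2| ≤ b := (abs_le_of_sq_le_sq (by nlinarith [sq_nonneg s.2.1])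
    (by linarith : 0 ≤ 2 + 2 * E + 1)).trans hb2
  rw [abs_le] at x1 x2 p1 p2
  exact ⟨⟨⟨x1.1, x2.1⟩, ⟨p1.1, p2.1⟩⟩, ⟨⟨x1.2, x2.2⟩, ⟨p1.2, p2.2⟩⟩⟩

theorem mem_closure_vertical (hE1 : -1 < E) (hE : E < 0) {s : State} (hs : s ∈ closedLevel E)
    (hL : angMom s = 0) : s ∈ closure (verticalStates E) := by
  obtain ⟨h1, h2, h3⟩ := hs
  by_cases hp : s ∈ phaseSpace
  · exact subset_closure (mem_verticalStates_iff.2 ⟨⟨hp, h2, h3⟩, hL⟩)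
  · -- an incoming state is a limit of states before the contact
    have hw : s.1.2 = 1 ∧ s.2.2 < 0 := by
      simp only [phaseSpace, mem_ofPred_eq, not_and, not_forall, not_le] at hp
      obtain ⟨h4, h5⟩ := hp h1
      exact ⟨h4, h5⟩
    obtain ⟨h4, h5⟩ := (angMom_eq_zero_iff h1 h3).1 hL
    have h6 : mirror s ∈ verticalStates E :=
      ⟨⟨⟨h1, fun _ => by simp only [mirror]; linarith [hw.2]⟩, by rw [energy_mirror, h2],
        by rw [integralD_mirror hw.1, h3]⟩, h4, h5⟩
    obtain ⟨z, T, hz, -⟩ := vertical_orbit hE1 hE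
    obtain ⟨t, ht⟩ := hz.range_eq.symm ▸ h6
    have h7 := hz.trajectory.tendsto_left t
    have h8 : incoming (z t) = s := by
      unfold incoming
      rw [ht, if_pos (by exact hw.1), mirror_mirror]
    rw [h8] at h7
    refine mem_closure_of_tendsto h7 (Eventually.of_forall fun t' => ?_)
    rw [← hz.range_eq]; exact mem_range_self _

theorem tendsto_infDist (hE1 : -1 < E) (hE : E < 0) {l : Filter ℝ} (hw : IsTrajectory w)
    (h0 : w 0 ∈ levelSet 2 E) (hL : Tendsto (fun t => angMom (w t)) l (𝓝 0)) :
    Tendsto (fun t => Metric.infDist (w t) (verticalStates E)) l (𝓝 0) := by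
  refine tendsto_order.2 ⟨fun a ha => Eventually.of_forall fun t =>
    ha.trans_le Metric.infDist_nonneg, fun ε hε => ?_⟩
  -- away from the vertical orbit `|L|` is bounded below
  have hC : IsCompact (closedLevel E ∩ {s | ε ≤ Metric.infDist s (verticalStates E)}) :=
    (isCompact_closedLevel hE).inter_right
      (isClosed_le continuous_const (Metric.continuous_infDist_pt _))
  have hmem : ∀ t, w t ∈ closedLevel E := fun t =>
    ⟨hw.above_wall t, (hw.mem_levelSet h0 t).2⟩
  rcases (closedLevel E ∩ {s | ε ≤ Metric.infDist s (verticalStates E)}).eq_empty_or_nonempty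
    with he | hne
  · refine Eventually.of_forall fun t => ?_
    by_contra h
    exact (he ▸ ⟨hmem t, not_lt.1 h⟩ : w t ∈ (∅ : Set State))
  · obtain ⟨s, ⟨hs1, hs2⟩, hmin⟩ := hC.exists_isMinOn hne continuous_angMom.abs.continuousOn
    have h1 : 0 < |angMom s| := by
      refine abs_pos.2 fun h => ?_
      have := mem_closure_vertical hE1 hE hs1 h
      have h2 := Metric.infDist_zero_of_mem_closure this
      rw [mem_ofPred_eq, h2] at hs2
      linarith
    have h2 : Tendsto (fun t => |angMom (w t)|) l (𝓝 0) := by simpa using hL.abs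
    filter_upwards [h2.eventually (gt_mem_nhds h1)] with t ht
    by_contra h
    exact ht.not_ge (hmin ⟨hmem t, not_lt.1 h⟩)

/-! ### Connectedness of the separatrix -/

theorem continuous_glue : Continuous glue := continuous_quotient_mk'

theorem glue_mirror {s : State} (h : s.1.2 = 1) : glue (mirror s) = glue s :=
  Quotient.sound (Or.inr ⟨rfl, h, rfl, rfl⟩)

theorem len_two : len (0, 2) = 2 := len_vertical (by norm_num)

theorem mem_separatrixStates_of_focus {s : State} (hx : s.1 = (0, 2))
    (hp : s.2.1 ^ 2 + s.2.2 ^ 2 = 1 + 2 * E) (h1 : s.2.1 ≠ 0) : s ∈ separatrixStates E := by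
  refine ⟨⟨⟨by rw [hx]; norm_num, fun h => ?_⟩, ?_, ?_⟩, ?_⟩
  · rw [hx] at h; norm_num at h
  · rw [energy_eq, hx, len_two]; linarith
  · simp only [integralD, lrl₂, angMom, hx, len_two]; ring
  · simp only [angMom, hx]; simpa using h1

theorem isPreconnected_half {k : ℝ} (hk : 0 < k) : IsPreconnected
    {s : State | s.1 = (0, 2) ∧ s.2.1 ^ 2 + s.2.2 ^ 2 = k ^ 2 ∧ 0 < s.2.1} := by
  have h1 : {s : State | s.1 = (0, 2) ∧ s.2.1 ^ 2 + s.2.2 ^ 2 = k ^ 2 ∧ 0 < s.2.1} =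
      (fun q : ℝ => (((0, 2), (√(k ^ 2 - q ^ 2), q)) : State)) '' Ioo (-k) k := by
    ext s
    constructor
    · rintro ⟨h1, h2, h3⟩
      refine ⟨s.2.2, abs_lt.1 (abs_lt_of_sq_lt_sq (by nlinarith) hk.le), ?_⟩
      have h4 : k ^ 2 - s.2.2 ^ 2 = s.2.1 ^ 2 := by linarith
      simp only [h4, Real.sqrt_sq h3.le]
      exact Prod.ext h1.symm rfl
    · rintro ⟨q, hq, rfl⟩
      have h2 : 0 < k ^ 2 - q ^ 2 := by
        have := mul_pos (sub_pos.2 hq.2) (neg_lt_iff_pos_add.1 hq.1)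
        nlinarith
      refine ⟨rfl, ?_, Real.sqrt_pos.2 h2⟩
      simp only [Real.sq_sqrt h2.le]; ring
  rw [h1]
  exact isPreconnected_Ioo.image _ (by fun_prop)

/-- Every trajectory of the separatrix passes through `(0,2)` from left to right. -/
theorem exists_through_focus (hE1 : -1 / 2 < E) (hE : E < 0) (hw : IsTrajectory w)
    (h0 : w 0 ∈ separatrixStates E) :
    ∃ t, (w t).1 = (0, 2) ∧ (w t).2.1 ^ 2 + (w t).2.2 ^ 2 = 1 + 2 * E ∧ 0 < (w t).2.1 := by
  obtain ⟨u, -, -, harc⟩ := exists_arcs (by linarith) hE hw h0.1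
  have hL := angMom_ne_zero hE1 hE hw h0
  have hl := fun t => hw.mem_levelSet h0.1 t
  -- the angular momentum is negative on one of two consecutive arcs
  obtain ⟨n, hn⟩ : ∃ n, angMom (w (u n)) < 0 := by
    by_contra! h
    have h1 := angMom_mul_mirror_neg (harc 0).2.2.1 (hl _).2.2 (hL (u (0 + 1)))
    rw [(hw.arc_angMom (harc 0)).2] at h1
    exact h1.not_ge (mul_nonneg (h _) (h _))
  obtain ⟨t, ht, hx⟩ := arc_crosses_axis hw h0.1 (harc n) (hL _) (by linarith) hE
  refine ⟨t, hx, ?_, ?_⟩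
  · have := (hl t).2.1
    rw [energy_eq, hx, len_two] at this
    linarith
  · have h1 := (hw.arc_angMom (harc n)).1 t (Ioo_subset_Ico_self ht)
    rw [← h1] at hn
    simp only [angMom, hx] at hn
    linarith

/-- Every trajectory meets the set `H` of states at `(0,2)` which move to the right, and this set is
a half circle. -/
theorem isConnected_separatrix (hE1 : -1 / 2 < E) (hE : E < 0) :
    IsConnected (glue '' separatrixStates E) := by
  obtain ⟨k, hk0, hk⟩ : ∃ k : ℝ, 0 < k ∧ k ^ 2 = 1 + 2 * E :=
    ⟨√(1 + 2 * E), Real.sqrt_pos.2 (by linarith), Real.sq_sqrt (by linarith)⟩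
  set H := {s : State | s.1 = (0, 2) ∧ s.2.1 ^ 2 + s.2.2 ^ 2 = k ^ 2 ∧ 0 < s.2.1} with hH
  have hHW : H ⊆ separatrixStates E := fun s hs =>
    mem_separatrixStates_of_focus hs.1 (hs.2.1.trans hk) hs.2.2.ne'
  set b : State := ((0, 2), (k, 0)) with hb
  have hbH : b ∈ H := ⟨rfl, by simp [hb], hk0⟩
  refine ⟨⟨glue b, mem_image_of_mem _ (hHW hbH)⟩,
    isPreconnected_of_forall (glue b) fun y hy => ?_⟩
  obtain ⟨s, hs, rfl⟩ := hy
  obtain ⟨w, -, hw, hw0, -⟩ := exists_trajectory hs.1.1 (by rw [hs.1.2.1]; exact hE)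
    (by unfold grazing; rw [hs.1.2.1, hs.1.2.2]; linarith)
  have h0 : w 0 ∈ separatrixStates E := hw0 ▸ hs
  obtain ⟨t, ht1, ht2, ht3⟩ := exists_through_focus hE1 hE hw h0
  have hcont : Continuous fun t => glue (w t) :=
    hw.continuous_comp (fun _ _ => continuous_glue.continuousAt) fun _ => glue_mirror
  refine ⟨glue '' H ∪ range fun t => glue (w t), union_subset (image_mono hHW) ?_,
    Or.inl (mem_image_of_mem _ hbH), Or.inr ⟨0, by rw [← hw0]⟩, ?_⟩
  · rintro _ ⟨t, rfl⟩
    exact mem_image_of_mem _ (mem_separatrixStates hE1 hE hw h0 t)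
  · exact IsPreconnected.union (glue (w t))
      (mem_image_of_mem _ ⟨ht1, ht2.trans hk.symm, ht3⟩) (mem_range_self t)
      ((isPreconnected_half hk0).image _ continuous_glue.continuousOn)
      (isPreconnected_range hcont)

theorem isSeparatrix (hE1 : -1 / 2 < E) (hE : E < 0) :
    IsSeparatrix (verticalStates E) (separatrixStates E) where
  disjoint := disjoint_separatrixStates E
  connected := isConnected_separatrix hE1 hE
  exists_trajectory s hs := by
    obtain ⟨w, -, hw, hw0, -⟩ := exists_trajectory hs.1.1 (by rw [hs.1.2.1]; exact hE)
      (by unfold grazing; rw [hs.1.2.1, hs.1.2.2]; linarith)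
    exact ⟨w, hw, hw0⟩
  invariant _ hw h0 t := mem_separatrixStates hE1 hE hw h0 t
  forward _ hw h0 := tendsto_infDist (by linarith) hE hw h0.1 (tendsto_angMom hE1 hE hw h0).1
  backward _ hw h0 := tendsto_infDist (by linarith) hE hw h0.1 (tendsto_angMom hE1 hE hw h0).2

end separatrix

/-! ### The singular pairs of values of the integrals -/

/-- The conditions on `D` and `E` express that the integrals of a state satisfy `D + 2E ≥ 0`, with
equality for sliding states only, and that `|A| ≤ 1`. -/
theorem singular_pairs {D E : ℝ} (hE : E < 0) (hS : IsSingularPair D E)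
    (hne : (levelSet D E).Nonempty) :
    (D + 2 * E = 0 ∧ 0 < D ∧ D < 2) ∨
    (1 + 2 * D * E + 4 * E ^ 2 = 0 ∧ 2 < D ∧ -1 / 2 < E) ∨
    (D = 2 ∧ -1 < E ∧ E < -1 / 2) ∨
    (D = 2 ∧ -1 / 2 < E ∧ E < 0) ∨
    (D = 2 ∧ (E = -1 ∨ E = -1 / 2)) := by
  obtain ⟨s, ⟨hs, -⟩, hsE, hsD⟩ := hne
  have hG := grazing_nonneg hs
  have hG0 := grazing_eq_zero_iff hs
  unfold grazing at hG hG0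
  rw [hsE, hsD] at hG hG0
  have hr := len_pos hs
  by_cases h1 : D + 2 * E = 0
  · -- a sliding state
    obtain ⟨-, h3⟩ := hG0.1 h1
    have h4 := energy_eq s
    have h5 : 1 / len s.1 ≤ 1 := by rw [div_le_one hr]; exact hs.trans le_len
    rw [h3, hsE] at h4
    have h6 : -1 ≤ E := by nlinarith [sq_nonneg s.2.1]
    rcases h6.eq_or_lt with rfl | h6
    · exact Or.inr <| Or.inr <| Or.inr <| Or.inr ⟨by linarith, Or.inl rfl⟩
    · exact Or.inl ⟨h1, by linarith, by linarith⟩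
  by_cases h2 : 1 + 2 * D * E + 4 * E ^ 2 = 0
  · -- `A = (0, 2E)`
    have h3 := radius_sq hs
    have h4 := lrl_sq hs
    rw [hsD, hsE, h2] at h3
    rw [hsE] at h4
    have h5 : (lrl₂ s - 2 * E) ^ 2 = 0 := by
      linarith [sq_nonneg (lrl₁ s), sq_nonneg (lrl₂ s - 2 * E)]
    have h6 : lrl₂ s = 2 * E := sub_eq_zero.1 (by simpa using h5)
    rw [h6] at h4
    have h7 : 4 * E ^ 2 ≤ 1 := by
      nlinarith [sq_nonneg (lrl₁ s), mul_nonneg (neg_nonneg.2 hE.le) (sq_nonneg (angMom s))]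
    have h8 : -1 / 2 ≤ E := by nlinarith
    rcases h8.eq_or_lt with rfl | h8
    · exact Or.inr <| Or.inr <| Or.inr <| Or.inr ⟨by linarith, Or.inr rfl⟩
    · refine Or.inr <| Or.inl ⟨h2, ?_, h8⟩
      have h9 : 0 < (1 + 2 * E) ^ 2 := pow_pos (by linarith) 2
      nlinarith
  have h3 : D = 2 := by
    by_contra h3
    refine hS ⟨fun h4 => ?_, fun h4 => h2 (by linarith), h1⟩
    have h5 : (D - 2) * (D + 2) = 0 := by linarith
    rcases mul_eq_zero.1 h5 with h5 | h5
    · exact h3 (by linarith)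
    · -- `D = -2` contradicts `D + 2E ≥ 0`
      linarith
  subst h3
  have h4 : -1 < E := lt_of_le_of_ne (by linarith) fun h => h1 (by rw [← h]; norm_num)
  rcases lt_trichotomy E (-1 / 2) with h5 | h5 | h5
  · exact Or.inr <| Or.inr <| Or.inl ⟨rfl, h4, h5⟩
  · exact Or.inr <| Or.inr <| Or.inr <| Or.inr ⟨rfl, Or.inr h5⟩
  · exact Or.inr <| Or.inr <| Or.inr <| Or.inl ⟨rfl, h5, hE⟩

end Boltzmann

end
open Boltzmann in
theorem theorem4p1 :
    -- the wall
    (∀ D E : ℝ, D + 2 * E = 0 → 0 < D → D < 2 →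
      ∃ z T, IsClosedOrbit z T (levelSet D E) ∧ IsBouncingLimit z ∧
        ∃ a b : ℝ, 0 < a ∧ a < b ∧ causticPlus D E = wallEllipse a b ∧
          trace z = segment ℝ ((-a, 1) : ℝ × ℝ) (a, 1)) ∧
    -- the 2-periodic ellipse
    (∀ D E : ℝ, 1 + 2 * D * E + 4 * E ^ 2 = 0 → 2 < D → -1 / 2 < E →
      ∃ z T, IsClosedOrbit z T (levelSet D E) ∧
        {t ∈ Set.Ico 0 T | (z t).1.2 = 1}.ncard = 2 ∧
        ∃ a b : ℝ, 0 < a ∧ a < b ∧ trace z = {x ∈ wallEllipse a b | 1 ≤ x.2}) ∧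
    -- the vertical orbit
    (∀ E : ℝ, -1 < E → E < -1 / 2 →
      ∃ z T, IsClosedOrbit z T (levelSet 2 E) ∧
        trace z = segment ℝ ((0, 1) : ℝ × ℝ) (0, -1 / E)) ∧
    -- the vertical orbit and the separatrix
    (∀ E : ℝ, -1 / 2 < E → E < 0 →
      ∃ z T K W, levelSet 2 E = K ∪ W ∧ IsClosedOrbit z T K ∧
        trace z = segment ℝ ((0, 1) : ℝ × ℝ) (0, -1 / E) ∧
        IsSeparatrix K W ∧ ∀ w, IsTrajectory w → w 0 ∈ W → ArcsThroughF w E) ∧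
    -- there are no other non-empty singular level sets, except at two corners
    (∀ D E : ℝ, E < 0 → IsSingularPair D E → (levelSet D E).Nonempty →
      (D + 2 * E = 0 ∧ 0 < D ∧ D < 2) ∨
      (1 + 2 * D * E + 4 * E ^ 2 = 0 ∧ 2 < D ∧ -1 / 2 < E) ∨
      (D = 2 ∧ -1 < E ∧ E < -1 / 2) ∨
      (D = 2 ∧ -1 / 2 < E ∧ E < 0) ∨
      (D = 2 ∧ (E = -1 ∨ E = -1 / 2))) := by
  refine ⟨fun D E => wall_orbit, fun D E => ellipse_orbit, fun E h1 h2 => ?_, fun E h1 h2 => ?_,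
    fun D E => singular_pairs⟩
  · rw [levelSet_two_eq h2]
    exact vertical_orbit h1 (by linarith)
  · obtain ⟨z, T, hz, htr⟩ := vertical_orbit (by linarith : -1 < E) h2
    exact ⟨z, T, verticalStates E, separatrixStates E, levelSet_two_eq_union E, hz, htr,
      isSeparatrix h1 h2, fun w => arcsThroughF h1 h2⟩
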